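/- Let $n\ge 1$ and $m\ge 2$ be integers and write $L^s=L^s(\mathbb R^n)$ (complex-valued functions, Lebesgue measure). An $m$-linear Calderón–Zygmund operator is an $m$-linear operator $T$, initially defined on $C_c^\infty(\mathbb R^n)^m$ with values in the measurable functions, such that: (a) for some $s_1,\dots,s_m\in(1,\infty]$ with $\frac1s:=\sum_i\frac1{s_i}\in(0,\infty)$ there is a constant $C$ with $\|T(f_1,\dots,f_m)\|_s\le C\prod_i\|f_i\|_{s_i}$ for all $f_i\in C_c^\infty(\mathbb R^n)$; (b) there is a function $K:(\mathbb R^n)^{m+1}\setminus\{x=y_1=\dots=y_m\}\to\mathbb C$, a constant $C>0$ and an increasing $\omega:[0,1)\to[0,\infty)$ with $\omega(0)=0$ and $\int_0^1\omega(t)\frac{dt}t<\infty$ such that $$|K(x,y_1,\dots,y_m)|\le \frac{C}{(\sum_i|x-y_i|)^{mn}}$$ off the diagonal $x=y_1=\dots=y_m$; such that, for all $(x,y_1,\dots,y_m)$ off the diagonal and all $h\in\mathbb R^n$ with $|h|\le\frac12\max_i|x-y_i|$, $$|K(x+h,y_1,\dots,y_m)-K(x,y_1,\dots,y_m)|+\sum_{i=1}^m|K(x,y_1,\dots,y_i+h,\dots,y_m)-K(x,y_1,\dots,y_m)|\le\frac{C}{(\sum_i|x-y_i|)^{mn}}\,\omega\Big(\frac{|h|}{\sum_i|x-y_i|}\Big);$$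 and such that, for all $f_1,\dots,f_m\in C_c^\infty(\mathbb R^n)$ and almost every $x\notin\bigcap_i\operatorname{supp}f_i$, $$T(f_1,\dots,f_m)(x)=\int_{\mathbb R^{mn}}K(x,y_1,\dots,y_m)\prod_{i=1}^m f_i(y_i)\,dy_1\cdots dy_m .$$ A Calderón–Zygmund operator $T$ is non-degenerate if it has a kernel $K$ satisfying the three displayed conditions, where for this kernel $\omega$ is only required to be increasing with $\omega(0)=0$ and $\omega(t)\to0$ as $t\to0^+$, and if, in addition, there is a $c_0>0$ such that for every $y\in\mathbb R^n$ and $\rho>0$ there is an $x\in\mathbb R^n$ with $|x-y|\ge \rho$ and $|K(x,y,\dots,y)|\ge \frac1{c_0\rho^{mn}}$. For essentially bounded, compactly supported $f_1,\dots,f_m$, the function $T(f_1,\dots,f_m)$ is defined by continuity: it is the limit in measure of $T(\varphi_1^k,\dots,\varphi_m^k)$, as $k\to\infty$, for all sequences $\varphi_i^k\in C_c^\infty(\mathbb R^n)$ that converge to $f_i$ almost everywhere, are uniformly bounded, and are supported in a common ball. For a locally integrable $b:\mathbb R^n\to\mathbb R$ the commutator is $$[b,T]_1(f_1,\dots,f_m):=b\,T(f_1,\dots,f_m)-T(bf_1,f_2,\dots,f_m),$$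 for essentially bounded, compactly supported $f_1,\dots,f_m$ for which $bf_1$ is essentially bounded and both terms are defined. It is said to be bounded from $L^{p_1}\times\dots\times L^{p_m}$ to $L^q$ if there is a constant $C$ with $\|[b,T]_1(f_1,\dots,f_m)\|_q\le C\prod_i\|f_i\|_{p_i}$ for all such $f_1,\dots,f_m$. **Theorem.** Let $1<q<p<\infty$, let $p_1,\dots,p_m\in(1,\infty)$ with $\frac1p=\sum_{i=1}^m\frac1{p_i}$, and let $\frac1r=\frac1q-\frac1p$. Let $T$ be a non-degenerate $m$-linear Calderón–Zygmund operator and let $b\in L^1_{\mathrm{loc}}(\mathbb R^n)$ be real-valued. If $[b,T]_1$ is bounded from $L^{p_1}\times\dots\times L^{p_m}$ to $L^q$, then $b$ belongs to $L^r$ modulo constants, that is, $b\in L^r_{\mathrm{loc}}(\mathbb R^n)$ and $\inf_{c}\|b-c\|_{r}<\infty$, the infimum being over constants $c$. -/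

import Mathlib

open MeasureTheory Filter Topology
open scoped ENNReal NNReal

noncomputable section

namespace MultilinearCZ

/-- The Euclidean space `ℝⁿ`. -/
abbrev Rn (n : ℕ) : Type := EuclideanSpace ℝ (Fin n)

/-- `C_c^∞(ℝⁿ)`, complex valued (the order of smoothness is `(⊤ : ℕ∞)`, that is, `C^∞`). -/
abbrev TestFn (n : ℕ) : Type :=
  TestFunction (⊤ : TopologicalSpace.Opens (Rn n)) ℂ (⊤ : ℕ∞)

/-- An `m`-linear operator, initially defined on `C_c^∞(ℝⁿ) × ⋯ × C_c^∞(ℝⁿ)`, with values in the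
measurable functions modulo equality almost everywhere. -/
abbrev InitialOperator (n m : ℕ) : Type :=
  MultilinearMap ℂ (fun _ : Fin m => TestFn n) (Rn n →ₘ[(volume : Measure (Rn n))] ℂ)

/-- `T` is initially bounded from `L^{q₁} × ⋯ × L^{q_m}` to `L^q`, for some `q_i ∈ (1,∞]` with
`1/q := ∑ 1/q_i ∈ (0,∞)`. Here `q` may be smaller than `1`. -/
def InitiallyBounded {n m : ℕ} (T : InitialOperator n m) : Prop :=
  ∃ (s : Fin m → ℝ≥0∞) (q : ℝ≥0∞),
    (∀ i, 1 < s i) ∧ q⁻¹ = ∑ i, (s i)⁻¹ ∧ 0 < q⁻¹ ∧ q⁻¹ < ∞ ∧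
    ∃ C : ℝ≥0, ∀ f : Fin m → TestFn n,
      eLpNorm (T f) q volume ≤ C * ∏ i, eLpNorm (f i) (s i) volume

/-! ### Kernels

A kernel is a function `K x y` of `x ∈ ℝⁿ` and `y = (y₁, …, y_m) ∈ (ℝⁿ)^m`; only its values off the
diagonal `x = y₁ = ⋯ = y_m`, that is, at points with `y i ≠ x` for some `i`, play a role. -/

/-- The size condition. -/
def SizeCondition {n m : ℕ} (K : Rn n → (Fin m → Rn n) → ℂ) : Prop :=
  ∃ C : ℝ, 0 < C ∧ ∀ (x : Rn n) (y : Fin m → Rn n), (∃ i, y i ≠ x) →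
    ‖K x y‖ ≤ C / (∑ i, ‖x - y i‖) ^ (m * n)

/-- The regularity condition with modulus `ω`. The condition `∃ j, ‖h‖ ≤ ‖x - y j‖ / 2` says that
`‖h‖` is at most half of the maximum of the `‖x - y j‖`. -/
def RegularityCondition {n m : ℕ} (K : Rn n → (Fin m → Rn n) → ℂ) (ω : ℝ → ℝ) : Prop :=
  ∃ C : ℝ, 0 < C ∧ ∀ (x : Rn n) (y : Fin m → Rn n) (h : Rn n), (∃ i, y i ≠ x) →
    (∃ j, ‖h‖ ≤ ‖x - y j‖ / 2) →
    ‖K (x + h) y - K x y‖ + ∑ i, ‖K x (Function.update y i (y i + h)) - K x y‖ ≤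
      C / (∑ i, ‖x - y i‖) ^ (m * n) * ω (‖h‖ / ∑ i, ‖x - y i‖)

/-- `ω : [0,1) → [0,∞)` is increasing with `ω 0 = 0`. -/
structure IsModulus (ω : ℝ → ℝ) : Prop where
  nonneg : ∀ t ∈ Set.Ico (0 : ℝ) 1, 0 ≤ ω t
  mono : MonotoneOn ω (Set.Ico 0 1)
  zero : ω 0 = 0

/-- The Dini condition `∫₀¹ ω(t)/t dt < ∞`. -/
def DiniCondition (ω : ℝ → ℝ) : Prop :=
  ∫⁻ t in Set.Ioo (0 : ℝ) 1, ENNReal.ofReal (ω t / t) < ∞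

/-- The kernel representation of `T` on test functions, off the intersection of the supports. -/
def KernelRepresentation {n m : ℕ} (T : InitialOperator n m)
    (K : Rn n → (Fin m → Rn n) → ℂ) : Prop :=
  ∀ f : Fin m → TestFn n, ∀ᵐ x : Rn n, x ∉ ⋂ i, tsupport (f i) →
    T f x = ∫ y : Fin m → Rn n, K x y * ∏ i, f i (y i)

/-- The non-degeneracy condition of a kernel. -/
def NondegenerateKernel {n m : ℕ} (K : Rn n → (Fin m → Rn n) → ℂ) : Prop :=
  ∃ c₀ : ℝ, 0 < c₀ ∧ ∀ (y : Rn n) (r : ℝ), 0 < r →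
    ∃ x : Rn n, x ∉ Metric.ball y r ∧ 1 / (c₀ * r ^ (m * n)) ≤ ‖K x (fun _ => y)‖

/-- `m`-linear Calderón–Zygmund operators. -/
def IsCZO {n m : ℕ} (T : InitialOperator n m) : Prop :=
  InitiallyBounded T ∧
  ∃ (K : Rn n → (Fin m → Rn n) → ℂ) (ω : ℝ → ℝ),
    IsModulus ω ∧ DiniCondition ω ∧ SizeCondition K ∧ RegularityCondition K ω ∧
    KernelRepresentation T K

/-- Non-degenerate `m`-linear Calderón–Zygmund operators. -/
def IsNondegenerateCZO {n m : ℕ} (T : InitialOperator n m) : Prop :=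
  IsCZO T ∧
  ∃ (K : Rn n → (Fin m → Rn n) → ℂ) (ω : ℝ → ℝ),
    IsModulus ω ∧ Tendsto ω (𝓝[>] 0) (𝓝 0) ∧ SizeCondition K ∧ RegularityCondition K ω ∧
    KernelRepresentation T K ∧ NondegenerateKernel K

/-! ### The extension of `T` and the commutator -/

/-- `L^∞_c(ℝⁿ)`: essentially bounded functions with compact support. -/
def MemLinftyC {n : ℕ} (f : Rn n → ℂ) : Prop :=
  MemLp f ∞ volume ∧ HasCompactSupport f

/-- The test functions `φ k` converge to `f` almost everywhere, are bounded uniformly in `k`, and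
are supported in a common ball. -/
def BoundedlyApproximates {n : ℕ} (φ : ℕ → TestFn n) (f : Rn n → ℂ) : Prop :=
  (∃ M : ℝ, ∀ k x, ‖φ k x‖ ≤ M) ∧
  (∃ R : ℝ, ∀ k, tsupport (φ k) ⊆ Metric.closedBall 0 R) ∧
  ∀ᵐ x : Rn n, Tendsto (fun k => φ k x) atTop (𝓝 (f x))

/-- `h` is the value `T(f₁, …, f_m)` of the extension of `T` by continuity to
`f₁, …, f_m ∈ L^∞_c`: it is the limit in measure of `T(φ₁ k, …, φ_m k)` along all bounded
approximations of the `f_i` by test functions. Such approximations exist (mollify the `f_i`), so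
`h` is unique. As these approximations converge in every `L^s` with `s < ∞`, every continuous
extension of `T` to a product of `L^s` spaces with finite exponents has this value. -/
def IsValue {n m : ℕ} (T : InitialOperator n m) (f : Fin m → Rn n → ℂ)
    (h : Rn n →ₘ[(volume : Measure (Rn n))] ℂ) : Prop :=
  (∀ i, MemLinftyC (f i)) ∧
  ∀ φ : ℕ → Fin m → TestFn n, (∀ i, BoundedlyApproximates (fun k => φ k i) (f i)) →
    TendstoInMeasure volume (fun k => (T (φ k) : Rn n → ℂ)) atTop h

/-- `g = [b,T]_i(f₁, …, f_m) = b T(f₁, …, f_m) - T(f₁, …, b f_i, …, f_m)`, for functions `f_j` for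
which both terms are defined. In particular `f_1, …, f_m` and `b f_i` belong to `L^∞_c`. -/
def IsCommutatorValue {n m : ℕ} (b : Rn n → ℝ) (T : InitialOperator n m) (i : Fin m)
    (f : Fin m → Rn n → ℂ) (g : Rn n → ℂ) : Prop :=
  ∃ h₀ h₁ : Rn n →ₘ[(volume : Measure (Rn n))] ℂ,
    IsValue T f h₀ ∧
    IsValue T (Function.update f i (fun x => (b x : ℂ) * f i x)) h₁ ∧
    g =ᵐ[volume] fun x => (b x : ℂ) * h₀ x - h₁ x

/-- `[b,T]_i` is bounded from `L^{p₁} × ⋯ × L^{p_m}` to `L^q`. The bound is only asked for on the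
functions for which `[b,T]_i` is defined above (for a real-valued, measurable `b`, these
are dense in the spaces `L^{p_j}` with `p_j < ∞`). -/
def CommutatorBounded {n m : ℕ} (b : Rn n → ℝ) (T : InitialOperator n m) (i : Fin m)
    (p : Fin m → ℝ≥0∞) (q : ℝ≥0∞) : Prop :=
  ∃ C : ℝ≥0, ∀ (f : Fin m → Rn n → ℂ) (g : Rn n → ℂ), IsCommutatorValue b T i f g →
    eLpNorm g q volume ≤ C * ∏ j, eLpNorm (f j) (p j) volume

/-- The space `L^r` modulo constants: `b ∈ L^r_loc` and `inf_c ‖b - c‖_r < ∞`. -/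
def MemDotLp {n : ℕ} (b : Rn n → ℝ) (r : ℝ≥0∞) : Prop :=
  (∀ (x : Rn n) (R : ℝ), MemLp b r (volume.restrict (Metric.ball x R))) ∧
  (⨅ c : ℝ, eLpNorm (fun x => b x - c) r volume) < ∞

end MultilinearCZ

end

/-! It suffices to bound `X = ∑ o_j ^ r |B_j|` over all finite sparse families of balls `B_j`, where
`o_j` is at most the mean of `|b - α|` over `B_j` for every constant `α`. The bound may depend on
the sparseness constant only.

One ball (`exists_local_lower_bound`). Non-degeneracy, together with size and regularity, gives a
ball `B'` of the same radius as `B`, at comparable distance, such that on `B' × B × ⋯ × B` the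
kernel stays within `|z| / 2` of a constant `z` with `|z| ≳ |B| ^ (-m)`. Let `α` be a median of `b`
on `B'`. For a sign `σ`, let `E` be the part of `B` where `0 ≤ σ(b - α) ≤ N` and `F` the part of
`B'` where `σ(b - α) ≤ 0`. For `x ∈ F` and `y ∈ E` the difference `b(x) - b(y)` has constant sign
and modulus at least `|b(y) - α|`, so nothing cancels. With the right `σ` and `N`, testing
`[b,T]_1(1_E, 1_B, …, 1_B)` on `F` controls `∫_B |b - α|`. The truncation at `N` keeps `b 1_E`
bounded, as the definition of the commutator requires.

Many balls (`CommutatorBounded.memDotLp`). Put weights `o_j ^ (r/p_i)` on the indicators in slot `i`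
and `o_j ^ (r/q')` on those of the sets `F_j`. As `1/q' + ∑ 1/p_i = 1 - 1/r`, the diagonal terms of
the pairing add up to at least a multiple of `X`. Averaging over independent signs removes the mixed
terms (`exists_signs`). Hölder, the assumed bound and the Carleson estimate `‖∑ μ_j 1_{B_j}‖_s ^ s ≲
∑ μ_j ^ s |B_j|` for sparse families bound the pairing by a multiple of `X ^ (1 - 1/r)`. As `X` is
finite, it is bounded.

From sparse sums to `L^r` (`memDotLp_of_sparse`). A stopping time on the dyadic subcubes of a large
cube dominates `|b - ⟨b⟩|` by a sum of mean oscillations over sparse cubes. The Carleson estimate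
bounds its `L^r` norm uniformly in the large cube, and a limit over growing cubes produces the
constant.

The bound on the commutator is assumed only where `T` has a value, so such values must be shown to
exist for bounded, compactly supported functions (`IsCZO.exists_isValue`). This is delicate when the
initial bound involves `L^∞`, because bounded approximations do not converge there. A smooth
Calderón–Zygmund decomposition and the Dini condition give continuity in measure instead
(`IsCZO.exists_integral_le`). This part uses the Dini kernel; the lower bound uses the
non-degenerate one. -/

namespace MultilinearCZ

/-! ### Carleson packing -/

/-- The balls `closedBall (c j) (ρ j)` satisfy a Carleson packing condition with constant `Λ`. -/
def CarlesonPacking {n : ℕ} {ι : Type} (Λ : ℝ≥0∞) (c : ι → Rn n) (ρ : ι → ℝ) : Prop :=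
  ∀ t : Finset ι, ∑ j ∈ t, volume (Metric.closedBall (c j) (ρ j)) ≤
    Λ * volume (⋃ j ∈ t, Metric.closedBall (c j) (ρ j))

theorem volume_biUnion_closedBall_le {n : ℕ} {ι : Type} (t : Finset ι) (c : ι → Rn n)
    (ρ : ι → ℝ) (hρ : ∀ j, 0 < ρ j) :
    ∃ u ⊆ t, ((u : Set ι).PairwiseDisjoint fun j => Metric.closedBall (c j) (ρ j)) ∧
      volume (⋃ j ∈ t, Metric.closedBall (c j) (ρ j)) ≤
        ENNReal.ofReal (4 ^ n) * ∑ j ∈ u, volume (Metric.closedBall (c j) (ρ j)) := by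
  classical
  obtain ⟨R, hR⟩ : ∃ R, ∀ a ∈ t, ρ a ≤ R := by
    obtain ⟨R, hR⟩ := (t.image ρ).bddAbove
    exact ⟨R, fun a ha => hR (by simpa using ⟨a, ha, rfl⟩)⟩
  obtain ⟨u, hut, hdis, hcov⟩ := Vitali.exists_disjoint_subfamily_covering_enlargement_closedBall
    (t : Set ι) c ρ R hR 4 (by norm_num)
  refine ⟨t.filter (· ∈ u), Finset.filter_subset _ _, ?_, ?_⟩
  · intro a ha b hb hab
    simp only [Finset.coe_filter, Set.mem_ofPred_eq] at ha hb
    exact hdis ha.2 hb.2 hab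
  · have hsub : (⋃ j ∈ t, Metric.closedBall (c j) (ρ j)) ⊆
        ⋃ j ∈ t.filter (· ∈ u), Metric.closedBall (c j) (4 * ρ j) := by
      intro x hx
      simp only [Set.mem_iUnion] at hx ⊢
      obtain ⟨j, hj, hx⟩ := hx
      obtain ⟨b, hb, hsub⟩ := hcov j hj
      exact ⟨b, by simpa using ⟨hut hb, hb⟩, hsub hx⟩
    refine (measure_mono hsub).trans ((measure_biUnion_finset_le _ _).trans ?_)
    rw [Finset.mul_sum]
    refine Finset.sum_le_sum fun j _ => ?_
    rw [Measure.addHaar_closedBall_mul _ _ (by norm_num) (hρ j).le]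
    simp only [finrank_euclideanSpace, Fintype.card_fin]
    exact (congrArg _ (Measure.addHaar_closedBall_center _ _ _).symm).le

/-- Packing replaces the sum of volumes by the volume of the union, and Vitali replaces the union by
disjoint balls. On each of these the points with `g ≤ s / 2` supply at most half of the integral of
`g`, so the set `{s < 2 g}` carries the rest. Restricting to this set is what makes the weak-type
bound integrable in `s`. -/
theorem CarlesonPacking.sum_volume_le {n : ℕ} {ι : Type} {Λ : ℝ≥0∞} {c : ι → Rn n} {ρ : ι → ℝ}
    (hpack : CarlesonPacking Λ c ρ) (hρ : ∀ j, 0 < ρ j) {g : Rn n → ℝ} (hg : Measurable g)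
    {s : ℝ} (hs : 0 < s) (t : Finset ι)
    (ht : ∀ j ∈ t, ENNReal.ofReal s * volume (Metric.closedBall (c j) (ρ j)) <
      ∫⁻ x in Metric.closedBall (c j) (ρ j), ENNReal.ofReal (g x)) :
    (∑ j ∈ t, volume (Metric.closedBall (c j) (ρ j))) * ENNReal.ofReal s ≤
      Λ * ENNReal.ofReal (4 ^ n) * 2 *
        ∫⁻ x in {x | s < 2 * g x}, ENNReal.ofReal (g x) := by
  obtain ⟨u, hut, hdis, hcov⟩ := volume_biUnion_closedBall_le t c ρ hρ
  have hmeas : MeasurableSet {x | s < 2 * g x} :=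
    measurableSet_lt measurable_const (hg.const_mul 2)
  have key : ∀ j ∈ u, volume (Metric.closedBall (c j) (ρ j)) * ENNReal.ofReal s ≤
      2 * ∫⁻ x in Metric.closedBall (c j) (ρ j),
        {x | s < 2 * g x}.indicator (fun x => ENNReal.ofReal (g x)) x := by
    intro j hj
    have h1 : ∫⁻ x in Metric.closedBall (c j) (ρ j), ENNReal.ofReal (g x) ≤
        (∫⁻ x in Metric.closedBall (c j) (ρ j),
          {x | s < 2 * g x}.indicator (fun x => ENNReal.ofReal (g x)) x) +
        ENNReal.ofReal (s / 2) * volume (Metric.closedBall (c j) (ρ j)) := by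
      rw [← setLIntegral_const, ← lintegral_add_right _ measurable_const]
      refine lintegral_mono fun x => ?_
      by_cases hx : s < 2 * g x
      · rw [Set.indicator_of_mem (by exact hx)]; exact le_self_add
      · rw [Set.indicator_of_notMem (by exact hx), zero_add]
        exact ENNReal.ofReal_le_ofReal (by linarith)
    have h2 := (ht j (hut hj)).le.trans h1
    have h3 : ENNReal.ofReal s = ENNReal.ofReal (s / 2) + ENNReal.ofReal (s / 2) := by
      rw [← ENNReal.ofReal_add (by positivity) (by positivity)]; ring_nf
    have hfin : ENNReal.ofReal (s / 2) * volume (Metric.closedBall (c j) (ρ j)) ≠ ∞ :=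
      ENNReal.mul_ne_top ENNReal.ofReal_ne_top measure_closedBall_lt_top.ne
    have h4 : ENNReal.ofReal (s / 2) * volume (Metric.closedBall (c j) (ρ j)) ≤
        ∫⁻ x in Metric.closedBall (c j) (ρ j),
          {x | s < 2 * g x}.indicator (fun x => ENNReal.ofReal (g x)) x := by
      rw [h3, add_mul] at h2
      exact (ENNReal.add_le_add_iff_right hfin).1 h2
    calc _ = 2 * (ENNReal.ofReal (s / 2) * volume (Metric.closedBall (c j) (ρ j))) := by
          rw [h3]; ring
      _ ≤ _ := by gcongr
  calc (∑ j ∈ t, volume (Metric.closedBall (c j) (ρ j))) * ENNReal.ofReal s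
      ≤ (Λ * (ENNReal.ofReal (4 ^ n) * ∑ j ∈ u, volume (Metric.closedBall (c j) (ρ j)))) *
          ENNReal.ofReal s := by
        gcongr
        exact (hpack t).trans (by gcongr)
    _ = Λ * ENNReal.ofReal (4 ^ n) *
          ∑ j ∈ u, volume (Metric.closedBall (c j) (ρ j)) * ENNReal.ofReal s := by
        rw [← Finset.sum_mul]; ring
    _ ≤ Λ * ENNReal.ofReal (4 ^ n) * ∑ j ∈ u, 2 * ∫⁻ x in Metric.closedBall (c j) (ρ j),
        {x | s < 2 * g x}.indicator (fun x => ENNReal.ofReal (g x)) x := by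
        exact mul_le_mul_right (Finset.sum_le_sum key) _
    _ = Λ * ENNReal.ofReal (4 ^ n) * 2 * ∫⁻ x in ⋃ j ∈ u, Metric.closedBall (c j) (ρ j),
        {x | s < 2 * g x}.indicator (fun x => ENNReal.ofReal (g x)) x := by
        rw [← Finset.mul_sum, lintegral_biUnion_finset hdis
          (fun j _ => Metric.isClosed_closedBall.measurableSet)]
        ring
    _ ≤ Λ * ENNReal.ofReal (4 ^ n) * 2 *
        ∫⁻ x, {x | s < 2 * g x}.indicator (fun x => ENNReal.ofReal (g x)) x := by
        gcongr
        exact Measure.restrict_le_self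
    _ = _ := by rw [lintegral_indicator hmeas]

/-- The Carleson embedding theorem: the weak-type bound above, multiplied by `s ^ (p - 2)` and
integrated over `s`. -/
theorem CarlesonPacking.sum_volume_mul_average_rpow_le {n : ℕ} {ι : Type} [Fintype ι] {Λ : ℝ≥0∞}
    {c : ι → Rn n} {ρ : ι → ℝ} (hpack : CarlesonPacking Λ c ρ) (hρ : ∀ j, 0 < ρ j)
    {g : Rn n → ℝ} (hg : Measurable g) (hg0 : ∀ x, 0 ≤ g x) {a : ι → ℝ} (ha : ∀ j, 0 ≤ a j)
    (hga : ∀ j, ENNReal.ofReal (a j) * volume (Metric.closedBall (c j) (ρ j)) =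
      ∫⁻ x in Metric.closedBall (c j) (ρ j), ENNReal.ofReal (g x)) {p : ℝ} (hp : 1 < p) :
    ∑ j, ENNReal.ofReal (a j ^ p) * volume (Metric.closedBall (c j) (ρ j)) ≤
      ENNReal.ofReal p * (Λ * ENNReal.ofReal (4 ^ n) * 2) *
        ((ENNReal.ofReal (p - 1))⁻¹ * ENNReal.ofReal (2 ^ (p - 1))) *
          ∫⁻ x, ENNReal.ofReal (g x ^ p) := by
  classical
  let _ : MeasurableSpace ι := ⊤
  set w : ι → ℝ≥0∞ := fun j => volume (Metric.closedBall (c j) (ρ j)) with hw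
  -- With this discrete measure on the indices the weighted sum is an integral, to which the layer
  -- cake formula applies.
  set μ : Measure ι := ∑ j, w j • Measure.dirac j with hμ
  have hwpos : ∀ j, 0 < w j := fun j => Metric.measure_closedBall_pos _ _ (hρ j)
  have hwfin : ∀ j, w j ≠ ∞ := fun j => measure_closedBall_lt_top.ne
  have hint : ∀ f : ι → ℝ≥0∞, ∫⁻ j, f j ∂μ = ∑ j, w j * f j := by
    intro f
    rw [hμ, lintegral_finsetSum_measure]
    exact Finset.sum_congr rfl fun j _ => by
      rw [lintegral_smul_measure, lintegral_dirac' _ (by measurability)]; rfl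
  have h1 := lintegral_rpow_eq_lintegral_meas_lt_mul (μ := μ) (f := a)
    (Eventually.of_forall ha) (by fun_prop) (p := p) (by linarith)
  rw [hint] at h1
  -- On the right the layer cake formula is read for the measure `g dx`, the function `2 g` and the
  -- exponent `p - 1`; the product of `g` and `(2 g) ^ (p - 1)` gives back `g ^ p`.
  have h2 := lintegral_rpow_eq_lintegral_meas_lt_mul
    (μ := volume.withDensity fun x => ENNReal.ofReal (g x)) (f := fun x => 2 * g x)
    (Eventually.of_forall fun x => by simpa using hg0 x) (by fun_prop) (p := p - 1) (by linarith)
  have hp1 : ENNReal.ofReal (p - 1) ≠ 0 := by simpa using hp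
  have hlev : ∀ s ∈ Set.Ioi (0 : ℝ), μ {j | s < a j} * ENNReal.ofReal (s ^ (p - 1)) ≤
      (Λ * ENNReal.ofReal (4 ^ n) * 2) *
      ((volume.withDensity fun x => ENNReal.ofReal (g x)) {x | s < 2 * g x} *
        ENNReal.ofReal (s ^ (p - 1 - 1))) := by
    intro s hs
    have hs : 0 < s := hs
    have hμs : μ {j | s < a j} = ∑ j with s < a j, w j := by
      rw [← lintegral_indicator_one (by trivial), hint, Finset.sum_filter]
      refine Finset.sum_congr rfl fun j _ => ?_
      by_cases h : s < a j <;> simp [h, Set.indicator]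
    have hmeas : MeasurableSet {x | s < 2 * g x} :=
      measurableSet_lt measurable_const (hg.const_mul 2)
    rw [withDensity_apply _ hmeas, hμs]
    have := hpack.sum_volume_le hρ hg hs (Finset.univ.filter fun j => s < a j) (by
      intro j hj
      rw [← hga j]
      have hj : s < a j := by simpa using hj
      exact (ENNReal.mul_lt_mul_iff_left (hwpos j).ne' (hwfin j)).2
        ((ENNReal.ofReal_lt_ofReal_iff (hs.trans hj)).2 hj))
    have he : ENNReal.ofReal (s ^ (p - 1)) =
        ENNReal.ofReal s * ENNReal.ofReal (s ^ (p - 1 - 1)) := by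
      rw [← ENNReal.ofReal_mul hs.le, ← Real.rpow_one_add' hs.le (by linarith)]; congr 2; ring
    rw [he, ← mul_assoc, ← mul_assoc]
    gcongr
  have h3 : ∫⁻ s in Set.Ioi (0 : ℝ), ((volume.withDensity fun x => ENNReal.ofReal (g x))
      {x | s < 2 * g x} * ENNReal.ofReal (s ^ (p - 1 - 1))) =
      ((ENNReal.ofReal (p - 1))⁻¹ * ENNReal.ofReal (2 ^ (p - 1))) *
          ∫⁻ x, ENNReal.ofReal (g x ^ p) := by
    rw [lintegral_withDensity_eq_lintegral_mul _ (by fun_prop) (by fun_prop)] at h2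
    have h4 : ∫⁻ x, ((fun x => ENNReal.ofReal (g x)) *
        fun x => ENNReal.ofReal ((2 * g x) ^ (p - 1))) x =
        ENNReal.ofReal (2 ^ (p - 1)) * ∫⁻ x, ENNReal.ofReal (g x ^ p) := by
      rw [← lintegral_const_mul _ (by fun_prop)]
      refine lintegral_congr fun x => ?_
      simp only [Pi.mul_apply]
      rw [← ENNReal.ofReal_mul (hg0 x), ← ENNReal.ofReal_mul (by positivity),
        Real.mul_rpow (by norm_num) (hg0 x)]
      congr 1
      have : g x ^ p = g x * g x ^ (p - 1) := by
        rw [← Real.rpow_one_add' (hg0 x) (by linarith)]; congr 1; ring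
      rw [this]; ring
    rw [h4] at h2
    rw [mul_assoc, h2, ← mul_assoc, ENNReal.inv_mul_cancel hp1 ENNReal.ofReal_ne_top, one_mul]
  calc ∑ j, ENNReal.ofReal (a j ^ p) * w j = ∑ j, w j * ENNReal.ofReal (a j ^ p) := by
        simp_rw [mul_comm]
    _ = _ := h1
    _ ≤ ENNReal.ofReal p * ∫⁻ s in Set.Ioi (0 : ℝ), (Λ * ENNReal.ofReal (4 ^ n) * 2) *
      ((volume.withDensity fun x => ENNReal.ofReal (g x)) {x | s < 2 * g x} *
        ENNReal.ofReal (s ^ (p - 1 - 1))) := by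
        refine mul_le_mul_right ?_ _
        exact setLIntegral_mono' measurableSet_Ioi hlev
    _ = _ := by
        rw [lintegral_const_mul, h3]
        · ring
        · refine Measurable.mul ?_ (by fun_prop)
          refine Antitone.measurable ?_
          intro s s' hss
          exact measure_mono fun x (hx : s' < 2 * g x) => lt_of_le_of_lt hss hx

/-- Dual to the Carleson embedding. Let `G` be the sum and test it against `g = G ^ (s - 1)`, whose
`s'`-th power is `G ^ s`. Then `∫ G ^ s` is the sum of `μ_j a_j |B_j|`, with `a_j` the average of
`g`; Young's inequality splits the products and the embedding absorbs the `a_j`. -/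
theorem CarlesonPacking.lintegral_sum_indicator_rpow_le (n : ℕ) {Λ : ℝ≥0∞} (hΛ : Λ ≠ ∞)
    {s : ℝ} (hs : 1 < s) :
    ∃ C : ℝ≥0∞, C ≠ ∞ ∧ ∀ (ι : Type) [Fintype ι] (c : ι → Rn n) (ρ : ι → ℝ) (μ : ι → ℝ),
      CarlesonPacking Λ c ρ → (∀ j, 0 < ρ j) → (∀ j, 0 ≤ μ j) →
      ∫⁻ x, ENNReal.ofReal
        ((∑ j, (Metric.closedBall (c j) (ρ j)).indicator (fun _ => μ j) x) ^ s) ≤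
      C * ∑ j, ENNReal.ofReal (μ j ^ s) * volume (Metric.closedBall (c j) (ρ j)) := by
  obtain ⟨s', hss'⟩ : ∃ s', Real.HolderConjugate s s' := ⟨_, Real.HolderConjugate.conjExponent hs⟩
  have hs' : 1 < s' := hss'.symm.lt
  set D : ℝ≥0∞ := ENNReal.ofReal s' * (Λ * ENNReal.ofReal (4 ^ n) * 2) *
        ((ENNReal.ofReal (s' - 1))⁻¹ * ENNReal.ofReal (2 ^ (s' - 1))) with hD
  have hDfin : D ≠ ∞ := by
    have : ENNReal.ofReal (s' - 1) ≠ 0 := by simpa using hs'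
    have := ENNReal.inv_ne_top.2 this
    finiteness
  -- With this `δ` in Young's inequality, the terms in `a_j` amount to at most half of the left-hand
  -- side.
  obtain ⟨δ, hδ, hδD⟩ : ∃ δ : ℝ, 0 < δ ∧ ENNReal.ofReal (δ ^ s' / s') * D ≤ 1 / 2 := by
    refine ⟨(1 / (2 * (D.toReal + 1)) * s') ^ (1 / s'), by positivity, ?_⟩
    rw [← Real.rpow_mul (by positivity), one_div_mul_cancel (by linarith), Real.rpow_one,
      mul_div_cancel_right₀ _ (by linarith)]
    rw [← ENNReal.ofReal_toReal hDfin, ← ENNReal.ofReal_mul (by positivity)]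
    have : (1 / 2 : ℝ≥0∞) = ENNReal.ofReal (1 / 2) := by
      rw [ENNReal.ofReal_div_of_pos (by norm_num)]; simp
    rw [this]
    apply ENNReal.ofReal_le_ofReal
    have := ENNReal.toReal_nonneg (a := D)
    rw [ENNReal.toReal_ofReal this, one_div_mul_eq_div, div_le_div_iff₀ (by positivity) (by norm_num)]
    linarith
  refine ⟨2 * ENNReal.ofReal (δ⁻¹ ^ s / s), by finiteness, ?_⟩
  intro ι _ c ρ μ hpack hρ hμ
  set G : Rn n → ℝ :=
    fun x => ∑ j, (Metric.closedBall (c j) (ρ j)).indicator (fun _ => μ j) x with hG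
  have hmB : ∀ j, MeasurableSet (Metric.closedBall (c j) (ρ j)) :=
    fun j => Metric.isClosed_closedBall.measurableSet
  have hGm : Measurable G :=
    Finset.measurable_fun_sum _ fun j _ => measurable_const.indicator (hmB j)
  have hind0 : ∀ j x, 0 ≤ (Metric.closedBall (c j) (ρ j)).indicator (fun _ => μ j) x :=
    fun j x => Set.indicator_nonneg (fun _ _ => hμ j) x
  have hG0 : ∀ x, 0 ≤ G x := fun x => Finset.sum_nonneg fun j _ => hind0 j x
  have hGle : ∀ x, G x ≤ ∑ j, μ j := fun x => Finset.sum_le_sum fun j _ =>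
    Set.indicator_le_self' (fun _ _ => hμ j) x
  set g : Rn n → ℝ := fun x => G x ^ (s - 1) with hg
  have hgm : Measurable g := by fun_prop
  have hg0 : ∀ x, 0 ≤ g x := fun x => Real.rpow_nonneg (hG0 x) _
  have hgle : ∀ x, g x ≤ (∑ j, μ j) ^ (s - 1) := fun x =>
    Real.rpow_le_rpow (hG0 x) (hGle x) (by linarith)
  set w : ι → ℝ≥0∞ := fun j => volume (Metric.closedBall (c j) (ρ j)) with hw
  have hwpos : ∀ j, w j ≠ 0 := fun j => (Metric.measure_closedBall_pos _ _ (hρ j)).ne'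
  have hwfin : ∀ j, w j ≠ ∞ := fun j => measure_closedBall_lt_top.ne
  have hgfin : ∀ j, ∫⁻ x in Metric.closedBall (c j) (ρ j), ENNReal.ofReal (g x) ≠ ∞ := by
    intro j
    refine ne_top_of_le_ne_top ?_ (lintegral_mono fun x => ENNReal.ofReal_le_ofReal (hgle x))
    rw [setLIntegral_const]
    exact ENNReal.mul_ne_top ENNReal.ofReal_ne_top (hwfin j)
  set a : ι → ℝ := fun j =>
    ((∫⁻ x in Metric.closedBall (c j) (ρ j), ENNReal.ofReal (g x)) / w j).toReal with ha
  have ha0 : ∀ j, 0 ≤ a j := fun j => ENNReal.toReal_nonneg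
  have hga : ∀ j, ENNReal.ofReal (a j) * w j =
      ∫⁻ x in Metric.closedBall (c j) (ρ j), ENNReal.ofReal (g x) := by
    intro j
    rw [ha, ENNReal.ofReal_toReal (ENNReal.div_ne_top (hgfin j) (hwpos j)),
      ENNReal.div_mul_cancel (hwpos j) (hwfin j)]
  have hcarl := hpack.sum_volume_mul_average_rpow_le hρ hgm hg0 ha0 hga hs'
  have hgs : ∀ x, g x ^ s' = G x ^ s := by
    intro x
    rw [hg, ← Real.rpow_mul (hG0 x)]
    congr 1
    exact hss'.sub_one_mul_conj
  simp_rw [hgs] at hcarl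
  set X := ∫⁻ x, ENNReal.ofReal (G x ^ s) with hX
  have hXsum : X = ∑ j, ENNReal.ofReal (μ j * a j) * w j := by
    have h1 : ∀ x, ENNReal.ofReal (G x ^ s) = ∑ j,
        (Metric.closedBall (c j) (ρ j)).indicator
          (fun x => ENNReal.ofReal (μ j) * ENNReal.ofReal (g x)) x := by
      intro x
      have : G x ^ s = G x * g x := by
        rw [hg, ← Real.rpow_one_add' (hG0 x) (by linarith)]; congr 1; ring
      rw [this, ENNReal.ofReal_mul (hG0 x), hG]
      simp only
      rw [ENNReal.ofReal_sum_of_nonneg (fun j _ => hind0 j x), Finset.sum_mul]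
      refine Finset.sum_congr rfl fun j _ => ?_
      by_cases hx : x ∈ Metric.closedBall (c j) (ρ j)
      · simp only [Set.indicator_of_mem hx]
      · simp only [Set.indicator_of_notMem hx, ENNReal.ofReal_zero, zero_mul]
    rw [hX]
    simp_rw [h1]
    rw [lintegral_finsetSum _ fun j _ => (by fun_prop : Measurable _).indicator (hmB j)]
    refine Finset.sum_congr rfl fun j _ => ?_
    rw [lintegral_indicator (hmB j), lintegral_const_mul _ (by fun_prop), ← hga j,
      ENNReal.ofReal_mul (hμ j), mul_assoc]
  -- Absorption needs a finite left-hand side; this is where the family being finite enters.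
  have hXfin : X ≠ ∞ := by
    rw [hXsum]
    exact ENNReal.sum_ne_top.2 fun j _ => ENNReal.mul_ne_top ENNReal.ofReal_ne_top (hwfin j)
  have hyoung : ∀ j, μ j * a j ≤ δ⁻¹ ^ s / s * μ j ^ s + δ ^ s' / s' * a j ^ s' := by
    intro j
    have := Real.young_inequality_of_nonneg (a := δ⁻¹ * μ j) (b := δ * a j)
      (mul_nonneg (by positivity) (hμ j)) (mul_nonneg hδ.le (ha0 j)) hss'
    rw [Real.mul_rpow (by positivity) (hμ j), Real.mul_rpow hδ.le (ha0 j)] at this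
    have h2 : δ⁻¹ * μ j * (δ * a j) = μ j * a j := by field_simp
    rw [h2] at this
    calc _ ≤ _ := this
      _ = _ := by ring
  have hfinal : X ≤ ENNReal.ofReal (δ⁻¹ ^ s / s) * ∑ j, ENNReal.ofReal (μ j ^ s) * w j +
      1 / 2 * X := by
    calc X = ∑ j, ENNReal.ofReal (μ j * a j) * w j := hXsum
      _ ≤ ∑ j, (ENNReal.ofReal (δ⁻¹ ^ s / s) * (ENNReal.ofReal (μ j ^ s) * w j) +
          ENNReal.ofReal (δ ^ s' / s') * (ENNReal.ofReal (a j ^ s') * w j)) := by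
          refine Finset.sum_le_sum fun j _ => ?_
          rw [← mul_assoc, ← mul_assoc, ← add_mul, ← ENNReal.ofReal_mul (by positivity),
            ← ENNReal.ofReal_mul (by positivity), ← ENNReal.ofReal_add
              (mul_nonneg (by positivity) (Real.rpow_nonneg (hμ j) _))
              (mul_nonneg (by positivity) (Real.rpow_nonneg (ha0 j) _))]
          gcongr
          exact hyoung j
      _ ≤ _ := by
          rw [Finset.sum_add_distrib, ← Finset.mul_sum, ← Finset.mul_sum]
          refine add_le_add_right ?_ _
          calc _ ≤ ENNReal.ofReal (δ ^ s' / s') * (D * X) := mul_le_mul_right hcarl _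
            _ ≤ _ := by rw [← mul_assoc]; exact mul_le_mul_left hδD _
  have hhalf : 1 / 2 * X + 1 / 2 * X = X := by
    rw [← add_mul, ENNReal.add_halves, one_mul]
  have h5 : 1 / 2 * X ≤ ENNReal.ofReal (δ⁻¹ ^ s / s) * ∑ j, ENNReal.ofReal (μ j ^ s) * w j := by
    have h6 : 1 / 2 * X + 1 / 2 * X ≤
      ENNReal.ofReal (δ⁻¹ ^ s / s) * ∑ j, ENNReal.ofReal (μ j ^ s) * w j + 1 / 2 * X := by
      rw [hhalf]; exact hfinal
    exact (ENNReal.add_le_add_iff_right (ENNReal.mul_ne_top (by norm_num) hXfin)).1 h6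
  calc X = 2 * (1 / 2 * X) := by
        rw [← mul_assoc, one_div, ENNReal.mul_inv_cancel (by norm_num) (by norm_num), one_mul]
    _ ≤ _ := by rw [mul_assoc]; gcongr

/-! ### Stopping times in nested partitions -/

section Stopping

variable {X β : Type*} [MeasurableSpace X]

/-- The cell of `x` in the `k`-th partition, whose cells are the fibres of `idx k`. -/
def cell (idx : ℕ → X → β) (k : ℕ) (x : X) : Set X := {y | idx k y = idx k x}

/-- The average of `b` over the cell of `x`. -/
noncomputable def cellAvg (μ : Measure X) (idx : ℕ → X → β) (b : X → ℝ) (k : ℕ) (x : X) : ℝ :=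
  ⨍ y in cell idx k x, b y ∂μ

/-- The average over the cell of level `l` of the deviation from the average at level `k`. -/
noncomputable def cellDev (μ : Measure X) (idx : ℕ → X → β) (b : X → ℝ) (k l : ℕ) (x : X) : ℝ :=
  ⨍ y in cell idx l x, |b y - cellAvg μ idx b k x| ∂μ

open Classical in
/-- The level of the smallest stopping cell around `x` of level at most `k`: a cell is stopping if
the mean deviation exceeds twice that of the previous stopping cell. -/
noncomputable def stopLevel (μ : Measure X) (idx : ℕ → X → β) (b : X → ℝ) : ℕ → X → ℕ
  | 0, _ => 0
  | k + 1, x =>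
    let t := stopLevel μ idx b k x
    if 2 * cellDev μ idx b t t x < cellDev μ idx b t (k + 1) x then k + 1 else t

variable {μ : Measure X} {idx : ℕ → X → β} {b : X → ℝ}

omit [MeasurableSpace X] in
theorem cell_eq_of_mem {k : ℕ} {x y : X} (h : y ∈ cell idx k x) : cell idx k y = cell idx k x := by
  have h : idx k y = idx k x := h
  simp only [cell, h]

omit [MeasurableSpace X] in
theorem cell_subset_cell (hnest : ∀ k x y, idx (k + 1) x = idx (k + 1) y → idx k x = idx k y)
    {k l : ℕ} (hkl : k ≤ l) (x : X) : cell idx l x ⊆ cell idx k x := by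
  induction l, hkl using Nat.le_induction with
  | base => exact subset_rfl
  | succ l _ ih => exact fun y hy => ih (hnest l y x hy)

theorem stopLevel_le (k : ℕ) (x : X) : stopLevel μ idx b k x ≤ k := by
  induction k with
  | zero => simp [stopLevel]
  | succ k ih =>
    simp only [stopLevel]
    split_ifs <;> omega

theorem stopLevel_succ_of_lt {k : ℕ} {x : X}
    (h : 2 * cellDev μ idx b (stopLevel μ idx b k x) (stopLevel μ idx b k x) x <
      cellDev μ idx b (stopLevel μ idx b k x) (k + 1) x) :
    stopLevel μ idx b (k + 1) x = k + 1 := by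
  simp only [stopLevel]; rw [if_pos h]

theorem stopLevel_succ_of_not_lt {k : ℕ} {x : X}
    (h : ¬ 2 * cellDev μ idx b (stopLevel μ idx b k x) (stopLevel μ idx b k x) x <
      cellDev μ idx b (stopLevel μ idx b k x) (k + 1) x) :
    stopLevel μ idx b (k + 1) x = stopLevel μ idx b k x := by
  simp only [stopLevel]; rw [if_neg h]

theorem stopLevel_stopLevel (k : ℕ) (x : X) :
    stopLevel μ idx b (stopLevel μ idx b k x) x = stopLevel μ idx b k x := by
  induction k with
  | zero => simp [stopLevel]
  | succ k ih =>
    by_cases h : 2 * cellDev μ idx b (stopLevel μ idx b k x) (stopLevel μ idx b k x) x <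
      cellDev μ idx b (stopLevel μ idx b k x) (k + 1) x
    · rw [stopLevel_succ_of_lt h, stopLevel_succ_of_lt h]
    · rw [stopLevel_succ_of_not_lt h, ih]

theorem cellAvg_congr {k : ℕ} {x y : X} (h : y ∈ cell idx k x) :
    cellAvg μ idx b k y = cellAvg μ idx b k x := by
  simp only [cellAvg, cell_eq_of_mem h]

theorem cellDev_congr {k l : ℕ} {x y : X} (hk : y ∈ cell idx k x) (hl : y ∈ cell idx l x) :
    cellDev μ idx b k l y = cellDev μ idx b k l x := by
  simp only [cellDev, cell_eq_of_mem hl, cellAvg_congr hk]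

theorem stopLevel_congr (hnest : ∀ k x y, idx (k + 1) x = idx (k + 1) y → idx k x = idx k y)
    {k : ℕ} {x y : X} (h : y ∈ cell idx k x) :
    stopLevel μ idx b k y = stopLevel μ idx b k x := by
  induction k with
  | zero => simp [stopLevel]
  | succ k ih =>
    have hk := cell_subset_cell hnest k.le_succ x h
    have ht := cell_subset_cell hnest (stopLevel_le (μ := μ) (idx := idx) (b := b) k x) x hk
    simp only [stopLevel, ih hk]
    rw [cellDev_congr ht ht, cellDev_congr ht h]

/-- Such a set is the union of the cells of its points, and there are only countably many cells. -/
theorem measurableSet_of_saturated [Countable β] (hmeas : ∀ k x, MeasurableSet (cell idx k x))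
    {k : ℕ} {A : Set X} (hA : ∀ y ∈ A, cell idx k y ⊆ A) : MeasurableSet A := by
  have : A = ⋃ z ∈ idx k '' A, idx k ⁻¹' {z} := by
    ext x
    simp only [Set.mem_image, Set.iUnion_exists, Set.biUnion_and', Set.iUnion_iUnion_eq_right,
      Set.mem_iUnion, Set.mem_preimage, Set.mem_singleton_iff, exists_prop]
    exact ⟨fun hx => ⟨x, hx, rfl⟩, fun ⟨y, hy, hxy⟩ => hA y hy hxy⟩
  rw [this]
  refine MeasurableSet.biUnion (Set.to_countable _) ?_
  rintro _ ⟨y, _, rfl⟩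
  exact hmeas k y

theorem mul_measure_le_of_saturated [Countable β] (hmeas : ∀ k x, MeasurableSet (cell idx k x))
    {k : ℕ} {A : Set X} (hA : ∀ y ∈ A, cell idx k y ⊆ A) {F : X → ℝ≥0∞} {c : ℝ≥0∞}
    (h : ∀ y ∈ A, c * μ (cell idx k y) ≤ ∫⁻ x in cell idx k y, F x ∂μ) :
    c * μ A ≤ ∫⁻ x in A, F x ∂μ := by
  have hun : A = ⋃ z : β, A ∩ idx k ⁻¹' {z} := by
    ext x; simp
  have hcell : ∀ z : β, A ∩ idx k ⁻¹' {z} = ∅ ∨ ∃ y ∈ A, A ∩ idx k ⁻¹' {z} = cell idx k y := by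
    intro z
    rcases Set.eq_empty_or_nonempty (A ∩ idx k ⁻¹' {z}) with h0 | ⟨y, hyA, hyz⟩
    · exact Or.inl h0
    · refine Or.inr ⟨y, hyA, ?_⟩
      have hyz : idx k y = z := hyz
      ext x
      refine ⟨fun hx => ?_, fun hx => ⟨hA y hyA hx, ?_⟩⟩
      · have : idx k x = z := hx.2
        exact this.trans hyz.symm
      · have : idx k x = idx k y := hx
        exact this.trans hyz
  have hm : ∀ z, MeasurableSet (A ∩ idx k ⁻¹' {z}) := by
    intro z
    rcases hcell z with h0 | ⟨y, _, h1⟩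
    · rw [h0]; exact MeasurableSet.empty
    · rw [h1]; exact hmeas k y
  have hd : Pairwise (Function.onFun Disjoint fun z => A ∩ idx k ⁻¹' {z}) := by
    intro z w hzw
    refine Set.disjoint_left.2 fun x hx hx' => hzw ?_
    have h1 : idx k x = z := hx.2
    have h2 : idx k x = w := hx'.2
    exact h1.symm.trans h2
  rw [hun, measure_iUnion hd hm, lintegral_iUnion hm hd, ← ENNReal.tsum_mul_left]
  refine ENNReal.tsum_le_tsum fun z => ?_
  rcases hcell z with h0 | ⟨y, hy, h1⟩
  · rw [h0]; simp
  · rw [h1]; exact h y hy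

section Bounds

variable (hnest : ∀ k x y, idx (k + 1) x = idx (k + 1) y → idx k x = idx k y)
  (hmeas : ∀ k x, MeasurableSet (cell idx k x))
  (hpos : ∀ k x, μ (cell idx k x) ≠ 0) (hfin : ∀ k x, μ (cell idx k x) ≠ ∞)
  (hb : ∀ k x, IntegrableOn b (cell idx k x) μ)

include hfin hb in
theorem integrableOn_abs_sub_cell (c : ℝ) (k : ℕ) (x : X) :
    IntegrableOn (fun y => |b y - c|) (cell idx k x) μ :=
  ((hb k x).sub (integrableOn_const (hfin k x))).abs

include hpos hfin in
theorem measureReal_cell_pos (k : ℕ) (x : X) : 0 < μ.real (cell idx k x) :=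
  ENNReal.toReal_pos (hpos k x) (hfin k x)

include hpos hfin in
theorem cellDev_mul (k l : ℕ) (x : X) : cellDev μ idx b k l x * μ.real (cell idx l x) =
    ∫ y in cell idx l x, |b y - cellAvg μ idx b k x| ∂μ := by
  rw [cellDev, setAverage_eq, smul_eq_mul, mul_comm, ← mul_assoc, mul_inv_cancel₀, one_mul]
  exact (measureReal_cell_pos hpos hfin l x).ne'

theorem cellDev_nonneg (k l : ℕ) (x : X) : 0 ≤ cellDev μ idx b k l x := by
  rw [cellDev, setAverage_eq]
  exact smul_nonneg (by positivity) (integral_nonneg fun _ => abs_nonneg _)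

include hpos hfin hb in
theorem abs_cellAvg_sub_le (k l : ℕ) (x : X) :
    |cellAvg μ idx b l x - cellAvg μ idx b k x| ≤ cellDev μ idx b k l x := by
  have hp := measureReal_cell_pos hpos hfin l x
  have h1 : (cellAvg μ idx b l x - cellAvg μ idx b k x) * μ.real (cell idx l x) =
      ∫ y in cell idx l x, (b y - cellAvg μ idx b k x) ∂μ := by
    rw [integral_sub (hb l x) (integrableOn_const (hfin l x)), setIntegral_const, smul_eq_mul,
      sub_mul, mul_comm (cellAvg μ idx b k x)]
    congr 1
    rw [cellAvg, setAverage_eq, smul_eq_mul, mul_comm, ← mul_assoc, mul_inv_cancel₀ hp.ne', one_mul]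
  refine le_of_mul_le_mul_right ?_ hp
  rw [cellDev_mul hpos hfin, ← abs_of_pos hp, ← abs_mul, h1]
  exact abs_integral_le_integral_abs

include hnest hpos hfin hb in
-- The integral of the deviation does not increase on a child cell, while the measure drops by a
-- factor of at most `D`.
theorem cellDev_succ_le {D : ℝ} (hD : ∀ k x, μ.real (cell idx k x) ≤ D * μ.real (cell idx (k + 1) x))
    (k l : ℕ) (x : X) : cellDev μ idx b k (l + 1) x ≤ D * cellDev μ idx b k l x := by
  have hp := measureReal_cell_pos hpos hfin (l + 1) x
  refine le_of_mul_le_mul_right ?_ hp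
  calc cellDev μ idx b k (l + 1) x * μ.real (cell idx (l + 1) x)
      = ∫ y in cell idx (l + 1) x, |b y - cellAvg μ idx b k x| ∂μ := cellDev_mul hpos hfin _ _ _
    _ ≤ ∫ y in cell idx l x, |b y - cellAvg μ idx b k x| ∂μ :=
        setIntegral_mono_set (integrableOn_abs_sub_cell hfin hb _ _ _)
          (Eventually.of_forall fun _ => abs_nonneg _)
          (cell_subset_cell hnest l.le_succ x).eventuallyLE
    _ = cellDev μ idx b k l x * μ.real (cell idx l x) := (cellDev_mul hpos hfin _ _ _).symm
    _ ≤ cellDev μ idx b k l x * (D * μ.real (cell idx (l + 1) x)) :=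
        mul_le_mul_of_nonneg_left (hD l x) (cellDev_nonneg k l x)
    _ = _ := by ring

/-- Either level `k` is itself the stopping level, or the cell of level `k` failed the stopping
criterion. -/
theorem cellDev_stopLevel_le (k : ℕ) (x : X) :
    cellDev μ idx b (stopLevel μ idx b k x) k x ≤
      2 * cellDev μ idx b (stopLevel μ idx b k x) (stopLevel μ idx b k x) x := by
  rcases k with _ | k
  · have := cellDev_nonneg (μ := μ) (idx := idx) (b := b) 0 0 x
    simp only [stopLevel]; linarith
  · by_cases h : 2 * cellDev μ idx b (stopLevel μ idx b k x) (stopLevel μ idx b k x) x <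
      cellDev μ idx b (stopLevel μ idx b k x) (k + 1) x
    · rw [stopLevel_succ_of_lt h]
      have := cellDev_nonneg (μ := μ) (idx := idx) (b := b) (k + 1) (k + 1) x
      linarith
    · rw [stopLevel_succ_of_not_lt h]; exact not_lt.1 h

include hnest hpos hfin hb in
-- The averages are telescoped along the stopping levels above `x`. The parent of a newly stopped
-- cell did not exceed the threshold, so the new average is off by at most `2 D` times the mean
-- deviation of the previous stopping cell.
theorem abs_cellAvg_stopLevel_sub_le {D : ℝ} (hD1 : 1 ≤ D)
    (hD : ∀ k x, μ.real (cell idx k x) ≤ D * μ.real (cell idx (k + 1) x)) (k : ℕ) (x : X) :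
    |cellAvg μ idx b (stopLevel μ idx b k x) x - cellAvg μ idx b 0 x| ≤
      2 * D * ∑ l ∈ Finset.range (stopLevel μ idx b k x) with stopLevel μ idx b l x = l,
        cellDev μ idx b l l x := by
  induction k with
  | zero => simp [stopLevel]
  | succ k ih =>
    by_cases h : 2 * cellDev μ idx b (stopLevel μ idx b k x) (stopLevel μ idx b k x) x <
      cellDev μ idx b (stopLevel μ idx b k x) (k + 1) x
    · rw [stopLevel_succ_of_lt h]
      set t := stopLevel μ idx b k x with ht
      have htk : t ≤ k := stopLevel_le k x
      have h1 : |cellAvg μ idx b (k + 1) x - cellAvg μ idx b t x| ≤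
          2 * D * cellDev μ idx b t t x := by
        refine (abs_cellAvg_sub_le hpos hfin hb t (k + 1) x).trans ?_
        refine (cellDev_succ_le hnest hpos hfin hb hD t k x).trans ?_
        have := mul_le_mul_of_nonneg_left (cellDev_stopLevel_le (μ := μ) (idx := idx) (b := b) k x)
          (by linarith : (0 : ℝ) ≤ D)
        linarith
      -- The previous stopping level `t` is missing from `range t` but belongs to `range (k + 1)`,
      -- so its term pays for the new jump.
      have h2 : ∑ l ∈ Finset.range t with stopLevel μ idx b l x = l, cellDev μ idx b l l x +
          cellDev μ idx b t t x ≤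
          ∑ l ∈ Finset.range (k + 1) with stopLevel μ idx b l x = l, cellDev μ idx b l l x := by
        have hnot : t ∉ (Finset.range t).filter fun l => stopLevel μ idx b l x = l := by simp
        rw [add_comm, ← Finset.sum_insert (f := fun l => cellDev μ idx b l l x) hnot]
        refine Finset.sum_le_sum_of_subset_of_nonneg ?_ fun l _ _ => cellDev_nonneg l l x
        intro l hl
        rcases Finset.mem_insert.1 hl with rfl | hl
        · simp only [Finset.mem_filter, Finset.mem_range]
          exact ⟨by omega, stopLevel_stopLevel k x⟩
        · simp only [Finset.mem_filter, Finset.mem_range] at hl ⊢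
          exact ⟨by omega, hl.2⟩
      have h3 := abs_sub_le (cellAvg μ idx b (k + 1) x) (cellAvg μ idx b t x) (cellAvg μ idx b 0 x)
      have h4 := mul_le_mul_of_nonneg_left h2 (by linarith : (0 : ℝ) ≤ 2 * D)
      linarith
    · rw [stopLevel_succ_of_not_lt h]; exact ih

include hnest hpos hfin hb in
/-- Sparse domination of the averages of `b`. -/
theorem abs_cellAvg_sub_le_sum {D : ℝ} (hD1 : 1 ≤ D)
    (hD : ∀ k x, μ.real (cell idx k x) ≤ D * μ.real (cell idx (k + 1) x)) (k : ℕ) (x : X) :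
    |cellAvg μ idx b k x - cellAvg μ idx b 0 x| ≤
      2 * D * ∑ l ∈ Finset.range (k + 1) with stopLevel μ idx b l x = l,
        cellDev μ idx b l l x := by
  have h0 := abs_cellAvg_stopLevel_sub_le hnest hpos hfin hb hD1 hD k x
  set t := stopLevel μ idx b k x with ht
  have htk : t ≤ k := stopLevel_le k x
  have h1 : |cellAvg μ idx b k x - cellAvg μ idx b t x| ≤ 2 * D * cellDev μ idx b t t x := by
    refine (abs_cellAvg_sub_le hpos hfin hb t k x).trans ?_
    refine (cellDev_stopLevel_le (μ := μ) (idx := idx) (b := b) k x).trans ?_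
    have := cellDev_nonneg (μ := μ) (idx := idx) (b := b) t t x
    nlinarith
  have h2 : ∑ l ∈ Finset.range t with stopLevel μ idx b l x = l, cellDev μ idx b l l x +
      cellDev μ idx b t t x ≤
      ∑ l ∈ Finset.range (k + 1) with stopLevel μ idx b l x = l, cellDev μ idx b l l x := by
    have hnot : t ∉ (Finset.range t).filter fun l => stopLevel μ idx b l x = l := by simp
    rw [add_comm, ← Finset.sum_insert (f := fun l => cellDev μ idx b l l x) hnot]
    refine Finset.sum_le_sum_of_subset_of_nonneg ?_ fun l _ _ => cellDev_nonneg l l x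
    intro l hl
    rcases Finset.mem_insert.1 hl with rfl | hl
    · simp only [Finset.mem_filter, Finset.mem_range]
      exact ⟨by omega, stopLevel_stopLevel k x⟩
    · simp only [Finset.mem_filter, Finset.mem_range] at hl ⊢
      exact ⟨by omega, hl.2⟩
  have h3 := abs_sub_le (cellAvg μ idx b k x) (cellAvg μ idx b t x) (cellAvg μ idx b 0 x)
  have h4 := mul_le_mul_of_nonneg_left h2 (by linarith : (0 : ℝ) ≤ 2 * D)
  linarith

/-- As long as the stopping level remains `k`, every test compares with the data of level `k`; hence
so does the test that first moves it. -/
theorem exists_lt_cellDev_of_stopLevel_ne {k N : ℕ} (hkN : k ≤ N) {x : X}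
    (hk : stopLevel μ idx b k x = k) (hN : stopLevel μ idx b N x ≠ k) :
    ∃ j, k < j ∧ j ≤ N ∧ 2 * cellDev μ idx b k k x < cellDev μ idx b k j x := by
  induction N, hkN using Nat.le_induction with
  | base => exact absurd hk hN
  | succ N hN' ih =>
    by_cases h1 : stopLevel μ idx b N x = k
    · by_cases h : 2 * cellDev μ idx b (stopLevel μ idx b N x) (stopLevel μ idx b N x) x <
        cellDev μ idx b (stopLevel μ idx b N x) (N + 1) x
      · rw [h1] at h
        exact ⟨N + 1, by omega, le_rfl, h⟩
      · rw [stopLevel_succ_of_not_lt h] at hN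
        exact absurd h1 hN
    · obtain ⟨j, h2, h3, h4⟩ := ih h1
      exact ⟨j, h2, by omega, h4⟩

include hnest hmeas hpos hfin hb in
-- Sparseness of the stopping cells, by Chebyshev's inequality: the maximal subcells whose mean
-- deviation exceeds twice that of the stopping cell fill at most half of it, and off them the
-- stopping level never moves.
theorem measure_cell_le_two_mul [Countable β] {k N : ℕ} (hkN : k ≤ N) {x : X}
    (hk : stopLevel μ idx b k x = k) :
    μ (cell idx k x) ≤ 2 * μ {y ∈ cell idx k x | stopLevel μ idx b N y = k} := by
  set Q := cell idx k x with hQ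
  set t := cellAvg μ idx b k x with ht
  set o := cellDev μ idx b k k x with ho
  have ho0 : 0 ≤ o := cellDev_nonneg k k x
  set F : X → ℝ≥0∞ := fun y => ENNReal.ofReal |b y - t| with hF
  have hFint : ∀ l y, ∫⁻ z in cell idx l y, F z ∂μ =
      ENNReal.ofReal (∫ z in cell idx l y, |b z - t| ∂μ) := fun l y =>
    (ofReal_integral_eq_lintegral_ofReal (integrableOn_abs_sub_cell hfin hb _ _ _)
      (Eventually.of_forall fun _ => abs_nonneg _)).symm
  -- Points sorted by the first level at which the criterion is met. These sets are disjoint unions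
  -- of cells of level `j`, so the Chebyshev estimates add up.
  set A : ℕ → Set X := fun j => {y ∈ Q | 2 * o < cellDev μ idx b k j y ∧
    ∀ i, k < i → i < j → ¬ 2 * o < cellDev μ idx b k i y} with hA
  have hsat : ∀ j, k < j → ∀ y ∈ A j, cell idx j y ⊆ A j := by
    intro j hj y hy z hz
    have hzi : ∀ i, i ≤ j → z ∈ cell idx i y := fun i hi => cell_subset_cell hnest hi y hz
    refine ⟨?_, ?_, ?_⟩
    · have := hzi k hj.le
      rwa [cell_eq_of_mem hy.1] at this
    · rw [cellDev_congr (hzi k hj.le) hz]; exact hy.2.1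
    · intro i hi hij
      rw [cellDev_congr (hzi k hj.le) (hzi i hij.le)]; exact hy.2.2 i hi hij
  have hcover : Q ⊆ {y ∈ Q | stopLevel μ idx b N y = k} ∪ ⋃ j ∈ Finset.Ioc k N, A j := by
    intro y hy
    by_cases h : stopLevel μ idx b N y = k
    · exact Or.inl ⟨hy, h⟩
    · have hky : stopLevel μ idx b k y = k := by rw [stopLevel_congr hnest hy, hk]
      have hex := exists_lt_cellDev_of_stopLevel_ne hkN hky h
      rw [cellDev_congr hy hy] at hex
      classical
      set j := Nat.find hex with hj
      obtain ⟨h1, h2, h3⟩ := Nat.find_spec hex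
      refine Or.inr ?_
      simp only [Set.mem_iUnion, Finset.mem_Ioc]
      refine ⟨j, ⟨h1, h2⟩, hy, h3, fun i hi hij hlt => ?_⟩
      exact Nat.find_min hex hij ⟨hi, by omega, hlt⟩
  have hdis : (↑(Finset.Ioc k N) : Set ℕ).PairwiseDisjoint A := by
    intro i hi j hj hij
    simp only [Finset.coe_Ioc, Set.mem_Ioc] at hi hj
    refine Set.disjoint_left.2 fun y hyi hyj => ?_
    rcases lt_or_gt_of_ne hij with h | h
    · exact hyj.2.2 i hi.1 h hyi.2.1
    · exact hyi.2.2 j hj.1 h hyj.2.1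
  have hAm : ∀ j ∈ Finset.Ioc k N, MeasurableSet (A j) := fun j hj =>
    measurableSet_of_saturated hmeas (hsat j (Finset.mem_Ioc.1 hj).1)
  set U := ⋃ j ∈ Finset.Ioc k N, A j with hU
  have hUQ : U ⊆ Q := Set.iUnion₂_subset fun j _ y hy => hy.1
  have hUle : ENNReal.ofReal (2 * o) * μ U ≤ ENNReal.ofReal o * μ Q := by
    calc ENNReal.ofReal (2 * o) * μ U = ∑ j ∈ Finset.Ioc k N, ENNReal.ofReal (2 * o) * μ (A j) := by
          rw [hU, measure_biUnion_finset hdis hAm, Finset.mul_sum]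
      _ ≤ ∑ j ∈ Finset.Ioc k N, ∫⁻ z in A j, F z ∂μ := by
          refine Finset.sum_le_sum fun j hj => ?_
          refine mul_measure_le_of_saturated hmeas (hsat j (Finset.mem_Ioc.1 hj).1) fun y hy => ?_
          rw [hFint, ht, ← cellAvg_congr hy.1, ← cellDev_mul hpos hfin,
            ENNReal.ofReal_mul (cellDev_nonneg _ _ _), ofReal_measureReal (hfin j y)]
          gcongr
          exact hy.2.1.le
      _ = ∫⁻ z in U, F z ∂μ := by rw [hU, lintegral_biUnion_finset hdis hAm]
      _ ≤ ∫⁻ z in Q, F z ∂μ := lintegral_mono_set hUQ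
      _ = ENNReal.ofReal o * μ Q := by
          rw [hFint, ht, ← cellDev_mul hpos hfin, ENNReal.ofReal_mul ho0,
            ofReal_measureReal (hfin k x)]
  have h2U : 2 * μ U ≤ μ Q := by
    rcases ho0.eq_or_lt with h0 | h0
    -- If the mean deviation vanishes, one cannot divide by it; but then the deviation also vanishes
    -- on every subcell and no subcell meets the strict criterion.
    · have hUe : U = ∅ := by
        refine Set.eq_empty_of_forall_notMem fun y hy => ?_
        simp only [hU, Set.mem_iUnion, Finset.mem_Ioc] at hy
        obtain ⟨j, ⟨hkj, _⟩, hyQ, hyj, _⟩ := hy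
        have h1 := cellDev_mul hpos hfin (b := b) k j y
        have h2 : ∫ z in cell idx j y, |b z - cellAvg μ idx b k y| ∂μ ≤
            ∫ z in cell idx k y, |b z - cellAvg μ idx b k y| ∂μ :=
          setIntegral_mono_set (integrableOn_abs_sub_cell hfin hb _ _ _)
            (Eventually.of_forall fun _ => abs_nonneg _)
            (cell_subset_cell hnest hkj.le y).eventuallyLE
        rw [← cellDev_mul hpos hfin (b := b) k k y, cellDev_congr hyQ hyQ, ← ho, ← h0, zero_mul,
          ← h1] at h2
        have h3 := measureReal_cell_pos hpos hfin (μ := μ) j y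
        have h4 : 0 < cellDev μ idx b k j y := by linarith
        nlinarith
      rw [hUe]; simp
    · rw [ENNReal.ofReal_mul (by norm_num), mul_comm (ENNReal.ofReal 2), mul_assoc] at hUle
      have := (ENNReal.mul_le_mul_iff_right (by simpa using h0) ENNReal.ofReal_ne_top).1 hUle
      simpa using this
  have h1 := (measure_mono (μ := μ) hcover).trans (measure_union_le _ _)
  have h3 : 2 * μ Q ≤ 2 * μ {y ∈ Q | stopLevel μ idx b N y = k} + μ Q := by
    calc 2 * μ Q ≤ 2 * (μ {y ∈ Q | stopLevel μ idx b N y = k} + μ U) := by gcongr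
      _ ≤ _ := by rw [mul_add]; gcongr
  rw [two_mul] at h3
  exact (ENNReal.add_le_add_iff_right (hfin k x)).1 h3

end Bounds

end Stopping

/-! ### Sparse families of balls -/

/-- A family of balls which contain disjoint sets of comparable measure. -/
def SparseBalls {n : ℕ} {ι : Type} (Λ : ℝ≥0∞) (c : ι → Rn n) (ρ : ι → ℝ) : Prop :=
  ∃ E : ι → Set (Rn n), (∀ j, E j ⊆ Metric.closedBall (c j) (ρ j)) ∧ (∀ j, MeasurableSet (E j)) ∧
    Pairwise (Function.onFun Disjoint E) ∧
    ∀ j, volume (Metric.closedBall (c j) (ρ j)) ≤ Λ * volume (E j)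

theorem SparseBalls.carlesonPacking {n : ℕ} {ι : Type} {Λ : ℝ≥0∞} {c : ι → Rn n} {ρ : ι → ℝ}
    (h : SparseBalls Λ c ρ) : CarlesonPacking Λ c ρ := by
  obtain ⟨E, hE, hm, hd, hv⟩ := h
  intro t
  calc ∑ j ∈ t, volume (Metric.closedBall (c j) (ρ j)) ≤ ∑ j ∈ t, Λ * volume (E j) :=
        Finset.sum_le_sum fun j _ => hv j
    _ = Λ * volume (⋃ j ∈ t, E j) := by
        rw [measure_biUnion_finset (fun i _ j _ hij => hd hij) (fun j _ => hm j), Finset.mul_sum]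
    _ ≤ _ := by gcongr with j; exact hE j

/-- The disjoint sets are kept and only the volumes of the balls grow. This is needed because the
sets on which the commutator is tested lie in dilates of the balls. -/
theorem SparseBalls.dilate {n : ℕ} {ι : Type} {Λ : ℝ≥0∞} {c : ι → Rn n} {ρ : ι → ℝ}
    (h : SparseBalls Λ c ρ) (hρ : ∀ j, 0 < ρ j) {A : ℝ} (hA : 1 ≤ A) :
    SparseBalls (ENNReal.ofReal (A ^ n) * Λ) c (fun j => A * ρ j) := by
  obtain ⟨E, hE, hm, hd, hv⟩ := h
  refine ⟨E, fun j => (hE j).trans (Metric.closedBall_subset_closedBall ?_), hm, hd, fun j => ?_⟩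
  · nlinarith [hρ j]
  · rw [Measure.addHaar_closedBall_mul _ _ (by linarith) (hρ j).le,
      ← Measure.addHaar_closedBall_center volume (c j), mul_assoc]
    simp only [finrank_euclideanSpace, Fintype.card_fin]
    gcongr
    exact hv j

/-! ### Dyadic cubes -/

/-- The index of the dyadic cube of side `2 a / 2 ^ k` of `[-a, a) ^ n` that contains `x`. -/
noncomputable def dyadicIndex {n : ℕ} (a : ℝ) (k : ℕ) (x : Rn n) : Fin n → ℤ :=
  fun i => ⌊2 ^ k * ((x i + a) / (2 * a))⌋

theorem dyadicIndex_nested {n : ℕ} (a : ℝ) (k : ℕ) (x y : Rn n)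
    (h : dyadicIndex a (k + 1) x = dyadicIndex a (k + 1) y) :
    dyadicIndex a k x = dyadicIndex a k y := by
  funext i
  have hi := congrFun h i
  simp only [dyadicIndex, pow_succ, mul_assoc, mul_comm (2 : ℝ) ((_ + a) / (2 * a))] at hi ⊢
  simp only [← mul_assoc] at hi
  set u := 2 ^ k * ((x i + a) / (2 * a))
  set v := 2 ^ k * ((y i + a) / (2 * a))
  -- The index of the parent is the integer half of the index of the child, so the child determines
  -- the parent.
  have key : ∀ w : ℝ, ⌊w⌋ = ⌊w * 2⌋ / 2 := by
    intro w
    have h1 := Int.floor_le w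
    have h2 := Int.lt_floor_add_one w
    have h3 : 2 * ⌊w⌋ ≤ ⌊w * 2⌋ := Int.le_floor.2 (by push_cast; linarith)
    have h4 : ⌊w * 2⌋ < 2 * ⌊w⌋ + 2 := Int.floor_lt.2 (by push_cast; linarith)
    omega
  rw [key u, key v, hi]

theorem mem_dyadic_cell_iff {n : ℕ} {a : ℝ} (ha : 0 < a) (k : ℕ) (x y : Rn n) :
    y ∈ cell (dyadicIndex a) k x ↔ ∀ i, y i ∈ Set.Ico
      (2 * a / 2 ^ k * dyadicIndex a k x i - a)
      (2 * a / 2 ^ k * (dyadicIndex a k x i + 1) - a) := by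
  have h2 : (0 : ℝ) < 2 ^ k := by positivity
  change dyadicIndex a k y = dyadicIndex a k x ↔ _
  rw [funext_iff]
  refine forall_congr' fun i => ?_
  rw [dyadicIndex, Int.floor_eq_iff, Set.mem_Ico]
  generalize (dyadicIndex a k x i : ℝ) = z
  have e1 : 2 ^ k * ((y i + a) / (2 * a)) = (2 ^ k * (y i + a)) / (2 * a) := by ring
  have e2 : ∀ w : ℝ, 2 * a / 2 ^ k * w = (w * (2 * a)) / 2 ^ k := fun w => by ring
  rw [e1, le_div_iff₀ (by positivity), div_lt_iff₀ (by positivity), e2, e2, sub_le_iff_le_add,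
    lt_sub_iff_add_lt, div_le_iff₀ h2, lt_div_iff₀ h2, mul_comm (2 ^ k)]

theorem dyadic_cell_eq {n : ℕ} {a : ℝ} (ha : 0 < a) (k : ℕ) (x : Rn n) :
    cell (dyadicIndex a) k x = (fun y : Rn n => y.ofLp) ⁻¹' Set.univ.pi fun i => Set.Ico
      (2 * a / 2 ^ k * dyadicIndex a k x i - a)
      (2 * a / 2 ^ k * (dyadicIndex a k x i + 1) - a) := by
  ext y
  rw [mem_dyadic_cell_iff ha]
  simp [Set.mem_pi]

theorem measurableSet_dyadic_cell {n : ℕ} {a : ℝ} (ha : 0 < a) (k : ℕ) (x : Rn n) :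
    MeasurableSet (cell (dyadicIndex a) k x) := by
  rw [dyadic_cell_eq ha]
  exact (WithLp.measurable_ofLp 2 _) (MeasurableSet.univ_pi fun i => measurableSet_Ico)

theorem volume_dyadic_cell {n : ℕ} {a : ℝ} (ha : 0 < a) (k : ℕ) (x : Rn n) :
    volume (cell (dyadicIndex a) k x) = ENNReal.ofReal ((2 * a / 2 ^ k) ^ n) := by
  rw [dyadic_cell_eq ha]
  have := (PiLp.volume_preserving_ofLp (Fin n)).measure_preimage
    (s := Set.univ.pi fun i => Set.Ico (2 * a / 2 ^ k * (dyadicIndex a k x i : ℝ) - a)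
      (2 * a / 2 ^ k * ((dyadicIndex a k x i : ℝ) + 1) - a))
    (MeasurableSet.univ_pi fun i => measurableSet_Ico).nullMeasurableSet
  refine this.trans ?_
  rw [Real.volume_pi_Ico]
  have : ∀ z : ℝ, 2 * a / 2 ^ k * (z + 1) - a - (2 * a / 2 ^ k * z - a) = 2 * a / 2 ^ k := by
    intro z; ring
  simp only [this, Finset.prod_const, Finset.card_univ, Fintype.card_fin]
  rw [ENNReal.ofReal_pow (by positivity)]

theorem dyadic_cell_subset_closedBall {n : ℕ} {a : ℝ} (ha : 0 < a) (k : ℕ) (x : Rn n) :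
    cell (dyadicIndex a) k x ⊆ Metric.closedBall x (√n * (2 * a / 2 ^ k)) := by
  intro y hy
  have hx := (mem_dyadic_cell_iff ha k x x).1 rfl
  rw [mem_dyadic_cell_iff ha] at hy
  rw [Metric.mem_closedBall, EuclideanSpace.dist_eq]
  have hδ : (0 : ℝ) ≤ 2 * a / 2 ^ k := by positivity
  have h1 : ∑ i, dist (y i) (x i) ^ 2 ≤ n * (2 * a / 2 ^ k) ^ 2 := by
    calc _ ≤ ∑ _i : Fin n, (2 * a / 2 ^ k) ^ 2 := by
          refine Finset.sum_le_sum fun i _ => ?_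
          refine pow_le_pow_left₀ dist_nonneg ?_ 2
          have h1 := hx i
          have h2 := hy i
          rw [Set.mem_Ico] at h1 h2
          rw [Real.dist_eq, abs_le]
          constructor <;> linarith
      _ = _ := by simp
  calc _ ≤ √(n * (2 * a / 2 ^ k) ^ 2) := Real.sqrt_le_sqrt h1
    _ = _ := by rw [Real.sqrt_mul (by positivity), Real.sqrt_sq hδ]

/-- The ratio of the measures of the circumscribed ball and of a cube. -/
noncomputable def ballCubeRatio (n : ℕ) : ℝ≥0∞ :=
  ENNReal.ofReal (√n ^ n) * volume (Metric.ball (0 : Rn n) 1)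

theorem ballCubeRatio_ne_top (n : ℕ) : ballCubeRatio n ≠ ∞ :=
  ENNReal.mul_ne_top ENNReal.ofReal_ne_top measure_ball_lt_top.ne

theorem volume_closedBall_eq_ballCubeRatio_mul {n : ℕ} {a : ℝ} (ha : 0 < a) (k : ℕ) (x y : Rn n) :
    volume (Metric.closedBall y (√n * (2 * a / 2 ^ k))) =
      ballCubeRatio n * volume (cell (dyadicIndex a) k x) := by
  rw [volume_dyadic_cell ha, Measure.addHaar_closedBall _ _ (by positivity)]
  simp only [finrank_euclideanSpace, Fintype.card_fin]
  rw [mul_pow, ENNReal.ofReal_mul (by positivity), ballCubeRatio]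
  ring

theorem ballCubeRatio_ne_zero {n : ℕ} (hn : 0 < n) : ballCubeRatio n ≠ 0 := by
  refine mul_ne_zero ?_ (Metric.measure_ball_pos _ _ one_pos).ne'
  have : (0 : ℝ) < n := by exact_mod_cast hn
  simp only [ne_eq, ENNReal.ofReal_eq_zero, not_le]
  positivity

/-- The corner of a dyadic cube. -/
noncomputable def dyadicCorner {n : ℕ} (a : ℝ) (k : ℕ) (z : Fin n → ℤ) : Rn n :=
  WithLp.toLp 2 fun i => 2 * a / 2 ^ k * z i - a

theorem dyadicIndex_dyadicCorner {n : ℕ} {a : ℝ} (ha : 0 < a) (k : ℕ) (z : Fin n → ℤ) :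
    dyadicIndex a k (dyadicCorner a k z) = z := by
  funext i
  have : 2 ^ k * ((2 * a / 2 ^ k * (z i : ℝ) - a + a) / (2 * a)) = z i := by field_simp; ring
  simp only [dyadicIndex, dyadicCorner]
  rw [this, Int.floor_intCast]

theorem dyadicIndex_mem_Ico {n : ℕ} {a : ℝ} {k : ℕ} {x : Rn n}
    (hx : dyadicIndex a 0 x = 0) (i : Fin n) : 0 ≤ dyadicIndex a k x i ∧
      dyadicIndex a k x i < 2 ^ k := by
  have h := congrFun hx i
  simp only [dyadicIndex, pow_zero, one_mul, Pi.zero_apply, Int.floor_eq_zero_iff, Set.mem_Ico] at h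
  constructor
  · exact Int.floor_nonneg.2 (mul_nonneg (by positivity) h.1)
  · refine Int.floor_lt.2 ?_
    push_cast
    nlinarith [h.2, (by positivity : (0 : ℝ) < 2 ^ k)]

theorem mem_dyadic_base {n : ℕ} {a : ℝ} (ha : 0 < a) {x : Rn n} (hx : ‖x‖ < a) :
    dyadicIndex a 0 x = 0 := by
  funext i
  simp only [dyadicIndex, pow_zero, one_mul, Pi.zero_apply, Int.floor_eq_zero_iff, Set.mem_Ico]
  have h1 : |x i| < a := (PiLp.norm_apply_le x i).trans_lt hx
  rw [abs_lt] at h1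
  exact ⟨div_nonneg (by linarith) (by linarith), (div_lt_one (by linarith)).2 (by linarith)⟩

/-! ### Sparse oscillations control the `L^r` norm modulo constants -/

theorem ballCubeRatio_toReal_pos {n : ℕ} (hn : 0 < n) : 0 < (ballCubeRatio n).toReal :=
  ENNReal.toReal_pos (ballCubeRatio_ne_zero hn) (ballCubeRatio_ne_top n)

/-- Lebesgue differentiation over balls centred at `x`. The dyadic cube around `x` lies in such a
ball and fills a fixed proportion of it, so its average converges as well. -/
theorem tendsto_cellAvg {n : ℕ} {b : Rn n → ℝ} (hb : LocallyIntegrable b volume) {a : ℝ}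
    (ha : 0 < a) (hn : 0 < n) :
    ∀ᵐ x, Tendsto (fun k => cellAvg volume (dyadicIndex a) b k x) atTop (𝓝 (b x)) := by
  have hn' : (0 : ℝ) < n := by exact_mod_cast hn
  filter_upwards [IsUnifLocDoublingMeasure.ae_tendsto_average_norm_sub volume hb 1] with x hx
  have hlim : Tendsto (fun k : ℕ => √n * (2 * a / 2 ^ k)) atTop (𝓝[>] 0) := by
    refine tendsto_nhdsWithin_iff.2 ⟨?_, Eventually.of_forall fun k => ?_⟩
    · have h := tendsto_pow_atTop_nhds_zero_of_lt_one (r := (1 / 2 : ℝ)) (by norm_num) (by norm_num)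
      have := h.const_mul (√n * (2 * a))
      rw [mul_zero] at this
      refine this.congr fun k => ?_
      rw [one_div, inv_pow]; ring
    · exact Set.mem_Ioi.2 (by positivity)
  have h1 := hx (fun _ => x) (fun k : ℕ => √n * (2 * a / 2 ^ k)) hlim
    (Eventually.of_forall fun k => Metric.mem_closedBall_self (by positivity))
  have h2 := h1.const_mul (ballCubeRatio n).toReal
  rw [mul_zero] at h2
  rw [tendsto_iff_dist_tendsto_zero]
  refine squeeze_zero (fun _ => dist_nonneg) (fun k => ?_) h2
  have hcell : cell (dyadicIndex a) k x ⊆ Metric.closedBall x (√n * (2 * a / 2 ^ k)) :=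
    dyadic_cell_subset_closedBall ha k x
  have hbB : IntegrableOn b (Metric.closedBall x (√n * (2 * a / 2 ^ k))) :=
    hb.integrableOn_isCompact (isCompact_closedBall _ _)
  have hvc : volume (cell (dyadicIndex a) k x) ≠ ∞ := by
    rw [volume_dyadic_cell ha]; exact ENNReal.ofReal_ne_top
  have hvc0 : 0 < volume.real (cell (dyadicIndex a) k x) := by
    rw [measureReal_def, volume_dyadic_cell ha, ENNReal.toReal_ofReal (by positivity)]; positivity
  have hvB : volume.real (Metric.closedBall x (√n * (2 * a / 2 ^ k))) =
      (ballCubeRatio n).toReal * volume.real (cell (dyadicIndex a) k x) := by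
    rw [measureReal_def, volume_closedBall_eq_ballCubeRatio_mul ha k x, ENNReal.toReal_mul]; rfl
  have hint : IntegrableOn (fun y => ‖b y - b x‖) (Metric.closedBall x (√n * (2 * a / 2 ^ k))) :=
    (hbB.sub (integrableOn_const measure_closedBall_lt_top.ne)).norm
  have h3 : cellAvg volume (dyadicIndex a) b k x - b x =
      (volume.real (cell (dyadicIndex a) k x))⁻¹ *
        ∫ y in cell (dyadicIndex a) k x, (b y - b x) := by
    rw [integral_sub (hbB.mono_set hcell) (integrableOn_const hvc), setIntegral_const, smul_eq_mul,
      cellAvg, setAverage_eq, smul_eq_mul]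
    field_simp
  rw [Real.dist_eq, h3, abs_mul, abs_of_pos (inv_pos.2 hvc0), setAverage_eq, hvB, smul_eq_mul,
    mul_inv, ← mul_assoc, ← mul_assoc,
    mul_inv_cancel₀ (ballCubeRatio_toReal_pos hn).ne', one_mul]
  gcongr
  refine (norm_integral_le_integral_norm (fun y => b y - b x)).trans ?_
  exact setIntegral_mono_set hint (Eventually.of_forall fun _ => norm_nonneg _) hcell.eventuallyLE

/-- The hypothesis is applied to balls around the stopping cubes, and the sparse domination turns
its conclusion into an `L^r` bound. Uniformity in `a` and `N` is the point: both tend to infinity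
later. -/
theorem lintegral_cellAvg_sub_rpow_le {n : ℕ} (hn : 0 < n) {b : Rn n → ℝ}
    (hb : LocallyIntegrable b volume) {r : ℝ} (hr : 1 < r)
    (h : ∀ Λ : ℝ≥0∞, Λ ≠ ∞ → ∃ C : ℝ≥0∞, C ≠ ∞ ∧ ∀ (ι : Type) [Fintype ι] (c : ι → Rn n)
      (ρ : ι → ℝ), (∀ j, 0 < ρ j) → SparseBalls Λ c ρ → ∀ o : ι → ℝ, (∀ j, 0 ≤ o j) →
      (∀ j α, o j * volume.real (Metric.closedBall (c j) (ρ j)) ≤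
        ∫ x in Metric.closedBall (c j) (ρ j), |b x - α|) →
      ∑ j, ENNReal.ofReal (o j ^ r) * volume (Metric.closedBall (c j) (ρ j)) ≤ C) :
    ∃ C : ℝ≥0∞, C ≠ ∞ ∧ ∀ a : ℝ, 0 < a → ∀ N : ℕ,
      ∫⁻ x in {x | dyadicIndex a 0 x = 0}, ENNReal.ofReal
        (|cellAvg volume (dyadicIndex a) b N x - cellAvg volume (dyadicIndex a) b 0 x| ^ r) ≤ C := by
  classical
  have hr0 : 0 < r := by linarith
  have hn' : (0 : ℝ) < n := by exact_mod_cast hn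
  set V := ballCubeRatio n with hV
  have hVt := ballCubeRatio_ne_top n
  have hV0 := ballCubeRatio_toReal_pos hn
  have hΛ : V * 2 ≠ ∞ := ENNReal.mul_ne_top hVt (by norm_num)
  obtain ⟨C, hC, hsum⟩ := h (V * 2) hΛ
  obtain ⟨C₁, hC₁, hcar⟩ := CarlesonPacking.lintegral_sum_indicator_rpow_le n hΛ hr
  set D : ℝ := 2 ^ n with hD
  have hD1 : 1 ≤ D := one_le_pow₀ (by norm_num)
  refine ⟨ENNReal.ofReal ((2 * D) ^ r) * (C₁ * (ENNReal.ofReal ((2 * V.toReal) ^ r) * C)),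
    by finiteness, fun a ha N => ?_⟩
  have hnest := dyadicIndex_nested (n := n) a
  have hmeas : ∀ k x, MeasurableSet (cell (dyadicIndex (n := n) a) k x) :=
    measurableSet_dyadic_cell ha
  have hfin : ∀ k x, volume (cell (dyadicIndex (n := n) a) k x) ≠ ∞ := fun k x => by
    rw [volume_dyadic_cell ha]; exact ENNReal.ofReal_ne_top
  have hpos : ∀ k x, volume (cell (dyadicIndex (n := n) a) k x) ≠ 0 := fun k x => by
    rw [volume_dyadic_cell ha]
    simp only [ne_eq, ENNReal.ofReal_eq_zero, not_le]
    positivity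
  have hbc : ∀ k x, IntegrableOn b (cell (dyadicIndex a) k x) := fun k x =>
    (hb.integrableOn_isCompact (isCompact_closedBall _ _)).mono_set
      (dyadic_cell_subset_closedBall ha k x)
  have hDv : ∀ k x, volume.real (cell (dyadicIndex (n := n) a) k x) ≤
      D * volume.real (cell (dyadicIndex a) (k + 1) x) := fun k x => by
    rw [measureReal_def, measureReal_def, volume_dyadic_cell ha, volume_dyadic_cell ha,
      ENNReal.toReal_ofReal (by positivity), ENNReal.toReal_ofReal (by positivity), hD, ← mul_pow,
      pow_succ]
    refine le_of_eq ?_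
    congr 1
    field_simp
  -- A cube of level `l` in the base cube has coordinates in `[0, 2 ^ l)`, so the cubes up to level
  -- `N` form a finite type. Corners represent the cubes, and `ι` selects the stopping ones.
  let corner : (Σ l : Fin (N + 1), (Fin n → Fin (2 ^ (l : ℕ)))) → Rn n := fun p =>
    dyadicCorner a p.1 fun i => ((p.2 i : ℕ) : ℤ)
  let ι : Type := {p : Σ l : Fin (N + 1), (Fin n → Fin (2 ^ (l : ℕ))) //
    stopLevel volume (dyadicIndex a) b p.1 (corner p) = p.1}
  let lev : ι → ℕ := fun p => p.1.1
  let c : ι → Rn n := fun p => corner p.1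
  let ρ : ι → ℝ := fun p => √n * (2 * a / 2 ^ lev p)
  have hlev_eq : ∀ p : ι, stopLevel volume (dyadicIndex a) b (lev p) (c p) = lev p := fun p => p.2
  have hlev : ∀ p : ι, lev p ≤ N := fun p => Nat.lt_succ_iff.1 p.1.1.2
  have hidx : ∀ p : ι, dyadicIndex a (lev p) (c p) = fun i => ((p.1.2 i : ℕ) : ℤ) := fun p =>
    dyadicIndex_dyadicCorner ha _ _
  have hρ : ∀ p, 0 < ρ p := fun p => by positivity
  have hvB : ∀ p, volume (Metric.closedBall (c p) (ρ p)) =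
      V * volume (cell (dyadicIndex a) (lev p) (c p)) := fun p =>
    volume_closedBall_eq_ballCubeRatio_mul ha _ _ _
  let dev : ι → ℝ := fun p => cellDev volume (dyadicIndex a) b (lev p) (lev p) (c p)
  have hdev0 : ∀ p, 0 ≤ dev p := fun p => cellDev_nonneg _ _ _
  have hsparse : SparseBalls (V * 2) c ρ := by
    -- The disjoint sets consist of the points whose last stopping cube, among levels up to `N`, is
    -- the given one.
    refine ⟨fun p => {y ∈ cell (dyadicIndex a) (lev p) (c p) |
      stopLevel volume (dyadicIndex a) b N y = lev p}, fun p y hy =>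
        dyadic_cell_subset_closedBall ha _ _ hy.1, fun p => ?_, ?_, fun p => ?_⟩
    · refine measurableSet_of_saturated (idx := dyadicIndex a) hmeas (k := N) fun y hy z hz => ?_
      refine ⟨?_, ?_⟩
      · have := cell_subset_cell hnest (hlev p) y hz
        rwa [cell_eq_of_mem hy.1] at this
      · rw [stopLevel_congr hnest hz]; exact hy.2
    · intro p p' hpp
      refine Set.disjoint_left.2 fun y hy hy' => hpp ?_
      have hl : lev p = lev p' := hy.2.symm.trans hy'.2
      have h1 : dyadicIndex a (lev p) y = dyadicIndex a (lev p) (c p) := hy.1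
      have h2 : dyadicIndex a (lev p') y = dyadicIndex a (lev p') (c p') := hy'.1
      rw [hidx] at h1 h2
      obtain ⟨⟨l, z⟩, hp⟩ := p
      obtain ⟨⟨l', z'⟩, hp'⟩ := p'
      have hl : l = l' := Fin.ext hl
      subst hl
      have : z = z' := by
        funext i
        have h3 := congrFun (h1.symm.trans h2) i
        exact Fin.ext (by exact_mod_cast h3)
      subst this
      rfl
    · rw [hvB, mul_assoc]
      gcongr
      exact measure_cell_le_two_mul hnest hmeas hpos hfin hbc (hlev p) (hlev_eq p)
  -- The deviation from the average is at most twice that from any constant, whence the `2`; the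
  -- factor `V` passes from the cube to the ball around it.
  have hosc := hsum ι c ρ hρ hsparse (fun p => dev p / (2 * V.toReal))
    (fun p => div_nonneg (hdev0 p) (by positivity)) fun p α => by
      have h1 := cellDev_mul hpos hfin (b := b) (lev p) (lev p) (c p)
      set Q := cell (dyadicIndex a) (lev p) (c p) with hQ
      set t := cellAvg volume (dyadicIndex a) b (lev p) (c p) with ht
      have hQp : 0 < volume.real Q := measureReal_cell_pos hpos hfin _ _
      have hi1 : IntegrableOn (fun y => |b y - α|) Q := integrableOn_abs_sub_cell hfin hbc _ _ _
      have hi2 : IntegrableOn (fun y => |b y - t|) Q := integrableOn_abs_sub_cell hfin hbc _ _ _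
      have h2 : |α - t| * volume.real Q ≤ ∫ y in Q, |b y - α| := by
        have h3 : (t - α) * volume.real Q = ∫ y in Q, (b y - α) := by
          rw [integral_sub (hbc _ _) (integrableOn_const (hfin _ _)), setIntegral_const,
            smul_eq_mul, ht, cellAvg, setAverage_eq, smul_eq_mul, ← hQ]
          field_simp
        calc |α - t| * volume.real Q = |(t - α) * volume.real Q| := by
              rw [abs_mul, abs_of_pos hQp, abs_sub_comm]
          _ ≤ _ := by rw [h3]; exact abs_integral_le_integral_abs
      have h4 : ∫ y in Q, |b y - t| ≤ 2 * ∫ y in Q, |b y - α| := by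
        calc ∫ y in Q, |b y - t| ≤ ∫ y in Q, (|b y - α| + |α - t|) :=
              integral_mono hi2 (hi1.add (integrableOn_const (hfin _ _)))
                fun y => abs_sub_le _ _ _
          _ = (∫ y in Q, |b y - α|) + |α - t| * volume.real Q := by
              rw [integral_add hi1 (integrableOn_const (hfin _ _)), setIntegral_const,
                smul_eq_mul, mul_comm |α - t|]
          _ ≤ _ := by linarith
      have h5 : ∫ y in Q, |b y - α| ≤ ∫ y in Metric.closedBall (c p) (ρ p), |b y - α| := by
        refine setIntegral_mono_set ?_ (Eventually.of_forall fun _ => abs_nonneg _)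
          (dyadic_cell_subset_closedBall ha _ _).eventuallyLE
        exact ((hb.integrableOn_isCompact (isCompact_closedBall _ _)).sub
          (integrableOn_const measure_closedBall_lt_top.ne)).abs
      rw [measureReal_def, hvB, ENNReal.toReal_mul, ← measureReal_def]
      calc dev p / (2 * V.toReal) * (V.toReal * volume.real Q) = dev p * volume.real Q / 2 := by
            have hVr : 0 < V.toReal := hV0
            rw [div_mul_eq_mul_div, div_eq_div_iff (by positivity) two_ne_zero]
            ring
        _ ≤ _ := by
            change cellDev volume (dyadicIndex a) b (lev p) (lev p) (c p) * _ / 2 ≤ _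
            rw [h1]; linarith
  have hpt : ∀ x ∈ {x : Rn n | dyadicIndex a 0 x = 0},
      |cellAvg volume (dyadicIndex a) b N x - cellAvg volume (dyadicIndex a) b 0 x| ≤
      2 * D * ∑ p : ι, (Metric.closedBall (c p) (ρ p)).indicator (fun _ => dev p) x := by
    intro x hx
    refine (abs_cellAvg_sub_le_sum hnest hpos hfin hbc hD1 hDv N x).trans ?_
    gcongr
    have hg0 : ∀ p, 0 ≤ (Metric.closedBall (c p) (ρ p)).indicator (fun _ => dev p) x := fun p =>
      Set.indicator_nonneg (fun _ _ => hdev0 p) x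
    have hmaps : ∀ p ∈ (Finset.univ : Finset ι), lev p ∈ Finset.range (N + 1) := fun p _ => by
      simpa using Nat.lt_succ_of_le (hlev p)
    rw [← Finset.sum_fiberwise_of_maps_to hmaps]
    rw [Finset.sum_filter]
    refine Finset.sum_le_sum fun l hl => ?_
    split_ifs with hsl
    -- At a stopping level, the cube of `x` is one of the indexed cubes, so its deviation occurs
    -- among the terms of the sum over balls at `x`.
    · have hlN : l < N + 1 := Finset.mem_range.1 hl
      have hz := dyadicIndex_mem_Ico (k := l) hx
      let z : Fin n → Fin (2 ^ l) := fun i => ⟨(dyadicIndex a l x i).toNat, by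
        have h1 := (hz i).2
        have h2 := (hz i).1
        zify; rw [Int.toNat_of_nonneg h2]; exact h1⟩
      have hzx : (fun i => ((z i : ℕ) : ℤ)) = dyadicIndex a l x := by
        funext i; exact Int.toNat_of_nonneg (hz i).1
      have hmem : x ∈ cell (dyadicIndex a) l (corner ⟨⟨l, hlN⟩, z⟩) := by
        change dyadicIndex a l x = dyadicIndex a l (dyadicCorner a l _)
        rw [dyadicIndex_dyadicCorner ha, hzx]
      have hst : stopLevel volume (dyadicIndex a) b l (corner ⟨⟨l, hlN⟩, z⟩) = l := by
        rw [← stopLevel_congr hnest hmem]; exact hsl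
      let p : ι := ⟨⟨⟨l, hlN⟩, z⟩, hst⟩
      have hp : cellDev volume (dyadicIndex a) b l l x =
          (Metric.closedBall (c p) (ρ p)).indicator (fun _ => dev p) x := by
        rw [Set.indicator_of_mem (dyadic_cell_subset_closedBall ha _ _ hmem)]
        exact cellDev_congr hmem hmem
      rw [hp]
      exact Finset.single_le_sum
        (f := fun p => (Metric.closedBall (c p) (ρ p)).indicator (fun _ => dev p) x)
        (fun p _ => hg0 p) (by simp [p, lev])
    · exact Finset.sum_nonneg fun p _ => hg0 p
  have hG0 : ∀ x, 0 ≤ ∑ p : ι, (Metric.closedBall (c p) (ρ p)).indicator (fun _ => dev p) x :=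
    fun x => Finset.sum_nonneg fun p _ => Set.indicator_nonneg (fun _ _ => hdev0 p) x
  have hbase : MeasurableSet {x : Rn n | dyadicIndex a 0 x = 0} :=
    measurableSet_of_saturated (idx := dyadicIndex a) hmeas (k := 0) fun y hy z hz =>
      (hz : dyadicIndex a 0 z = dyadicIndex a 0 y).trans hy
  calc _ ≤ ∫⁻ x in {x : Rn n | dyadicIndex a 0 x = 0}, ENNReal.ofReal ((2 * D) ^ r) *
        ENNReal.ofReal ((∑ p : ι,
          (Metric.closedBall (c p) (ρ p)).indicator (fun _ => dev p) x) ^ r) := by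
        refine setLIntegral_mono' hbase fun x hx => ?_
        rw [← ENNReal.ofReal_mul (by positivity), ← Real.mul_rpow (by positivity) (hG0 x)]
        exact ENNReal.ofReal_le_ofReal (Real.rpow_le_rpow (abs_nonneg _) (hpt x hx) hr0.le)
    _ ≤ ∫⁻ x, ENNReal.ofReal ((2 * D) ^ r) *
        ENNReal.ofReal ((∑ p : ι,
          (Metric.closedBall (c p) (ρ p)).indicator (fun _ => dev p) x) ^ r) :=
        setLIntegral_le_lintegral _ _
    _ = ENNReal.ofReal ((2 * D) ^ r) * ∫⁻ x,
        ENNReal.ofReal ((∑ p : ι,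
          (Metric.closedBall (c p) (ρ p)).indicator (fun _ => dev p) x) ^ r) :=
        lintegral_const_mul' _ _ ENNReal.ofReal_ne_top
    _ ≤ ENNReal.ofReal ((2 * D) ^ r) * (C₁ * ∑ p : ι, ENNReal.ofReal (dev p ^ r) *
          volume (Metric.closedBall (c p) (ρ p))) := by
        gcongr
        exact hcar ι c ρ dev hsparse.carlesonPacking hρ hdev0
    _ ≤ _ := by
        gcongr
        calc ∑ p : ι, ENNReal.ofReal (dev p ^ r) * volume (Metric.closedBall (c p) (ρ p))
            = ENNReal.ofReal ((2 * V.toReal) ^ r) * ∑ p : ι,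
              ENNReal.ofReal ((dev p / (2 * V.toReal)) ^ r) *
                volume (Metric.closedBall (c p) (ρ p)) := by
              rw [Finset.mul_sum]
              refine Finset.sum_congr rfl fun p _ => ?_
              rw [← mul_assoc, ← ENNReal.ofReal_mul (by positivity),
                ← Real.mul_rpow (by positivity) (div_nonneg (hdev0 p) (by positivity)),
                mul_div_cancel₀ _ (by positivity)]
          _ ≤ _ := by gcongr

/-- Fatou's lemma is used twice: first as the dyadic level grows, to replace averages by `b` on a
fixed cube, then along a subsequence of growing cubes on which the averages converge to the required
constant. -/
theorem memDotLp_of_sparse {n : ℕ} (hn : 0 < n) {b : Rn n → ℝ}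
    (hb : LocallyIntegrable b volume) {r : ℝ} (hr : 1 < r)
    (h : ∀ Λ : ℝ≥0∞, Λ ≠ ∞ → ∃ C : ℝ≥0∞, C ≠ ∞ ∧ ∀ (ι : Type) [Fintype ι] (c : ι → Rn n)
      (ρ : ι → ℝ), (∀ j, 0 < ρ j) → SparseBalls Λ c ρ → ∀ o : ι → ℝ, (∀ j, 0 ≤ o j) →
      (∀ j α, o j * volume.real (Metric.closedBall (c j) (ρ j)) ≤
        ∫ x in Metric.closedBall (c j) (ρ j), |b x - α|) →
      ∑ j, ENNReal.ofReal (o j ^ r) * volume (Metric.closedBall (c j) (ρ j)) ≤ C) :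
    MemDotLp b (ENNReal.ofReal r) := by
  have hr0 : 0 < r := by linarith
  obtain ⟨C, hC, hcell⟩ := lintegral_cellAvg_sub_rpow_le hn hb hr h
  have hbm : AEMeasurable b := hb.aestronglyMeasurable.aemeasurable
  let Q : ℕ → Set (Rn n) := fun M => {x | dyadicIndex ((M : ℝ) + 1) 0 x = 0}
  have hpos : ∀ M : ℕ, (0 : ℝ) < (M : ℝ) + 1 := fun M => by positivity
  have hQm : ∀ M, MeasurableSet (Q M) := fun M =>
    measurableSet_of_saturated (idx := dyadicIndex ((M : ℝ) + 1))
      (measurableSet_dyadic_cell (hpos M)) (k := 0) fun y hy z hz =>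
      (hz : dyadicIndex ((M : ℝ) + 1) 0 z = dyadicIndex _ 0 y).trans hy
  let κ : ℕ → ℝ := fun M => cellAvg volume (dyadicIndex ((M : ℝ) + 1)) b 0 (0 : Rn n)
  have hκ : ∀ M, ∫⁻ x in Q M, ENNReal.ofReal (|b x - κ M| ^ r) ≤ C := by
    intro M
    have h0 : dyadicIndex ((M : ℝ) + 1) 0 (0 : Rn n) = 0 := mem_dyadic_base (hpos M) (by
      rw [norm_zero]; exact hpos M)
    have hc : ∀ x ∈ Q M, cellAvg volume (dyadicIndex ((M : ℝ) + 1)) b 0 x = κ M := fun x hx =>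
      cellAvg_congr ((hx : dyadicIndex ((M : ℝ) + 1) 0 x = 0).trans h0.symm)
    have hmeasN : ∀ N, Measurable fun x =>
        cellAvg volume (dyadicIndex ((M : ℝ) + 1)) b N x := by
      intro N s _
      refine measurableSet_of_saturated (idx := dyadicIndex ((M : ℝ) + 1))
        (measurableSet_dyadic_cell (hpos M)) (k := N) fun y hy z hz => ?_
      have hy : cellAvg volume (dyadicIndex ((M : ℝ) + 1)) b N y ∈ s := hy
      change cellAvg volume (dyadicIndex ((M : ℝ) + 1)) b N z ∈ s
      rwa [cellAvg_congr hz]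
    calc ∫⁻ x in Q M, ENNReal.ofReal (|b x - κ M| ^ r)
        = ∫⁻ x in Q M, liminf (fun N => ENNReal.ofReal
          (|cellAvg volume (dyadicIndex ((M : ℝ) + 1)) b N x -
            cellAvg volume (dyadicIndex ((M : ℝ) + 1)) b 0 x| ^ r)) atTop := by
          refine lintegral_congr_ae ?_
          filter_upwards [ae_restrict_of_ae (tendsto_cellAvg hb (hpos M) hn),
            ae_restrict_mem (hQm M)] with x hx hxQ
          rw [hc x hxQ]
          refine (Tendsto.liminf_eq ?_).symm
          refine ENNReal.tendsto_ofReal ?_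
          exact ((hx.sub_const _).abs).rpow_const (Or.inr hr0.le)
      _ ≤ liminf (fun N => ∫⁻ x in Q M, ENNReal.ofReal
          (|cellAvg volume (dyadicIndex ((M : ℝ) + 1)) b N x -
            cellAvg volume (dyadicIndex ((M : ℝ) + 1)) b 0 x| ^ r)) atTop := by
          refine lintegral_liminf_le fun N => ?_
          have h1 := hmeasN N
          have h2 := hmeasN 0
          fun_prop
      _ ≤ C := by
          refine liminf_le_of_le (by isBoundedDefault) fun y hy => ?_
          obtain ⟨N, hN⟩ := hy.exists
          exact hN.trans (hcell _ (hpos M) N)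
  -- On the smallest cube `b` is close in `L^r` both to `κ M` and to `κ 0`, with the same constant
  -- `C`, so these numbers stay within a fixed distance.
  have hbound : ∃ R : ℝ, ∀ M, κ M ∈ Metric.closedBall (κ 0) R := by
    have hv : 0 < volume (Q 0) ∧ volume (Q 0) ≠ ∞ := by
      have h0 : dyadicIndex (((0 : ℕ) : ℝ) + 1) 0 (0 : Rn n) = 0 := mem_dyadic_base (hpos 0) (by
        rw [norm_zero]; exact hpos 0)
      have hQ0 : Q 0 = cell (dyadicIndex (((0 : ℕ) : ℝ) + 1)) 0 (0 : Rn n) := by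
        ext x; simp only [Q, cell, h0]
      rw [hQ0, volume_dyadic_cell (hpos 0)]
      exact ⟨by simp only [ENNReal.ofReal_pos]; positivity, ENNReal.ofReal_ne_top⟩
    have hQsub : ∀ M, Q 0 ⊆ Q M := by
      intro M x hx
      have hx : dyadicIndex (((0 : ℕ) : ℝ) + 1) 0 x = 0 := hx
      change dyadicIndex ((M : ℝ) + 1) 0 x = 0
      funext i
      have hi := congrFun hx i
      simp only [dyadicIndex, pow_zero, one_mul, Pi.zero_apply, Int.floor_eq_zero_iff, Set.mem_Ico,
        Nat.cast_zero, zero_add, mul_one] at hi ⊢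
      have hM : (0 : ℝ) ≤ M := by positivity
      rw [le_div_iff₀ (by norm_num), div_lt_iff₀ (by norm_num)] at hi
      rw [le_div_iff₀ (by positivity), div_lt_iff₀ (by positivity)]
      constructor <;> linarith [hi.1, hi.2]
    have hle : ∀ M, ENNReal.ofReal (|κ M - κ 0| ^ r) * volume (Q 0) ≤
        ENNReal.ofReal (2 ^ r) * (C + C) := by
      intro M
      rw [← setLIntegral_const]
      calc ∫⁻ _ in Q 0, ENNReal.ofReal (|κ M - κ 0| ^ r)
          ≤ ∫⁻ x in Q 0, ENNReal.ofReal (2 ^ r) * (ENNReal.ofReal (|b x - κ M| ^ r) +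
            ENNReal.ofReal (|b x - κ 0| ^ r)) := by
            refine lintegral_mono fun x => ?_
            rw [← ENNReal.ofReal_add (by positivity) (by positivity),
              ← ENNReal.ofReal_mul (by positivity)]
            refine ENNReal.ofReal_le_ofReal ?_
            have h1 : |κ M - κ 0| ≤ |b x - κ M| + |b x - κ 0| := by
              have := abs_sub_le (κ M) (b x) (κ 0)
              rwa [abs_sub_comm (κ M) (b x)] at this
            rcases le_total (|b x - κ M|) (|b x - κ 0|) with h2 | h2
            · calc |κ M - κ 0| ^ r ≤ (2 * |b x - κ 0|) ^ r :=
                    Real.rpow_le_rpow (abs_nonneg _) (by linarith) hr0.le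
                _ = 2 ^ r * |b x - κ 0| ^ r := Real.mul_rpow (by norm_num) (abs_nonneg _)
                _ ≤ _ := by
                    gcongr
                    have : 0 ≤ |b x - κ M| ^ r := by positivity
                    linarith
            · calc |κ M - κ 0| ^ r ≤ (2 * |b x - κ M|) ^ r :=
                    Real.rpow_le_rpow (abs_nonneg _) (by linarith) hr0.le
                _ = 2 ^ r * |b x - κ M| ^ r := Real.mul_rpow (by norm_num) (abs_nonneg _)
                _ ≤ _ := by
                    gcongr
                    have : 0 ≤ |b x - κ 0| ^ r := by positivity
                    linarith
        _ = ENNReal.ofReal (2 ^ r) * ((∫⁻ x in Q 0, ENNReal.ofReal (|b x - κ M| ^ r)) +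
            ∫⁻ x in Q 0, ENNReal.ofReal (|b x - κ 0| ^ r)) := by
            rw [lintegral_const_mul' _ _ ENNReal.ofReal_ne_top, lintegral_add_left']
            exact (by fun_prop : AEMeasurable _ volume).restrict
        _ ≤ _ := by
            gcongr
            · exact (lintegral_mono_set (hQsub M)).trans (hκ M)
            · exact hκ 0
    set B := (ENNReal.ofReal (2 ^ r) * (C + C)) / volume (Q 0) with hB
    have hBt : B ≠ ∞ := ENNReal.div_ne_top (by finiteness) hv.1.ne'
    refine ⟨B.toReal ^ (1 / r), fun M => ?_⟩
    have h1 : ENNReal.ofReal (|κ M - κ 0| ^ r) ≤ B :=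
      (ENNReal.le_div_iff_mul_le (Or.inl hv.1.ne') (Or.inl hv.2)).2 (hle M)
    have h2 := (ENNReal.ofReal_le_iff_le_toReal hBt).1 h1
    rw [Metric.mem_closedBall, Real.dist_eq]
    calc |κ M - κ 0| = (|κ M - κ 0| ^ r) ^ (1 / r) := by
          rw [← Real.rpow_mul (abs_nonneg _), mul_one_div_cancel hr0.ne', Real.rpow_one]
      _ ≤ _ := Real.rpow_le_rpow (by positivity) h2 (by positivity)
  obtain ⟨R, hR⟩ := hbound
  obtain ⟨c, _, φ, hφ, hlim⟩ := (isCompact_closedBall (κ 0) R).tendsto_subseq hR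
  have hfinal : ∫⁻ x, ENNReal.ofReal (|b x - c| ^ r) ≤ C := by
    calc ∫⁻ x, ENNReal.ofReal (|b x - c| ^ r)
        = ∫⁻ x, liminf (fun k => (Q (φ k)).indicator
            (fun x => ENNReal.ofReal (|b x - κ (φ k)| ^ r)) x) atTop := by
          refine lintegral_congr fun x => ?_
          refine (Tendsto.liminf_eq ?_).symm
          have h1 : Tendsto (fun k => ENNReal.ofReal (|b x - κ (φ k)| ^ r)) atTop
              (𝓝 (ENNReal.ofReal (|b x - c| ^ r))) := by
            refine ENNReal.tendsto_ofReal ?_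
            exact ((hlim.const_sub _).abs).rpow_const (Or.inr hr0.le)
          refine h1.congr' ?_
          obtain ⟨K, hK⟩ := exists_nat_gt ‖x‖
          filter_upwards [eventually_ge_atTop K] with k hk
          rw [Set.indicator_of_mem]
          refine mem_dyadic_base (hpos _) (hK.trans_le ?_)
          have : K ≤ φ k := hk.trans (hφ.id_le k)
          have : (K : ℝ) ≤ φ k := by exact_mod_cast this
          linarith
      _ ≤ liminf (fun k => ∫⁻ x, (Q (φ k)).indicator
            (fun x => ENNReal.ofReal (|b x - κ (φ k)| ^ r)) x) atTop := by
          refine lintegral_liminf_le' fun k => ?_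
          exact (by fun_prop : AEMeasurable _ volume).indicator (hQm _)
      _ ≤ C := by
          refine liminf_le_of_le (by isBoundedDefault) fun y hy => ?_
          obtain ⟨k, hk⟩ := hy.exists
          rw [lintegral_indicator (hQm _)] at hk
          exact hk.trans (hκ _)
  have hmem : MemLp (fun x => b x - c) (ENNReal.ofReal r) volume := by
    refine ⟨hb.aestronglyMeasurable.sub aestronglyMeasurable_const, ?_⟩
    rw [eLpNorm_lt_top_iff_lintegral_rpow_enorm_lt_top (by simpa using hr0) ENNReal.ofReal_ne_top,
      ENNReal.toReal_ofReal hr0.le]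
    refine lt_of_le_of_lt (le_of_eq ?_) (hfinal.trans_lt hC.lt_top)
    refine lintegral_congr fun x => ?_
    rw [← ofReal_norm, Real.norm_eq_abs, ENNReal.ofReal_rpow_of_nonneg (abs_nonneg _) hr0.le]
  refine ⟨fun x R => ?_, (iInf_le _ c).trans_lt hmem.2⟩
  have h1 := hmem.restrict (Metric.ball x R)
  have : IsFiniteMeasure (volume.restrict (Metric.ball x R)) :=
    ⟨by rw [Measure.restrict_apply_univ]; exact measure_ball_lt_top⟩
  have h2 := h1.add (memLp_const (μ := volume.restrict (Metric.ball x R)) (p := ENNReal.ofReal r) c)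
  refine h2.ae_eq (Eventually.of_forall fun y => ?_)
  simp

/-! ### Convergence in measure -/

section InMeasure

variable {α : Type*} {mα : MeasurableSpace α} {μ : Measure α} {E : Type*} [NormedAddCommGroup E]

theorem tendstoInMeasure_add {f f' : ℕ → α → E} {g g' : α → E}
    (h : TendstoInMeasure μ f atTop g) (h' : TendstoInMeasure μ f' atTop g') :
    TendstoInMeasure μ (fun k x => f k x + f' k x) atTop (fun x => g x + g' x) := by
  rw [tendstoInMeasure_iff_norm] at *
  intro ε hε
  have hsum := (h (ε / 2) (by positivity)).add (h' (ε / 2) (by positivity))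
  rw [add_zero] at hsum
  refine tendsto_of_tendsto_of_tendsto_of_le_of_le tendsto_const_nhds hsum (fun _ => zero_le)
    fun k => (measure_mono fun x hx => ?_).trans (measure_union_le _ _)
  by_contra hcon
  simp only [Set.mem_union, Set.mem_ofPred_eq, not_or, not_le] at hcon hx
  have : f k x + f' k x - (g x + g' x) = (f k x - g x) + (f' k x - g' x) := by abel
  rw [this] at hx
  have := norm_add_le (f k x - g x) (f' k x - g' x)
  linarith [hcon.1, hcon.2]

theorem tendstoInMeasure_zero (μ : Measure α) :
    TendstoInMeasure μ (fun (_ : ℕ) (_ : α) => (0 : E)) atTop (fun _ => 0) := by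
  rw [tendstoInMeasure_iff_norm]
  intro ε hε
  have : {x : α | ε ≤ ‖(0 : E) - 0‖} = ∅ := by
    ext x; simpa using hε
  simp only [this, measure_empty, tendsto_const_nhds]

theorem tendstoInMeasure_finset_sum {ι : Type*} (s : Finset ι) {f : ι → ℕ → α → E} {g : ι → α → E}
    (h : ∀ i ∈ s, TendstoInMeasure μ (f i) atTop (g i)) :
    TendstoInMeasure μ (fun k x => ∑ i ∈ s, f i k x) atTop (fun x => ∑ i ∈ s, g i x) := by
  classical
  induction s using Finset.induction_on with
  | empty => simpa using tendstoInMeasure_zero μ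
  | insert a s ha ih =>
    simp only [Finset.sum_insert ha]
    exact tendstoInMeasure_add (h a (by simp)) (ih fun i hi => h i (by simp [hi]))

theorem tendstoInMeasure_const_mul {f : ℕ → α → ℂ} {g : α → ℂ}
    (h : TendstoInMeasure μ f atTop g) (c : ℂ) :
    TendstoInMeasure μ (fun k x => c * f k x) atTop (fun x => c * g x) := by
  rcases eq_or_ne c 0 with rfl | hc
  · simpa using tendstoInMeasure_zero μ
  rw [tendstoInMeasure_iff_norm] at *
  intro ε hε
  have hc' : 0 < ‖c‖ := norm_pos_iff.2 hc
  refine (h (ε / ‖c‖) (by positivity)).congr fun k => ?_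
  congr 1
  ext x
  simp only [Set.mem_ofPred_eq]
  rw [← mul_sub, norm_mul, div_le_iff₀' hc']

/-- Completeness of convergence in measure. A subsequence with summable exceptional sets converges
almost everywhere by Borel–Cantelli, and the Cauchy property compares the whole sequence with its
limit. -/
theorem exists_tendstoInMeasure_of_cauchy [CompleteSpace E] {f : ℕ → α → E}
    (hf : ∀ k, AEStronglyMeasurable (f k) μ)
    (hcau : ∀ ε : ℝ, 0 < ε → ∀ δ : ℝ≥0∞, 0 < δ → ∃ N, ∀ k ≥ N, ∀ l ≥ N,
      μ {x | ε ≤ ‖f k x - f l x‖} ≤ δ) :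
    ∃ g : α →ₘ[μ] E, TendstoInMeasure μ f atTop g := by
  have hN : ∀ j : ℕ, ∃ N, ∀ k ≥ N, ∀ l ≥ N,
      μ {x | (1 / 2 : ℝ) ^ j ≤ ‖f k x - f l x‖} ≤ (2⁻¹ : ℝ≥0∞) ^ j := fun j =>
    hcau _ (by positivity) _ (ENNReal.pow_pos (by simp) _)
  choose N hN using hN
  set ns : ℕ → ℕ := fun j => (Finset.range (j + 1)).sup N + j with hns
  have hnsN : ∀ j, N j ≤ ns j := fun j =>
    (Finset.le_sup (f := N) (by simp)).trans (Nat.le_add_right _ _)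
  have hnsmono : StrictMono ns := by
    refine strictMono_nat_of_lt_succ fun j => ?_
    have : (Finset.range (j + 1)).sup N ≤ (Finset.range (j + 1 + 1)).sup N :=
      Finset.sup_mono (by intro a; simp; omega)
    simp only [hns]; omega
  have hae : ∀ᵐ x ∂μ, ∃ y, Tendsto (fun j => f (ns j) x) atTop (𝓝 y) := by
    have hsum : ∑' j, μ {x | (1 / 2 : ℝ) ^ j ≤ ‖f (ns (j + 1)) x - f (ns j) x‖} ≠ ∞ := by
      refine ne_top_of_le_ne_top ?_ (ENNReal.tsum_le_tsum fun j => hN j _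
        ((hnsN j).trans (hnsmono.monotone (Nat.le_succ j))) _ (hnsN j))
      simpa only [ENNReal.tsum_geometric, ENNReal.one_sub_inv_two, inv_inv] using
        ENNReal.ofNat_ne_top
    filter_upwards [ae_eventually_notMem hsum] with x hx
    refine cauchySeq_tendsto_of_complete (cauchySeq_of_summable_dist ?_)
    refine Summable.of_norm_bounded_eventually_nat
      (g := fun j => (1 / 2 : ℝ) ^ j) summable_geometric_two ?_
    filter_upwards [hx] with j hj
    simp only [not_le] at hj
    rw [Real.norm_of_nonneg dist_nonneg, dist_comm, dist_eq_norm]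
    exact hj.le
  obtain ⟨g, hg, hlim⟩ := exists_stronglyMeasurable_limit_of_tendsto_ae (fun j => hf (ns j)) hae
  refine ⟨AEEqFun.mk g hg.aestronglyMeasurable, ?_⟩
  refine TendstoInMeasure.congr_right (AEEqFun.coeFn_mk g _).symm ?_
  rw [tendstoInMeasure_iff_norm]
  intro ε hε
  rw [ENNReal.tendsto_atTop_zero]
  intro δ hδ
  obtain ⟨M, hM⟩ := hcau (ε / 2) (by positivity) δ hδ
  refine ⟨M, fun k hk => ?_⟩
  let A : Set α := {x | ε ≤ ‖f k x - g x‖}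
  -- Where `f k` is far from the limit, it is eventually far from the subsequence. The increasing
  -- union has measure at most `δ` because each of its members does.
  let B : Set α := ⋃ i, ⋂ j ≥ i, {x | ε / 2 ≤ ‖f k x - f (ns j) x‖}
  have hsub : A ≤ᵐ[μ] B := by
    filter_upwards [hlim] with x hx (hxε : ε ≤ ‖f k x - g x‖)
    have h1 : Tendsto (fun j => ‖f k x - f (ns j) x‖) atTop (𝓝 ‖f k x - g x‖) :=
      (hx.const_sub _).norm
    obtain ⟨i, hi⟩ := eventually_atTop.1
      (h1.eventually (lt_mem_nhds (show ε / 2 < ‖f k x - g x‖ by linarith)))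
    exact Set.mem_iUnion.2 ⟨i, Set.mem_iInter₂.2 fun j hj => (hi j hj).le⟩
  refine (measure_mono_ae hsub).trans ?_
  rw [Monotone.measure_iUnion]
  · refine iSup_le fun j => ?_
    refine (measure_mono (Set.biInter_subset_of_mem (show max j M ≥ j from le_max_left _ _))).trans
      (hM k hk _ ?_)
    exact (le_max_right _ _).trans (hnsmono.id_le _)
  · intro i j hij
    exact Set.biInter_subset_biInter_left fun a (ha : a ≥ j) => le_trans hij ha

end InMeasure

/-! ### Test functions and a smooth Calderón–Zygmund decomposition -/

/-- A smooth, compactly supported function as a test function. -/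
def mkTestFn {n : ℕ} (φ : Rn n → ℂ) (h : ContDiff ℝ ((⊤ : ℕ∞) : WithTop ℕ∞) φ)
    (hc : HasCompactSupport φ) : TestFn n :=
  ⟨φ, h, hc, fun _ _ => trivial⟩

theorem TestFn.integrable {n : ℕ} (f : TestFn n) : Integrable f :=
  f.continuous.integrable_of_hasCompactSupport f.hasCompactSupport

/-- By continuity the averages of `|f|` over small balls around `x` are at least `t`, while over
huge balls they tend to zero. Enlarging by the factor `6` repeatedly, one meets a last radius with
average at least `t`. -/
theorem exists_stopping_radius {n : ℕ} (hn : 0 < n) (f : TestFn n) {t : ℝ} (ht : 0 < t) {x : Rn n}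
    (hx : 2 * t ≤ ‖f x‖) : ∃ r : ℝ, 0 < r ∧
      t * volume.real (Metric.closedBall x r) ≤ ∫ y in Metric.closedBall x r, ‖f y‖ ∧
      ∫ y in Metric.closedBall x (6 * r), ‖f y‖ ≤ t * volume.real (Metric.closedBall x (6 * r)) := by
  let P : ℝ → Prop := fun r =>
    t * volume.real (Metric.closedBall x r) ≤ ∫ y in Metric.closedBall x r, ‖f y‖
  obtain ⟨r₀, hr₀, hP₀⟩ : ∃ r, 0 < r ∧ P r := by
    have hev : ∀ᶠ y in 𝓝 x, t ≤ ‖f y‖ := by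
      have := f.continuous.norm.continuousAt (x := x)
      filter_upwards [this.eventually (lt_mem_nhds (show t < ‖f x‖ by linarith))] with y hy
        using hy.le
    obtain ⟨r, hr, hsub⟩ := Metric.nhds_basis_closedBall.eventually_iff.1 hev
    refine ⟨r, hr, ?_⟩
    have h1 : ∫ _ in Metric.closedBall x r, t ≤ ∫ y in Metric.closedBall x r, ‖f y‖ :=
      setIntegral_mono_on (integrableOn_const measure_closedBall_lt_top.ne)
        (TestFn.integrable f).norm.integrableOn Metric.isClosed_closedBall.measurableSet
        fun y hy => hsub hy
    rwa [setIntegral_const, smul_eq_mul, mul_comm] at h1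
  by_contra! hcon
  -- If there were no last radius, all radii `6 ^ k * r₀` would have averages at least `t`, and the
  -- integral of `|f|` would be infinite.
  have hPall : ∀ k : ℕ, P (6 ^ k * r₀) := by
    intro k
    induction k with
    | zero => simpa using hP₀
    | succ k ih =>
      have := hcon _ (by positivity) ih
      rw [← mul_assoc, ← pow_succ'] at this
      exact this.le
  have hle : ∀ k : ℕ, t * volume.real (Metric.closedBall x (6 ^ k * r₀)) ≤ ∫ y, ‖f y‖ := fun k =>
    (hPall k).trans (setIntegral_le_integral (TestFn.integrable f).norm
      (Eventually.of_forall fun _ => norm_nonneg _))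
  set v := volume.real (Metric.closedBall x r₀) with hv
  have hv0 : 0 < v := ENNReal.toReal_pos (Metric.measure_closedBall_pos _ _ hr₀).ne'
    measure_closedBall_lt_top.ne
  have hvk : ∀ k : ℕ, volume.real (Metric.closedBall x (6 ^ k * r₀)) = (6 ^ k) ^ n * v := fun k => by
    rw [measureReal_def, Measure.addHaar_closedBall_mul _ _ (by positivity) hr₀.le,
      ENNReal.toReal_mul, ENNReal.toReal_ofReal (by positivity),
      ← Measure.addHaar_closedBall_center volume x, finrank_euclideanSpace, Fintype.card_fin]
    rfl
  obtain ⟨k, hk⟩ := pow_unbounded_of_one_lt ((∫ y, ‖f y‖) / (t * v)) (show (1 : ℝ) < 6 by norm_num)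
  have h1 := hle k
  rw [hvk, div_lt_iff₀ (by positivity)] at *
  have h2 : (6 : ℝ) ^ k ≤ (6 ^ k) ^ n := le_self_pow₀ (one_le_pow₀ (by norm_num)) hn.ne'
  have h3 := mul_le_mul_of_nonneg_right h2 (by positivity : 0 ≤ t * v)
  have h4 : t * ((6 ^ k) ^ n * v) = (6 ^ k) ^ n * (t * v) := by ring
  linarith

open scoped Manifold ContDiff in
theorem exists_smooth_cutoffs {n : ℕ} {ι : Type} [Fintype ι] {K : Set (Rn n)} (hK : IsClosed K)
    (c : ι → Rn n) (ρ : ι → ℝ) (hcov : K ⊆ ⋃ j, Metric.ball (c j) (ρ j)) :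
    ∃ ψ : ι → Rn n → ℝ, (∀ j, ContDiff ℝ ∞ (ψ j)) ∧ (∀ j x, 0 ≤ ψ j x) ∧
      (∀ j, tsupport (ψ j) ⊆ Metric.ball (c j) (ρ j)) ∧ (∀ x, ∑ j, ψ j x ≤ 1) ∧
      ∀ x ∈ K, ∑ j, ψ j x = 1 := by
  obtain ⟨f, hf⟩ := SmoothPartitionOfUnity.exists_isSubordinate 𝓘(ℝ, Rn n) hK
    (fun j => Metric.ball (c j) (ρ j)) (fun j => Metric.isOpen_ball) hcov
  refine ⟨fun j => f j, fun j => (f j).contMDiff.contDiff, fun j x => f.nonneg j x, hf,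
    fun x => ?_, fun x hx => ?_⟩
  · rw [← finsum_eq_sum_of_fintype]; exact f.sum_le_one x
  · rw [← finsum_eq_sum_of_fintype]; exact f.sum_eq_one hx

theorem volume_real_closedBall_mul {n : ℕ} (x : Rn n) {a r : ℝ} (ha : 0 ≤ a) (hr : 0 ≤ r) :
    volume.real (Metric.closedBall x (a * r)) = a ^ n * volume.real (Metric.closedBall x r) := by
  rw [measureReal_def, Measure.addHaar_closedBall_mul _ _ ha hr,
      ENNReal.toReal_mul, ENNReal.toReal_ofReal (by positivity),
      ← Measure.addHaar_closedBall_center volume x, finrank_euclideanSpace, Fintype.card_fin]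
  rfl

theorem volume_real_closedBall_pos {n : ℕ} (x : Rn n) {r : ℝ} (hr : 0 < r) :
    0 < volume.real (Metric.closedBall x r) :=
  ENNReal.toReal_pos (Metric.measure_closedBall_pos _ _ hr).ne' measure_closedBall_lt_top.ne

theorem exists_stopping_balls {n : ℕ} (hn : 0 < n) (f : TestFn n) {t : ℝ} (ht : 0 < t) :
    ∃ (u : Finset (Rn n)) (r : Rn n → ℝ), (∀ x ∈ u, 0 < r x) ∧
      ((u : Set (Rn n)).PairwiseDisjoint fun x => Metric.closedBall x (r x)) ∧
      ({x | 2 * t ≤ ‖f x‖} ⊆ ⋃ x ∈ u, Metric.ball x (6 * r x)) ∧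
      (∀ x ∈ u, t * volume.real (Metric.closedBall x (r x)) ≤
        ∫ y in Metric.closedBall x (r x), ‖f y‖) ∧
      ∀ x ∈ u, ∫ y in Metric.closedBall x (6 * r x), ‖f y‖ ≤
        t * volume.real (Metric.closedBall x (6 * r x)) := by
  classical
  set K : Set (Rn n) := {x | 2 * t ≤ ‖f x‖} with hK
  have hKc : IsCompact K := by
    refine f.hasCompactSupport.isCompact.of_isClosed_subset
      (isClosed_le continuous_const f.continuous.norm) fun x hx => subset_tsupport _ ?_
    have hx : 2 * t ≤ ‖f x‖ := hx
    exact norm_pos_iff.1 (by linarith)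
  have hr : ∀ x, ∃ r : ℝ, x ∈ K → 0 < r ∧
      t * volume.real (Metric.closedBall x r) ≤ ∫ y in Metric.closedBall x r, ‖f y‖ ∧
      ∫ y in Metric.closedBall x (6 * r), ‖f y‖ ≤
        t * volume.real (Metric.closedBall x (6 * r)) := fun x => by
    by_cases hx : x ∈ K
    · obtain ⟨r, h⟩ := exists_stopping_radius hn f ht hx
      exact ⟨r, fun _ => h⟩
    · exact ⟨0, fun h => absurd h hx⟩
  choose r hr using hr
  obtain ⟨s, hsK, hcov⟩ := hKc.elim_nhds_subcover (fun x => Metric.ball x (r x))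
    fun x hx => Metric.ball_mem_nhds x (hr x hx).1
  obtain ⟨R, hR⟩ : ∃ R, ∀ a ∈ s, r a ≤ R := by
    obtain ⟨R, hR⟩ := (s.image r).bddAbove
    exact ⟨R, fun a ha => hR (by simpa using ⟨a, ha, rfl⟩)⟩
  obtain ⟨u, hus, hdis, hcov'⟩ := Vitali.exists_disjoint_subfamily_covering_enlargement_closedBall
    (s : Set (Rn n)) id r R hR 4 (by norm_num)
  have hmem : ∀ x, x ∈ s.filter (· ∈ u) ↔ x ∈ u := fun x => by
    simp only [Finset.mem_filter, and_iff_right_iff_imp]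
    exact fun hx => hus hx
  have huK : ∀ x ∈ s.filter (· ∈ u), x ∈ K := fun x hx => hsK x (Finset.mem_filter.1 hx).1
  refine ⟨s.filter (· ∈ u), r, fun x hx => (hr x (huK x hx)).1, ?_, ?_,
    fun x hx => (hr x (huK x hx)).2.1, fun x hx => (hr x (huK x hx)).2.2⟩
  · intro x hx y hy hxy
    exact hdis ((hmem x).1 hx) ((hmem y).1 hy) hxy
  · intro x hx
    have := hcov hx
    simp only [Set.mem_iUnion] at this ⊢
    obtain ⟨y, hy, hxy⟩ := this
    obtain ⟨z, hz, hsub⟩ := hcov' y hy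
    refine ⟨z, (hmem z).2 hz, ?_⟩
    have h1 := hsub (Metric.ball_subset_closedBall hxy)
    -- Vitali gives a closed ball enlarged four times. It fits strictly inside the open ball
    -- enlarged six times, which leaves room for smooth cutoffs.
    have hz0 := (hr z (huK z ((hmem z).2 hz))).1
    exact Metric.closedBall_subset_ball (by linarith) h1

open scoped ContDiff in
/-- A smooth Calderón–Zygmund decomposition. -/
theorem exists_calderonZygmund_decomposition {n : ℕ} (hn : 0 < n) (f : TestFn n) {t : ℝ}
    (ht : 0 < t) :
    ∃ (ι : Type) (_ : Fintype ι) (c : ι → Rn n) (ρ : ι → ℝ) (g : TestFn n) (β : ι → TestFn n),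
      f = g + ∑ j, β j ∧ (∀ x, ‖g x‖ ≤ (2 + 12 ^ n) * t) ∧ (∀ j, 0 < ρ j) ∧
      (∀ j, tsupport (β j) ⊆ Metric.closedBall (c j) (ρ j)) ∧ (∀ j, ∫ x, β j x = 0) ∧
      ∑ j, ∫ x, ‖β j x‖ ≤ 2 * ∫ x, ‖f x‖ ∧
      t * ∑ j, volume.real (Metric.closedBall (c j) (ρ j)) ≤ 6 ^ n * ∫ x, ‖f x‖ := by
  classical
  obtain ⟨u, r, hr, hdis, hcov, hlow, hup⟩ := exists_stopping_balls hn f ht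
  let ι : Type := {x // x ∈ u}
  have hK : IsClosed {x | 2 * t ≤ ‖f x‖} := isClosed_le continuous_const f.continuous.norm
  obtain ⟨ψ, hψs, hψ0, hψsupp, hψ1, hψK⟩ := exists_smooth_cutoffs (ι := ι) hK (fun j => (j : Rn n))
    (fun j => 6 * r j) (fun x hx => by
      have := hcov hx
      simp only [Set.mem_iUnion] at this ⊢
      obtain ⟨y, hy, hxy⟩ := this
      exact ⟨⟨y, hy⟩, hxy⟩)
  have hr' : ∀ j : ι, 0 < r j := fun j => hr j j.2
  let η : ∀ j : ι, ContDiffBump (j : Rn n) := fun j =>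
    ⟨r j / 2, r j, half_pos (hr' j), half_lt_self (hr' j)⟩
  let e : ι → Rn n → ℝ := fun j => (η j).normed volume
  have he0 : ∀ j x, 0 ≤ e j x := fun j x => (η j).nonneg_normed x
  have hesupp : ∀ j, Function.support (e j) = Metric.ball (j : Rn n) (r j) := fun j =>
    (η j).support_normed_eq
  have heint : ∀ j, ∫ x, e j x = 1 := fun j => (η j).integral_normed
  have hecont : ∀ j, ContDiff ℝ ∞ (e j) := fun j => (η j).contDiff_normed
  have hecs : ∀ j, HasCompactSupport (e j) := fun j => (η j).hasCompactSupport_normed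
  have heI : ∀ j, Integrable (e j) := fun j => (η j).integrable_normed
  have hele : ∀ j x, e j x ≤ 2 ^ n / volume.real (Metric.closedBall (j : Rn n) (r j)) := by
    intro j x
    refine ((η j).normed_le_div_measure_closedBall_rIn volume x).trans (le_of_eq ?_)
    have h1 := volume_real_closedBall_mul (j : Rn n) (a := 2) (r := r j / 2) (by norm_num)
      (half_pos (hr' j)).le
    rw [mul_div_cancel₀ _ two_ne_zero] at h1
    have h2 := volume_real_closedBall_pos (j : Rn n) (half_pos (hr' j))
    rw [h1]
    change 1 / volume.real (Metric.closedBall (j : Rn n) (r j / 2)) = _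
    field_simp
  let a : ι → ℂ := fun j => ∫ x, f x * (ψ j x : ℂ)
  have hfψs : ∀ j, ContDiff ℝ ∞ fun x => f x * (ψ j x : ℂ) := fun j =>
    f.contDiff.mul (Complex.ofRealCLM.contDiff.comp (hψs j))
  have hfψc : ∀ j, HasCompactSupport fun x => f x * (ψ j x : ℂ) := fun j =>
    f.hasCompactSupport.mul_right
  have hfψI : ∀ j, Integrable fun x => f x * (ψ j x : ℂ) := fun j =>
    (hfψs j).continuous.integrable_of_hasCompactSupport (hfψc j)
  have hes : ∀ j, ContDiff ℝ ∞ fun x => a j * (e j x : ℂ) := fun j =>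
    contDiff_const.mul (Complex.ofRealCLM.contDiff.comp (hecont j))
  have hec : ∀ j, HasCompactSupport fun x => a j * (e j x : ℂ) := fun j =>
    ((hecs j).comp_left (g := fun y : ℝ => (y : ℂ)) Complex.ofReal_zero).mul_left
  -- The mean is removed by a bump on the small ball of radius `r j`, not on the ball of radius `6 *
  -- r j` that carries the cutoff. The small balls are disjoint, so at most one bump is nonzero at
  -- each point and the overlap of the large balls need not be counted.
  let β : ι → TestFn n := fun j =>
    mkTestFn _ (hfψs j) (hfψc j) - mkTestFn _ (hes j) (hec j)
  have hβ : ∀ j x, β j x = f x * (ψ j x : ℂ) - a j * (e j x : ℂ) := fun j x => rfl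
  have heIC : ∀ j, Integrable fun x => a j * (e j x : ℂ) := fun j => (heI j).ofReal.const_mul _
  have hψle : ∀ j x, ψ j x ≤ 1 := fun j x =>
    (Finset.single_le_sum (f := fun j => ψ j x) (fun j _ => hψ0 j x) (Finset.mem_univ j)).trans
      (hψ1 x)
  have hnfψ : ∀ j x, ‖f x * (ψ j x : ℂ)‖ = ‖f x‖ * ψ j x := fun j x => by
    rw [norm_mul, Complex.norm_real, Real.norm_of_nonneg (hψ0 j x)]
  have ha : ∀ j, ‖a j‖ ≤ ∫ x, ‖f x‖ * ψ j x := fun j => by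
    refine (norm_integral_le_integral_norm _).trans (le_of_eq ?_)
    simp_rw [hnfψ]
  have hfψI' : ∀ j, Integrable fun x => ‖f x‖ * ψ j x := fun j => by
    have := (hfψI j).norm
    simp_rw [hnfψ] at this
    exact this
  have ha' : ∀ j : ι, ‖a j‖ ≤ t * (6 ^ n * volume.real (Metric.closedBall (j : Rn n) (r j))) := by
    intro j
    rw [← volume_real_closedBall_mul _ (by norm_num) (hr' j).le]
    refine (ha j).trans (le_trans ?_ (hup j j.2))
    rw [← setIntegral_eq_integral_of_forall_compl_eq_zero
      (s := Metric.closedBall (j : Rn n) (6 * r j))]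
    · refine setIntegral_mono (hfψI' j).integrableOn (TestFn.integrable f).norm.integrableOn
        fun x => mul_le_of_le_one_right (norm_nonneg _) (hψle j x)
    · intro x hx
      have : ψ j x = 0 := by
        by_contra h0
        exact hx (Metric.ball_subset_closedBall (hψsupp j (subset_tsupport _ h0)))
      rw [this, mul_zero]
  refine ⟨ι, inferInstance, fun j => j, fun j => 6 * r j, f - ∑ j, β j, β, by abel, ?_,
    fun j => mul_pos (by norm_num) (hr' j), ?_, ?_, ?_, ?_⟩
  · intro x
    have hg : (f - ∑ j, β j) x = f x * ((1 - ∑ j, ψ j x : ℝ) : ℂ) + ∑ j, a j * (e j x : ℂ) := by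
      have h1 : (f - ∑ j, β j) x = f x - ∑ j, β j x := by
        simp
      rw [h1]
      simp_rw [hβ]
      rw [Finset.sum_sub_distrib, ← Finset.mul_sum]
      push_cast
      ring
    rw [hg]
    refine (norm_add_le _ _).trans ?_
    rw [add_mul]
    refine add_le_add ?_ ?_
    · rw [norm_mul, Complex.norm_real, Real.norm_of_nonneg (by linarith [hψ1 x])]
      by_cases hx : x ∈ {x | 2 * t ≤ ‖f x‖}
      · rw [hψK x hx, sub_self, mul_zero]; positivity
      · have hx : ‖f x‖ < 2 * t := not_le.1 hx
        have h0 : 0 ≤ ∑ j, ψ j x := Finset.sum_nonneg fun j _ => hψ0 j x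
        exact (mul_le_of_le_one_right (norm_nonneg _) (by linarith)).trans hx.le
    -- Of `12 ^ n`, the factor `6 ^ n` comes from the average over the enlarged ball and `2 ^ n`
    -- from the height of a normalised bump whose inner radius is half the outer one.
    · have hterm : ∀ j, ‖a j * (e j x : ℂ)‖ ≤ 12 ^ n * t := by
        intro j
        rw [norm_mul, Complex.norm_real, Real.norm_of_nonneg (he0 j x)]
        have hv := volume_real_closedBall_pos (j : Rn n) (hr' j)
        calc ‖a j‖ * e j x ≤ t * (6 ^ n * volume.real (Metric.closedBall (j : Rn n) (r j))) *
              (2 ^ n / volume.real (Metric.closedBall (j : Rn n) (r j))) :=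
              mul_le_mul (ha' j) (hele j x) (he0 j x) (by positivity)
          _ = (6 * 2) ^ n * t := by rw [mul_pow]; field_simp
          _ = _ := by norm_num
      by_cases hex : ∃ j, e j x ≠ 0
      · obtain ⟨j, hj⟩ := hex
        rw [Finset.sum_eq_single j]
        · exact hterm j
        · intro i _ hij
          have : e i x = 0 := by
            by_contra hi
            have h1 : x ∈ Metric.ball (i : Rn n) (r i) := hesupp i ▸ hi
            have h2 : x ∈ Metric.ball (j : Rn n) (r j) := hesupp j ▸ hj
            exact Set.disjoint_left.1 (hdis i.2 j.2 fun h => hij (Subtype.ext h))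
              (Metric.ball_subset_closedBall h1) (Metric.ball_subset_closedBall h2)
          rw [this]; simp
        · simp
      · push Not at hex
        simp only [hex, Complex.ofReal_zero, mul_zero, Finset.sum_const_zero, norm_zero]
        positivity
  · intro j
    refine closure_minimal (fun x hx => ?_) Metric.isClosed_closedBall
    by_contra hxb
    apply hx
    have h1 : ψ j x = 0 := by
      by_contra h0
      exact hxb (Metric.ball_subset_closedBall (hψsupp j (subset_tsupport _ h0)))
    have h2 : e j x = 0 := by
      by_contra h0
      have : x ∈ Metric.ball (j : Rn n) (r j) := hesupp j ▸ h0
      exact hxb (Metric.closedBall_subset_closedBall (by linarith [hr' j])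
        (Metric.ball_subset_closedBall this))
    rw [hβ, h1, h2]; simp
  · intro j
    simp_rw [hβ]
    rw [integral_sub (hfψI j) (heIC j), integral_const_mul, integral_complex_ofReal, heint]
    simp [a]
  · calc ∑ j, ∫ x, ‖β j x‖ ≤ ∑ j, 2 * ∫ x, ‖f x‖ * ψ j x := by
          refine Finset.sum_le_sum fun j _ => ?_
          calc ∫ x, ‖β j x‖ ≤ ∫ x, (‖f x‖ * ψ j x + ‖a j‖ * e j x) := by
                refine integral_mono (TestFn.integrable _).norm
                  ((hfψI' j).add ((heI j).const_mul _)) fun x => ?_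
                simp only [hβ]
                refine (norm_sub_le _ _).trans (le_of_eq ?_)
                rw [hnfψ, norm_mul, Complex.norm_real, Real.norm_of_nonneg (he0 j x)]
            _ = (∫ x, ‖f x‖ * ψ j x) + ‖a j‖ := by
                rw [integral_add (hfψI' j) ((heI j).const_mul _), integral_const_mul, heint, mul_one]
            _ ≤ _ := by linarith [ha j]
      _ = 2 * ∫ x, ∑ j, ‖f x‖ * ψ j x := by
          rw [← Finset.mul_sum, integral_finsetSum _ fun j _ => hfψI' j]
      _ ≤ _ := by
          refine mul_le_mul_of_nonneg_left ?_ (by norm_num)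
          refine integral_mono (integrable_finsetSum _ fun j _ => hfψI' j)
            (TestFn.integrable f).norm fun x => ?_
          simp only
          rw [← Finset.mul_sum]
          exact mul_le_of_le_one_right (norm_nonneg _) (hψ1 x)
  · calc t * ∑ j : ι, volume.real (Metric.closedBall (j : Rn n) (6 * r j))
        = 6 ^ n * ∑ j : ι, t * volume.real (Metric.closedBall (j : Rn n) (r j)) := by
          rw [Finset.mul_sum, Finset.mul_sum]
          refine Finset.sum_congr rfl fun j _ => ?_
          rw [volume_real_closedBall_mul _ (by norm_num) (hr' j).le]; ring
      _ ≤ 6 ^ n * ∑ j : ι, ∫ y in Metric.closedBall (j : Rn n) (r j), ‖f y‖ := by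
          gcongr with j
          exact hlow j j.2
      _ = 6 ^ n * ∫ y in ⋃ j : ι, Metric.closedBall (j : Rn n) (r j), ‖f y‖ := by
          rw [integral_iUnion_fintype (ι := ι) (fun j => Metric.isClosed_closedBall.measurableSet)
            (fun i j hij => hdis i.2 j.2 fun h => hij (Subtype.ext h))
            fun j => (TestFn.integrable f).norm.integrableOn]
      _ ≤ _ := by
          refine mul_le_mul_of_nonneg_left ?_ (by positivity)
          exact setIntegral_le_integral (TestFn.integrable f).norm
            (Eventually.of_forall fun _ => norm_nonneg _)

/-! ### Kernels -/

theorem IsModulus.tendsto_nhdsGE {ω : ℝ → ℝ} (hω : IsModulus ω)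
    (h0 : Tendsto ω (𝓝[>] 0) (𝓝 0)) : Tendsto ω (𝓝[≥] 0) (𝓝 0) := by
  have : Set.Ici (0 : ℝ) = insert 0 (Set.Ioi 0) := by
    ext x; simp [le_iff_eq_or_lt, eq_comm]
  rw [this, nhdsWithin_insert, tendsto_sup]
  refine ⟨?_, h0⟩
  rw [tendsto_pure_left]
  intro s hs
  rw [hω.zero]
  exact mem_of_mem_nhds hs

/-- Regularity moves one coordinate at a time, so `y` is reached from `y₀` through the mixed points
that agree with `y` on a growing set of coordinates. -/
theorem RegularityCondition.continuousAt {n m : ℕ} {K : Rn n → (Fin m → Rn n) → ℂ} {ω : ℝ → ℝ}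
    (hK : RegularityCondition K ω) (hω : IsModulus ω) (h0 : Tendsto ω (𝓝[>] 0) (𝓝 0))
    {x : Rn n} {y₀ : Fin m → Rn n} (hy : ∃ i, y₀ i ≠ x) : ContinuousAt (K x) y₀ := by
  classical
  obtain ⟨C, hC, hreg⟩ := hK
  obtain ⟨j, hj⟩ := hy
  have hpw : ∀ s : Finset (Fin m), Tendsto (fun y : Fin m → Rn n => s.piecewise y y₀) (𝓝 y₀)
      (𝓝 y₀) := by
    intro s
    rw [tendsto_pi_nhds]
    intro i
    by_cases hi : i ∈ s
    · simp only [hi, Finset.piecewise_eq_of_mem]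
      exact (continuous_apply i).tendsto y₀
    · simp only [hi, not_false_eq_true, Finset.piecewise_eq_of_notMem]
      exact tendsto_const_nhds
  have key : ∀ s : Finset (Fin m),
      Tendsto (fun y : Fin m → Rn n => K x (s.piecewise y y₀)) (𝓝 y₀) (𝓝 (K x y₀)) := by
    intro s
    induction s using Finset.induction_on with
    | empty => simp
    | insert a s ha ih =>
      let z : (Fin m → Rn n) → Fin m → Rn n := fun y => s.piecewise y y₀
      let h : (Fin m → Rn n) → Rn n := fun y => y a - y₀ a
      let D : (Fin m → Rn n) → ℝ := fun y => ∑ i, ‖x - z y i‖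
      have hz : ∀ y, (insert a s).piecewise y y₀ = Function.update (z y) a (z y a + h y) := by
        intro y
        rw [Finset.piecewise_insert]
        congr 1
        simp [z, h, ha]
      have hh : Tendsto h (𝓝 y₀) (𝓝 0) := by
        have := ((continuous_apply a).tendsto y₀).sub_const (y₀ a)
        simpa [h] using this
      have hz0 : Tendsto z (𝓝 y₀) (𝓝 y₀) := hpw s
      have hD : Tendsto D (𝓝 y₀) (𝓝 (∑ i, ‖x - y₀ i‖)) := by
        refine tendsto_finsetSum _ fun i _ => ?_
        exact (((continuous_apply i).tendsto y₀).comp hz0).const_sub x |>.norm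
      have hDpos : 0 < ∑ i, ‖x - y₀ i‖ :=
        lt_of_lt_of_le (norm_pos_iff.2 (sub_ne_zero.2 (Ne.symm hj)))
          (Finset.single_le_sum (f := fun i => ‖x - y₀ i‖) (fun i _ => norm_nonneg _)
            (Finset.mem_univ j))
      have hq : Tendsto (fun y => ‖h y‖ / D y) (𝓝 y₀) (𝓝 0) := by
        have := hh.norm.div hD hDpos.ne'
        rwa [norm_zero, zero_div] at this
      have hω' : Tendsto (fun y => ω (‖h y‖ / D y)) (𝓝 y₀) (𝓝 0) := by
        refine (hω.tendsto_nhdsGE h0).comp (tendsto_nhdsWithin_iff.2 ⟨hq, ?_⟩)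
        refine Eventually.of_forall fun y => ?_
        exact div_nonneg (norm_nonneg _) (Finset.sum_nonneg fun i _ => norm_nonneg _)
      have hbound : Tendsto (fun y => C / D y ^ (m * n) * ω (‖h y‖ / D y)) (𝓝 y₀) (𝓝 0) := by
        have := (tendsto_const_nhds (x := C)).div (hD.pow (m * n)) (pow_pos hDpos _).ne' |>.mul hω'
        rwa [mul_zero] at this
      have hzj : Tendsto (fun y => ‖x - z y j‖ / 2 - ‖h y‖) (𝓝 y₀) (𝓝 (‖x - y₀ j‖ / 2 - 0)) := by
        have h1 := (((continuous_apply j).tendsto y₀).comp hz0).const_sub x |>.norm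
        have h2 := (h1.div_const 2).sub hh.norm
        rwa [norm_zero] at h2
      have hjpos : 0 < ‖x - y₀ j‖ := norm_pos_iff.2 (sub_ne_zero.2 (Ne.symm hj))
      have hev := hzj.eventually (lt_mem_nhds (show 0 < ‖x - y₀ j‖ / 2 - 0 by linarith))
      have hdiff : Tendsto (fun y => K x ((insert a s).piecewise y y₀) - K x (z y)) (𝓝 y₀)
          (𝓝 0) := by
        refine squeeze_zero_norm' ?_ hbound
        filter_upwards [hev] with y hy
        have hzne : z y j ≠ x := by
          intro he
          rw [he, sub_self, norm_zero] at hy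
          linarith [norm_nonneg (h y)]
        have := hreg x (z y) (h y) ⟨j, hzne⟩ ⟨j, by linarith⟩
        rw [hz]
        refine le_trans ?_ this
        refine le_trans ?_ (le_add_of_nonneg_left (norm_nonneg _))
        exact Finset.single_le_sum
          (f := fun i => ‖K x (Function.update (z y) i (z y i + h y)) - K x (z y)‖)
          (fun i _ => norm_nonneg _) (Finset.mem_univ a)
      have := hdiff.add ih
      simpa [z] using this
  have := key Finset.univ
  simp only [Finset.piecewise_univ] at this
  exact this

theorem isOpen_offDiagonal {n m : ℕ} (x : Rn n) : IsOpen {y : Fin m → Rn n | ∃ i, y i ≠ x} := by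
  have : {y : Fin m → Rn n | ∃ i, y i ≠ x} = ⋃ i, {y | y i ≠ x} := by ext; simp
  rw [this]
  exact isOpen_iUnion fun i => isOpen_ne.preimage (continuous_apply i)

/-- Kernels are not assumed measurable; measurability comes from continuity off the diagonal. On the
support of `F` the size condition bounds the kernel. -/
theorem integrable_kernel_mul {n m : ℕ} {K : Rn n → (Fin m → Rn n) → ℂ} {ω : ℝ → ℝ}
    (hS : SizeCondition K) (hK : RegularityCondition K ω) (hω : IsModulus ω)
    (h0 : Tendsto ω (𝓝[>] 0) (𝓝 0)) {x : Rn n} {F : (Fin m → Rn n) → ℂ} (hF : Integrable F)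
    {δ : ℝ} (hδ : 0 < δ) (hsupp : ∀ y, F y ≠ 0 → ∃ i, δ ≤ ‖x - y i‖) :
    Integrable fun y => K x y * F y := by
  obtain ⟨C, hC, hsize⟩ := hS
  have hne : ∀ y : Fin m → Rn n, (∃ i, δ ≤ ‖x - y i‖) → ∃ i, y i ≠ x := by
    rintro y ⟨i, hi⟩
    refine ⟨i, fun h => ?_⟩
    rw [h, sub_self, norm_zero] at hi
    linarith
  refine (hF.norm.const_mul (C / δ ^ (m * n))).mono' ?_ (Eventually.of_forall fun y => ?_)
  · have hU := isOpen_offDiagonal (m := m) x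
    have h1 : AEStronglyMeasurable (K x) (volume.restrict {y : Fin m → Rn n | ∃ i, y i ≠ x}) :=
      ContinuousOn.aestronglyMeasurable
        (fun y hy => (hK.continuousAt hω h0 hy).continuousWithinAt) hU.measurableSet
    have h2 := (h1.mul hF.1.restrict)
    rw [← aestronglyMeasurable_indicator_iff hU.measurableSet] at h2
    refine h2.congr (Eventually.of_forall fun y => ?_)
    by_cases hy : ∃ i, y i ≠ x
    · exact Set.indicator_of_mem (s := {y : Fin m → Rn n | ∃ i, y i ≠ x}) hy _
    · rw [Set.indicator_of_notMem (s := {y : Fin m → Rn n | ∃ i, y i ≠ x}) hy]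
      have : F y = 0 := by
        by_contra hFy
        exact hy (hne y (hsupp y hFy))
      simp [this]
  · rw [norm_mul]
    by_cases hFy : F y = 0
    · simp [hFy]
    obtain ⟨i, hi⟩ := hsupp y hFy
    gcongr
    refine (hsize x y (hne y ⟨i, hi⟩)).trans ?_
    gcongr
    exact hi.trans (Finset.single_le_sum (f := fun i => ‖x - y i‖) (fun i _ => norm_nonneg _)
            (Finset.mem_univ i))

/-! ### Dini moduli and decay of the operator on mean-zero functions -/

/-- On `(2 ^ (-k-1), 2 ^ (-k))` monotonicity bounds `ω t / t` below by `2 ^ k ω(2 ^ (-k-1))`, so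
that interval contributes at least half of the `k`-th term to the Dini integral. -/
theorem DiniCondition.tsum_ne_top {ω : ℝ → ℝ} (hω : IsModulus ω) (hD : DiniCondition ω) :
    ∑' k : ℕ, ENNReal.ofReal (ω ((1 / 2) ^ (k + 1))) ≠ ∞ := by
  let I : ℕ → Set ℝ := fun k => Set.Ioo ((1 / 2 : ℝ) ^ (k + 1)) ((1 / 2) ^ k)
  have hIsub : ∀ k, I k ⊆ Set.Ioo 0 1 := fun k t ht =>
    ⟨lt_trans (by positivity) ht.1, ht.2.trans_le (pow_le_one₀ (by norm_num) (by norm_num))⟩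
  have hdis : Pairwise (Function.onFun Disjoint I) := by
    have hlt : ∀ i j, i < j → Disjoint (I i) (I j) := by
      intro i j hij
      refine Set.disjoint_left.2 fun t ht ht' => ?_
      have : (1 / 2 : ℝ) ^ j ≤ (1 / 2) ^ (i + 1) :=
        pow_le_pow_of_le_one (by norm_num) (by norm_num) hij
      linarith [ht.1, ht'.2]
    intro i j hij
    rcases lt_or_gt_of_ne hij with h | h
    · exact hlt i j h
    · exact (hlt j i h).symm
  have hle : ∀ k, ENNReal.ofReal (ω ((1 / 2) ^ (k + 1))) ≤
      2 * ∫⁻ t in I k, ENNReal.ofReal (ω t / t) := by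
    intro k
    have h2 : (0 : ℝ) < (1 / 2) ^ k := by positivity
    have hmem : (1 / 2 : ℝ) ^ (k + 1) ∈ Set.Ico (0 : ℝ) 1 :=
      ⟨by positivity, pow_lt_one₀ (by norm_num) (by norm_num) (by omega)⟩
    have hω0 := hω.nonneg _ hmem
    have h1 : ENNReal.ofReal (ω ((1 / 2) ^ (k + 1)) / (1 / 2) ^ k) * volume (I k) ≤
        ∫⁻ t in I k, ENNReal.ofReal (ω t / t) := by
      rw [← setLIntegral_const]
      refine setLIntegral_mono' measurableSet_Ioo fun t ht => ENNReal.ofReal_le_ofReal ?_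
      have ht0 := (hIsub k ht).1
      have hmon := hω.mono hmem ⟨ht0.le, (hIsub k ht).2⟩ ht.1.le
      exact div_le_div₀ (hω0.trans hmon) hmon ht0 ht.2.le
    have h3 : ENNReal.ofReal (ω ((1 / 2) ^ (k + 1)) / (1 / 2) ^ k) * volume (I k) =
        ENNReal.ofReal (ω ((1 / 2) ^ (k + 1)) / 2) := by
      rw [Real.volume_Ioo, ← ENNReal.ofReal_mul (by positivity)]
      congr 1
      rw [pow_succ]
      field_simp
      ring
    rw [h3] at h1
    calc ENNReal.ofReal (ω ((1 / 2) ^ (k + 1)))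
        = 2 * ENNReal.ofReal (ω ((1 / 2) ^ (k + 1)) / 2) := by
          rw [← ENNReal.ofReal_ofNat 2, ← ENNReal.ofReal_mul (by norm_num)]
          congr 1; ring
      _ ≤ _ := by gcongr
  refine ne_top_of_le_ne_top ?_ (ENNReal.tsum_le_tsum hle)
  rw [ENNReal.tsum_mul_left, ← lintegral_iUnion (fun k => measurableSet_Ioo) hdis]
  refine ENNReal.mul_ne_top (by norm_num) (ne_top_of_le_ne_top hD.ne ?_)
  exact lintegral_mono_set (Set.iUnion_subset hIsub)

theorem DiniCondition.tendsto {ω : ℝ → ℝ} (hω : IsModulus ω) (hD : DiniCondition ω) :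
    Tendsto ω (𝓝[>] 0) (𝓝 0) := by
  have h1 := ENNReal.tendsto_atTop_zero_of_tsum_ne_top (hD.tsum_ne_top hω)
  rw [Metric.tendsto_nhdsWithin_nhds]
  intro ε hε
  obtain ⟨k, hk⟩ := (h1.eventually (gt_mem_nhds (ENNReal.ofReal_pos.2 hε))).exists
  refine ⟨(1 / 2) ^ (k + 1), by positivity, fun {t} ht hdist => ?_⟩
  have ht : 0 < t := ht
  rw [Real.dist_eq, sub_zero, abs_of_pos ht] at hdist
  have hmem : (1 / 2 : ℝ) ^ (k + 1) ∈ Set.Ico (0 : ℝ) 1 :=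
    ⟨by positivity, pow_lt_one₀ (by norm_num) (by norm_num) (by omega)⟩
  have hmem' : t ∈ Set.Ico (0 : ℝ) 1 := ⟨ht.le, hdist.trans hmem.2⟩
  rw [Real.dist_eq, sub_zero, abs_of_nonneg (hω.nonneg t hmem')]
  exact (hω.mono hmem' hmem hdist.le).trans_lt ((ENNReal.ofReal_lt_ofReal_iff hε).1 hk)

/-- On the annulus `‖x - c‖ ≈ 2 ^ (k+1) ρ` the integrand is at most `ω(2 ^ (-k-1))` divided by a
multiple of the volume of the annulus, so the integral is dominated by the dyadic Dini sum. -/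
theorem lintegral_modulus_tail_le {n : ℕ} {ω : ℝ → ℝ} (hω : IsModulus ω)
    (hD : DiniCondition ω) : ∃ C : ℝ≥0∞, C ≠ ∞ ∧ ∀ (c : Rn n) (ρ : ℝ), 0 < ρ →
      ∫⁻ x in {x | 2 * ρ ≤ ‖x - c‖}, ENNReal.ofReal (ω (ρ / ‖x - c‖) / ‖x - c‖ ^ n) ≤ C := by
  refine ⟨ENNReal.ofReal (4 ^ n) * volume (Metric.ball (0 : Rn n) 1) *
    ∑' k : ℕ, ENNReal.ofReal (ω ((1 / 2) ^ (k + 1))), ENNReal.mul_ne_top (ENNReal.mul_ne_top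
      ENNReal.ofReal_ne_top measure_ball_lt_top.ne) (hD.tsum_ne_top hω), fun c ρ hρ => ?_⟩
  let A : ℕ → Set (Rn n) := fun k =>
    {x | 2 ^ (k + 1) * ρ ≤ ‖x - c‖ ∧ ‖x - c‖ ≤ 2 ^ (k + 2) * ρ}
  have hAm : ∀ k, MeasurableSet (A k) := fun k =>
    (measurableSet_le (f := fun _ : Rn n => 2 ^ (k + 1) * ρ) (g := fun x => ‖x - c‖)
      measurable_const (by fun_prop)).inter
      (measurableSet_le (f := fun x : Rn n => ‖x - c‖) (by fun_prop) measurable_const)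
  have hcov : {x | 2 * ρ ≤ ‖x - c‖} ⊆ ⋃ k, A k := by
    intro x hx
    have hx : 2 * ρ ≤ ‖x - c‖ := hx
    have h1 : 1 ≤ ‖x - c‖ / (2 * ρ) := (one_le_div₀ (by positivity)).2 hx
    obtain ⟨k, hk1, hk2⟩ := exists_nat_pow_near h1 (by norm_num : (1 : ℝ) < 2)
    rw [le_div_iff₀ (by positivity)] at hk1
    rw [div_lt_iff₀ (by positivity)] at hk2
    refine Set.mem_iUnion.2 ⟨k, ?_, ?_⟩
    · calc _ = 2 ^ k * (2 * ρ) := by ring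
        _ ≤ _ := hk1
    · calc _ ≤ _ := hk2.le
        _ = _ := by ring
  refine (lintegral_mono_set hcov).trans ((lintegral_iUnion_le _ _).trans ?_)
  rw [← ENNReal.tsum_mul_left]
  refine ENNReal.tsum_le_tsum fun k => ?_
  have hmem : (1 / 2 : ℝ) ^ (k + 1) ∈ Set.Ico (0 : ℝ) 1 :=
    ⟨by positivity, pow_lt_one₀ (by norm_num) (by norm_num) (by omega)⟩
  have hω0 := hω.nonneg _ hmem
  have hpt : ∀ x ∈ A k, ENNReal.ofReal (ω (ρ / ‖x - c‖) / ‖x - c‖ ^ n) ≤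
      ENNReal.ofReal (ω ((1 / 2) ^ (k + 1)) / (2 ^ (k + 1) * ρ) ^ n) := by
    rintro x ⟨hx1, hx2⟩
    have hx0 : 0 < ‖x - c‖ := lt_of_lt_of_le (by positivity) hx1
    have hle : ρ / ‖x - c‖ ≤ (1 / 2) ^ (k + 1) := by
      rw [div_le_iff₀ hx0, one_div, inv_pow, ← div_eq_inv_mul, le_div_iff₀ (by positivity)]
      linarith
    have hmon := hω.mono ⟨by positivity, hle.trans_lt hmem.2⟩ hmem hle
    refine ENNReal.ofReal_le_ofReal ?_
    exact div_le_div₀ hω0 hmon (by positivity) (pow_le_pow_left₀ (by positivity) hx1 n)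
  calc ∫⁻ x in A k, ENNReal.ofReal (ω (ρ / ‖x - c‖) / ‖x - c‖ ^ n)
      ≤ ∫⁻ _ in A k, ENNReal.ofReal (ω ((1 / 2) ^ (k + 1)) / (2 ^ (k + 1) * ρ) ^ n) :=
        setLIntegral_mono' (hAm k) hpt
    _ = ENNReal.ofReal (ω ((1 / 2) ^ (k + 1)) / (2 ^ (k + 1) * ρ) ^ n) * volume (A k) :=
        setLIntegral_const _ _
    _ ≤ ENNReal.ofReal (ω ((1 / 2) ^ (k + 1)) / (2 ^ (k + 1) * ρ) ^ n) *
        volume (Metric.closedBall c (2 ^ (k + 2) * ρ)) := by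
        gcongr
        intro x hx
        rw [Metric.mem_closedBall, dist_eq_norm]; exact hx.2
    _ ≤ _ := by
        rw [Measure.addHaar_closedBall _ _ (by positivity), finrank_euclideanSpace,
          Fintype.card_fin, ← mul_assoc, ← ENNReal.ofReal_mul (by positivity)]
        have e : ω ((1 / 2) ^ (k + 1)) / (2 ^ (k + 1) * ρ) ^ n * (2 ^ (k + 2) * ρ) ^ n =
            2 ^ n * ω ((1 / 2) ^ (k + 1)) := by
          have : (2 : ℝ) ^ (k + 2) * ρ = 2 * (2 ^ (k + 1) * ρ) := by ring
          rw [this, mul_pow 2]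
          field_simp
        rw [e, ENNReal.ofReal_mul (by positivity), mul_right_comm]
        gcongr
        norm_num

theorem integral_add_norm_rpow {E : Type*} [NormedAddCommGroup E] [NormedSpace ℝ E]
    [FiniteDimensional ℝ E] [MeasurableSpace E] [BorelSpace E] (μ : Measure E)
    [μ.IsAddHaarMeasure] {a : ℝ} (ha : 0 < a) (s : ℝ) (x : E) :
    ∫ z, (a + ‖z - x‖) ^ (-s) ∂μ =
      a ^ (-s) * a ^ (Module.finrank ℝ E) * ∫ z, (1 + ‖z‖) ^ (-s) ∂μ := by
  rw [integral_sub_right_eq_self (fun z => (a + ‖z‖) ^ (-s)) x]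
  have h1 : ∀ z : E, (a + ‖z‖) ^ (-s) = a ^ (-s) * (1 + ‖a⁻¹ • z‖) ^ (-s) := by
    intro z
    rw [← Real.mul_rpow ha.le (by positivity), norm_smul, norm_inv, Real.norm_of_nonneg ha.le]
    congr 1
    field_simp
  simp_rw [h1]
  rw [integral_const_mul, Measure.integral_comp_smul μ (fun z => (1 + ‖z‖) ^ (-s)), mul_assoc]
  rw [inv_pow, inv_inv, abs_of_pos (pow_pos ha _), smul_eq_mul]

theorem integrable_add_norm_rpow {E : Type*} [NormedAddCommGroup E] [NormedSpace ℝ E]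
    [FiniteDimensional ℝ E] [MeasurableSpace E] [BorelSpace E] (μ : Measure E)
    [μ.IsAddHaarMeasure] {a : ℝ} (ha : 0 < a) {s : ℝ} (hs : (Module.finrank ℝ E : ℝ) < s) (x : E) :
    Integrable (fun z => (a + ‖z - x‖) ^ (-s)) μ := by
  have h0 := integrable_one_add_norm (μ := μ) hs
  have h1 : ∀ z : E, (a + ‖z‖) ^ (-s) = a ^ (-s) * (1 + ‖a⁻¹ • z‖) ^ (-s) := by
    intro z
    rw [← Real.mul_rpow ha.le (by positivity), norm_smul, norm_inv, Real.norm_of_nonneg ha.le]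
    congr 1
    field_simp
  have h2 : Integrable (fun z => (a + ‖z‖) ^ (-s)) μ := by
    simp_rw [h1]
    exact ((integrable_comp_smul_iff μ (fun z => (1 + ‖z‖) ^ (-s)) (inv_ne_zero ha.ne')).2
      h0).const_mul _
  exact h2.comp_sub_right x

theorem mul_mul_le_of_le_mul {A F P C w N u : ℝ} (h1 : A ≤ C * u * w) (h2 : P ≤ N) (hF : 0 ≤ F)
    (hA : 0 ≤ A) (hP : 0 ≤ P) : A * (F * P) ≤ F * (C * w * N * u) := by
  calc A * (F * P) ≤ (C * u * w) * (F * N) :=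
        mul_le_mul h1 (mul_le_mul_of_nonneg_left h2 hF) (by positivity) (hA.trans h1)
    _ = _ := by ring

/-- As `f i` has mean zero, the kernel with its `i`-th variable frozen at `c` may be subtracted.
Regularity bounds the difference by `ω(ρ / a)` times a kernel of order `(k + 1) n`, with `a = ‖x -
c‖`; integrating out the other `k` variables leaves `a ^ (-n)`. -/
theorem norm_integral_kernel_le {n k : ℕ} (hn : 0 < n) {K : Rn n → (Fin (k + 1) → Rn n) → ℂ}
    {ω : ℝ → ℝ} (hS : SizeCondition K) (hK : RegularityCondition K ω) (hω : IsModulus ω)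
    (h0 : Tendsto ω (𝓝[>] 0) (𝓝 0)) :
    ∃ C : ℝ, 0 ≤ C ∧ ∀ (i : Fin (k + 1)) (f : Fin (k + 1) → TestFn n) (M : ℝ), 0 ≤ M →
      (∀ j, j ≠ i → ∀ x, ‖f j x‖ ≤ M) → ∀ (c : Rn n) (ρ : ℝ), 0 < ρ →
      tsupport (f i) ⊆ Metric.closedBall c ρ → ∫ x, f i x = 0 → ∀ x, 2 * ρ ≤ ‖x - c‖ →
      ‖∫ y, K x y * ∏ j, f j (y j)‖ ≤
        C * M ^ k * (∫ x, ‖f i x‖) * (ω (ρ / ‖x - c‖) / ‖x - c‖ ^ n) := by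
  obtain ⟨C, hC, hreg⟩ := id hK
  set s : ℝ := (((k + 1) * n : ℕ) : ℝ) with hs
  have hfr : (Module.finrank ℝ (Fin k → Rn n) : ℝ) < s := by
    rw [Module.finrank_pi_fintype]
    simp only [finrank_euclideanSpace, Fintype.card_fin, Finset.sum_const, Finset.card_univ,
      smul_eq_mul, hs]
    exact_mod_cast (Nat.mul_lt_mul_right hn).2 (Nat.lt_succ_self k)
  set I : ℝ := ∫ z : Fin k → Rn n, (1 + ‖z‖) ^ (-s) with hI
  have hI0 : 0 ≤ I := integral_nonneg fun z => by positivity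
  refine ⟨C * I, by positivity, ?_⟩
  intro i f M hM hfM c ρ hρ hsupp hint x hx
  set a : ℝ := ‖x - c‖ with ha
  have ha0 : 0 < a := by linarith
  have hxc : c ≠ x := by
    rintro rfl; simp at ha; linarith
  let e := MeasurableEquiv.piFinSuccAbove (fun _ : Fin (k + 1) => Rn n) i
  have he : MeasurePreserving e := volume_preserving_piFinSuccAbove (fun _ : Fin (k + 1) => Rn n) i
  let P : (Fin k → Rn n) → ℂ := fun z => ∏ j, f (i.succAbove j) (z j)
  have hPI : Integrable P := Integrable.fintype_prod fun j => TestFn.integrable _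
  have hPM : ∀ z, ‖P z‖ ≤ M ^ k := by
    intro z
    rw [norm_prod]
    calc _ ≤ ∏ _j : Fin k, M := Finset.prod_le_prod (fun j _ => norm_nonneg _)
          fun j _ => hfM _ (Fin.succAbove_ne i j) _
      _ = M ^ k := by simp
  have hprod : ∀ y : Fin (k + 1) → Rn n, ∏ j, f j (y j) = f i (e y).1 * P (e y).2 := fun y =>
    Fin.prod_univ_succAbove _ i
  have hF : Integrable fun y : Fin (k + 1) → Rn n => ∏ j, f j (y j) :=
    Integrable.fintype_prod fun j => TestFn.integrable _
  have hfi : ∀ u, f i u ≠ 0 → ‖u - c‖ ≤ ρ := fun u hu => by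
    have := hsupp (subset_tsupport _ hu)
    rwa [Metric.mem_closedBall, dist_eq_norm] at this
  have hint1 : Integrable fun y => K x y * ∏ j, f j (y j) := by
    refine integrable_kernel_mul hS hK hω h0 hF hρ fun y hy => ⟨i, ?_⟩
    have hyi : f i (y i) ≠ 0 := (Finset.prod_ne_zero_iff.1 hy) i (Finset.mem_univ i)
    have h1 := hfi _ hyi
    have h2 : ‖x - c‖ ≤ ‖x - y i‖ + ‖y i - c‖ := norm_sub_le_norm_sub_add_norm_sub _ _ _
    linarith
  let K₀ : (Fin k → Rn n) → ℂ := fun z => K x (i.insertNth c z)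
  have hK₀I : Integrable fun z => K₀ z * P z := by
    obtain ⟨C', hC', hsize⟩ := hS
    have hne : ∀ z : Fin k → Rn n, ∃ j, (i.insertNth c z : Fin (k + 1) → Rn n) j ≠ x :=
      fun z => ⟨i, by simpa using hxc⟩
    refine hPI.bdd_mul (c := C' / a ^ ((k + 1) * n)) ?_ (Eventually.of_forall fun z => ?_)
    · refine Continuous.aestronglyMeasurable ?_
      rw [continuous_iff_continuousAt]
      intro z
      exact (hK.continuousAt hω h0 (hne z)).comp
        (f := fun z : Fin k → Rn n => (i.insertNth c z : Fin (k + 1) → Rn n))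
        (continuous_const.finInsertNth i continuous_id).continuousAt
    · refine (hsize _ _ (hne z)).trans ?_
      gcongr
      refine le_trans (le_of_eq ?_) (Finset.single_le_sum
        (f := fun j => ‖x - (i.insertNth c z : Fin (k + 1) → Rn n) j‖) (fun j _ => norm_nonneg _)
        (Finset.mem_univ i))
      simp [ha]
  -- The subtracted term: a product of a function of the `i`-th variable with integral zero and a
  -- function of the others.
  let G : Rn n × (Fin k → Rn n) → ℂ := fun p => f i p.1 * (K₀ p.2 * P p.2)
  have hG : Integrable G := (TestFn.integrable (f i)).mul_prod hK₀I
  have hG0 : ∫ p, G p = 0 := by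
    change ∫ p, G p ∂(volume.prod volume) = 0
    rw [integral_prod_mul (fun u => f i u) (fun z => K₀ z * P z), hint, zero_mul]
  have hGe : Integrable fun y => G (e y) := he.integrable_comp_emb e.measurableEmbedding |>.2 hG
  have hGe0 : ∫ y, G (e y) = 0 := by
    rw [he.integral_comp e.measurableEmbedding, hG0]
  have heq : ∫ y, K x y * ∏ j, f j (y j) = ∫ y, (K x y * ∏ j, f j (y j) - G (e y)) := by
    rw [integral_sub hint1 hGe, hGe0, sub_zero]
  let B : Rn n × (Fin k → Rn n) → ℝ := fun p =>
    ‖f i p.1‖ * (C * ω (ρ / a) * M ^ k * (a + ‖p.2 - fun _ => x‖) ^ (-s))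
  have hBI : Integrable B := (TestFn.integrable (f i)).norm.mul_prod
    ((integrable_add_norm_rpow volume ha0 hfr _).const_mul _)
  have hρa : ρ / a ≤ 1 / 2 := by rw [div_le_div_iff₀ ha0 two_pos]; linarith
  have hρamem : ρ / a ∈ Set.Ico (0 : ℝ) 1 := ⟨by positivity, by linarith⟩
  have hω0 := hω.nonneg _ hρamem
  have hbound : ∀ y, ‖K x y * ∏ j, f j (y j) - G (e y)‖ ≤ B (e y) := by
    intro y
    by_cases hfy : f i (y i) = 0
    · have h1 : ∏ j, f j (y j) = 0 := Finset.prod_eq_zero (Finset.mem_univ i) hfy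
      have h2 : G (e y) = 0 := by
        change f i (y i) * _ = 0
        rw [hfy, zero_mul]
      have h3 : B (e y) = 0 := by
        change ‖f i (y i)‖ * _ = 0
        rw [hfy, norm_zero, zero_mul]
      rw [h1, h2, h3]; simp
    · have hyc := hfi _ hfy
      set z : Fin k → Rn n := (e y).2 with hz
      let y₀ : Fin (k + 1) → Rn n := i.insertNth c z
      have hy₀i : y₀ i = c := by simp [y₀]
      have hy : Function.update y₀ i (y₀ i + (y i - c)) = y := by
        rw [hy₀i, add_sub_cancel]
        have : y = i.insertNth (y i) z := (Fin.insertNth_self_removeNth i y).symm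
        rw [Fin.update_insertNth]
        exact this.symm
      have hreg' := hreg x y₀ (y i - c) ⟨i, by rw [hy₀i]; exact hxc⟩
        ⟨i, by rw [hy₀i]; change _ ≤ a / 2; linarith⟩
      have hdiff : ‖K x y - K x y₀‖ ≤ C / (∑ j, ‖x - y₀ j‖) ^ ((k + 1) * n) *
          ω (‖y i - c‖ / ∑ j, ‖x - y₀ j‖) := by
        refine le_trans (le_trans ?_ (le_add_of_nonneg_left (norm_nonneg _))) hreg'
        have := Finset.single_le_sum
          (f := fun j => ‖K x (Function.update y₀ j (y₀ j + (y i - c))) - K x y₀‖)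
          (fun j _ => norm_nonneg _) (Finset.mem_univ i)
        simp only [hy] at this
        exact this
      have hsumge : a + ‖z - fun _ => x‖ ≤ ∑ j, ‖x - y₀ j‖ := by
        rw [Fin.sum_univ_succAbove _ i, hy₀i]
        gcongr
        refine (pi_norm_le_iff_of_nonneg (Finset.sum_nonneg fun j _ => norm_nonneg _)).2 fun j => ?_
        have := Finset.single_le_sum (f := fun j => ‖x - y₀ (i.succAbove j)‖)
          (fun j _ => norm_nonneg _) (Finset.mem_univ j)
        refine le_trans (le_of_eq ?_) this
        simp [y₀, norm_sub_rev]
      have hsumpos : 0 < a + ‖z - fun _ => x‖ := by positivity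
      have hle1 : ‖y i - c‖ / ∑ j, ‖x - y₀ j‖ ≤ ρ / a :=
        div_le_div₀ hρ.le hyc ha0 (le_trans (le_add_of_nonneg_right (norm_nonneg _)) hsumge)
      have hmem : ‖y i - c‖ / ∑ j, ‖x - y₀ j‖ ∈ Set.Ico (0 : ℝ) 1 := Set.mem_Ico.2
        ⟨div_nonneg (norm_nonneg _) (Finset.sum_nonneg fun j _ => norm_nonneg _),
          hle1.trans_lt hρamem.2⟩
      have hmon := hω.mono hmem hρamem hle1
      have hpow : C / (∑ j, ‖x - y₀ j‖) ^ ((k + 1) * n) ≤ C * (a + ‖z - fun _ => x‖) ^ (-s) := by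
        rw [Real.rpow_neg hsumpos.le, hs, Real.rpow_natCast, ← div_eq_mul_inv]
        gcongr
      have hdiff' : ‖K x y - K x y₀‖ ≤ C * (a + ‖z - fun _ => x‖) ^ (-s) * ω (ρ / a) :=
        hdiff.trans (mul_le_mul hpow hmon (hω.nonneg _ hmem)
          (mul_nonneg hC.le (Real.rpow_nonneg hsumpos.le _)))
      have heq2 : K x y * ∏ j, f j (y j) - G (e y) = (K x y - K x y₀) * (f i (y i) * P z) := by
        rw [hprod]
        change K x y * (f i (y i) * P z) - f i (y i) * (K x y₀ * P z) = _
        ring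
      rw [heq2, norm_mul, norm_mul]
      change _ ≤ ‖f i (y i)‖ * (C * ω (ρ / a) * M ^ k * (a + ‖z - fun _ => x‖) ^ (-s))
      exact mul_mul_le_of_le_mul hdiff' (hPM z) (norm_nonneg _) (norm_nonneg _) (norm_nonneg _)
  rw [heq]
  have hBe : Integrable fun y => B (e y) := he.integrable_comp_emb e.measurableEmbedding |>.2 hBI
  refine (norm_integral_le_of_norm_le hBe (Eventually.of_forall hbound)).trans (le_of_eq ?_)
  rw [he.integral_comp e.measurableEmbedding]
  change ∫ p, B p ∂(volume.prod volume) = _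
  rw [integral_prod_mul (fun u => ‖f i u‖)
    (fun z : Fin k → Rn n => C * ω (ρ / a) * M ^ k * (a + ‖z - fun _ => x‖) ^ (-s)),
    integral_const_mul, integral_add_norm_rpow volume ha0]
  have hpow : a ^ (-s) * a ^ (Module.finrank ℝ (Fin k → Rn n)) = (a ^ n)⁻¹ := by
    rw [Module.finrank_pi_fintype]
    simp only [finrank_euclideanSpace, Fintype.card_fin, Finset.sum_const, Finset.card_univ,
      smul_eq_mul]
    rw [Real.rpow_neg ha0.le, hs, Real.rpow_natCast, add_mul, one_mul, pow_add]
    field_simp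
  rw [hpow]
  field_simp
  rfl

theorem lintegral_operator_far_le {n k : ℕ} (hn : 0 < n) {T : InitialOperator n (k + 1)}
    {K : Rn n → (Fin (k + 1) → Rn n) → ℂ} {ω : ℝ → ℝ} (hω : IsModulus ω) (hD : DiniCondition ω)
    (hS : SizeCondition K) (hK : RegularityCondition K ω) (hT : KernelRepresentation T K) :
    ∃ C : ℝ≥0∞, C ≠ ∞ ∧ ∀ (i : Fin (k + 1)) (f : Fin (k + 1) → TestFn n) (M : ℝ), 0 ≤ M →
      (∀ j, j ≠ i → ∀ x, ‖f j x‖ ≤ M) → ∀ (c : Rn n) (ρ : ℝ), 0 < ρ →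
      tsupport (f i) ⊆ Metric.closedBall c ρ → ∫ x, f i x = 0 →
      ∫⁻ x in {x | 2 * ρ ≤ ‖x - c‖}, ‖T f x‖ₑ ≤ C * ENNReal.ofReal (M ^ k * ∫ x, ‖f i x‖) := by
  obtain ⟨C, hC, hb⟩ := norm_integral_kernel_le hn hS hK hω (hD.tendsto hω)
  obtain ⟨D, hD', hd⟩ := lintegral_modulus_tail_le (n := n) hω hD
  refine ⟨D * ENNReal.ofReal C, ENNReal.mul_ne_top hD' ENNReal.ofReal_ne_top, ?_⟩
  intro i f M hM hfM c ρ hρ hsupp hint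
  have hms : MeasurableSet {x : Rn n | 2 * ρ ≤ ‖x - c‖} :=
    measurableSet_le measurable_const (by fun_prop)
  have hI : 0 ≤ ∫ x, ‖f i x‖ := integral_nonneg fun _ => norm_nonneg _
  calc ∫⁻ x in {x | 2 * ρ ≤ ‖x - c‖}, ‖T f x‖ₑ
      ≤ ∫⁻ x in {x | 2 * ρ ≤ ‖x - c‖}, ENNReal.ofReal (C * M ^ k * ∫ x, ‖f i x‖) *
          ENNReal.ofReal (ω (ρ / ‖x - c‖) / ‖x - c‖ ^ n) := by
        refine setLIntegral_mono_ae' hms ?_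
        filter_upwards [hT f] with x hx hxc
        have hx' : x ∉ ⋂ i, tsupport (f i) := by
          intro hmem
          have := hsupp (Set.mem_iInter.1 hmem i)
          rw [Metric.mem_closedBall, dist_eq_norm] at this
          have h2 : 2 * ρ ≤ ‖x - c‖ := hxc
          linarith
        rw [hx hx', ← ofReal_norm, ← ENNReal.ofReal_mul (by positivity)]
        exact ENNReal.ofReal_le_ofReal (hb i f M hM hfM c ρ hρ hsupp hint x hxc)
    _ = ENNReal.ofReal (C * M ^ k * ∫ x, ‖f i x‖) * ∫⁻ x in {x | 2 * ρ ≤ ‖x - c‖},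
          ENNReal.ofReal (ω (ρ / ‖x - c‖) / ‖x - c‖ ^ n) :=
        lintegral_const_mul' _ _ ENNReal.ofReal_ne_top
    _ ≤ ENNReal.ofReal (C * M ^ k * ∫ x, ‖f i x‖) * D := mul_le_mul_right (hd c ρ hρ) _
    _ = D * ENNReal.ofReal C * ENNReal.ofReal (M ^ k * ∫ x, ‖f i x‖) := by
        rw [mul_assoc, ENNReal.ofReal_mul hC, mul_assoc D, mul_comm]

/-! ### Continuity in measure on bounded sets of test functions -/

theorem eLpNorm_testFn_le {n : ℕ} (f : TestFn n) {M R : ℝ} (hM : ∀ x, ‖f x‖ ≤ M)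
    (hR : tsupport f ⊆ Metric.closedBall 0 R) (s : ℝ≥0∞) :
    eLpNorm f s volume ≤
      eLpNorm ((Metric.closedBall (0 : Rn n) R).indicator fun _ => M) s volume := by
  refine eLpNorm_mono_real fun x => ?_
  by_cases hx : x ∈ Metric.closedBall (0 : Rn n) R
  · rw [Set.indicator_of_mem hx]; exact hM x
  · rw [Set.indicator_of_notMem hx, image_eq_zero_of_notMem_tsupport fun h => hx (hR h), norm_zero]

/-- Chebyshev's inequality. The bounds on size and support control the norms of the other slots,
also when some exponents are infinite. -/
theorem InitiallyBounded.measure_le {n m : ℕ} {T : InitialOperator n m} {s : Fin m → ℝ≥0∞}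
    {q : ℝ≥0∞} (hq0 : q ≠ 0) (hq1 : q ≠ ∞) {C : ℝ≥0}
    (hC : ∀ f : Fin m → TestFn n,
      eLpNorm (T f) q volume ≤ C * ∏ i, eLpNorm (f i) (s i) volume)
    (i : Fin m) (M R : ℝ) {ε : ℝ} (hε : 0 < ε) {δ : ℝ≥0∞} (hδ : 0 < δ) :
    ∃ η : ℝ≥0∞, 0 < η ∧ ∀ f : Fin m → TestFn n, (∀ j ≠ i, ∀ x, ‖f j x‖ ≤ M) →
      (∀ j ≠ i, tsupport (f j) ⊆ Metric.closedBall 0 R) → eLpNorm (f i) (s i) volume ≤ η →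
      volume {x | ε ≤ ‖T f x‖} ≤ δ := by
  set P : ℝ≥0∞ := C * ∏ j ∈ Finset.univ.erase i,
    eLpNorm ((Metric.closedBall (0 : Rn n) R).indicator fun _ => M) (s j) volume with hP
  have hPt : P ≠ ∞ := by
    refine ENNReal.mul_ne_top ENNReal.coe_ne_top (ENNReal.prod_ne_top fun j _ => ?_)
    exact (memLp_indicator_const (s j) Metric.isClosed_closedBall.measurableSet M
      (Or.inr measure_closedBall_lt_top.ne)).eLpNorm_ne_top
  have hqr : 0 < q.toReal := ENNReal.toReal_pos hq0 hq1
  have hcont : Tendsto (fun x : ℝ≥0∞ => (ENNReal.ofReal ε)⁻¹ ^ q.toReal * (P * x) ^ q.toReal)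
      (𝓝 0) (𝓝 0) := by
    have h1 : Tendsto (fun x : ℝ≥0∞ => P * x) (𝓝 0) (𝓝 (P * 0)) :=
      ENNReal.Tendsto.const_mul tendsto_id (Or.inr hPt)
    have h2 := (ENNReal.continuous_rpow_const (y := q.toReal)).tendsto (P * 0) |>.comp h1
    have h3 := ENNReal.Tendsto.const_mul (a := (ENNReal.ofReal ε)⁻¹ ^ q.toReal) h2
      (Or.inr (ENNReal.rpow_ne_top_of_nonneg hqr.le (by simpa using hε)))
    simpa [ENNReal.zero_rpow_of_pos hqr] using h3
  obtain ⟨η, hη, hηb⟩ := (ENNReal.nhds_zero_basis_Iic.mem_iff.1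
    (hcont.eventually (Iic_mem_nhds hδ)))
  refine ⟨η, hη, fun f hM hR hf => ?_⟩
  have hle : eLpNorm (T f) q volume ≤ P * η := by
    refine (hC f).trans ?_
    rw [← Finset.mul_prod_erase _ _ (Finset.mem_univ i), hP, mul_assoc, mul_comm _ η]
    gcongr with j hj
    exact eLpNorm_testFn_le _ (hM j (Finset.ne_of_mem_erase hj)) (hR j (Finset.ne_of_mem_erase hj)) _
  have hset : {x | ε ≤ ‖T f x‖} = {x | ENNReal.ofReal ε ≤ ‖T f x‖ₑ} := by
    ext x
    rw [Set.mem_ofPred_eq, Set.mem_ofPred_eq, ← ofReal_norm, ENNReal.ofReal_le_ofReal_iff (norm_nonneg _)]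
  rw [hset]
  refine (meas_ge_le_mul_pow_eLpNorm_enorm volume hq0 hq1 (T f).aestronglyMeasurable
    (by simpa using hε) (fun h => absurd h ENNReal.ofReal_ne_top)).trans ?_
  refine le_trans ?_ (hηb (Set.mem_Iic.2 le_rfl) : _ ≤ δ)
  gcongr

/-- Interpolation between `L^1` and `L^∞`; it requires `s < ∞`, which is why the slot exponent `∞`
needs a separate argument below. -/
theorem eLpNorm_le_of_bounded_of_integral_le {n : ℕ} {s : ℝ≥0∞} (hs : 1 < s) (hs' : s ≠ ∞) (M : ℝ)
    {η : ℝ≥0∞} (hη : 0 < η) : ∃ L : ℝ, 0 < L ∧ ∀ f : TestFn n, (∀ x, ‖f x‖ ≤ M) →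
      ∫ x, ‖f x‖ ≤ L → eLpNorm f s volume ≤ η := by
  have hs0 : s ≠ 0 := (zero_lt_one.trans hs).ne'
  have hsr : 1 < s.toReal := by
    rw [← ENNReal.toReal_one]; exact (ENNReal.toReal_lt_toReal ENNReal.one_ne_top hs').2 hs
  set A : ℝ≥0∞ := ENNReal.ofReal M ^ (s.toReal - 1) with hA
  have hAt : A ≠ ∞ := ENNReal.rpow_ne_top_of_nonneg (by linarith) ENNReal.ofReal_ne_top
  have hcont : Tendsto (fun L : ℝ => (A * ENNReal.ofReal L) ^ (1 / s.toReal)) (𝓝[>] 0) (𝓝 0) := by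
    have h0 : Tendsto (fun L : ℝ => ENNReal.ofReal L) (𝓝[>] 0) (𝓝 0) := by
      have := (ENNReal.continuous_ofReal.tendsto 0).mono_left (nhdsWithin_le_nhds (s := Set.Ioi 0))
      simpa using this
    have h1 := ENNReal.Tendsto.const_mul (a := A) h0 (Or.inr hAt)
    have h2 := (ENNReal.continuous_rpow_const (y := 1 / s.toReal)).tendsto (A * 0) |>.comp h1
    have : 0 < 1 / s.toReal := by positivity
    rw [mul_zero, ENNReal.zero_rpow_of_pos this] at h2
    simpa [Function.comp_def] using h2
  obtain ⟨L, hL, hL0⟩ := ((hcont.eventually (Iic_mem_nhds hη)).and self_mem_nhdsWithin).exists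
  refine ⟨L, hL0, fun f hM hf => le_trans ?_ hL⟩
  rw [eLpNorm_eq_lintegral_rpow_enorm_toReal hs0 hs']
  refine ENNReal.rpow_le_rpow ?_ (by positivity)
  calc ∫⁻ x, ‖f x‖ₑ ^ s.toReal ≤ ∫⁻ x, A * ‖f x‖ₑ := by
        refine lintegral_mono fun x => ?_
        have : ‖f x‖ₑ ^ s.toReal = ‖f x‖ₑ ^ (s.toReal - 1) * ‖f x‖ₑ := by
          conv_rhs => rw [← ENNReal.rpow_one (‖f x‖ₑ), ← ENNReal.rpow_mul, one_mul]
          rw [← ENNReal.rpow_add_of_nonneg _ _ (by linarith) zero_le_one]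
          ring_nf
        rw [this]
        refine mul_le_mul_left (ENNReal.rpow_le_rpow ?_ (by linarith)) _
        rw [← ofReal_norm]
        exact ENNReal.ofReal_le_ofReal (hM x)
    _ = A * ∫⁻ x, ‖f x‖ₑ := lintegral_const_mul' _ _ hAt
    _ ≤ A * ENNReal.ofReal L := by
        refine mul_le_mul_right ?_ _
        have := ofReal_integral_norm_eq_lintegral_enorm (TestFn.integrable f)
        rw [← this]
        exact ENNReal.ofReal_le_ofReal hf

theorem measure_biUnion_closedBall_le {n : ℕ} {ι : Type} [Fintype ι] (c : ι → Rn n) (ρ : ι → ℝ)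
    (hρ : ∀ j, 0 < ρ j) : volume (⋃ j, Metric.closedBall (c j) (2 * ρ j)) ≤
      ENNReal.ofReal (2 ^ n * ∑ j, volume.real (Metric.closedBall (c j) (ρ j))) := by
  refine (measure_iUnion_fintype_le _ _).trans ?_
  rw [Finset.mul_sum, ENNReal.ofReal_sum_of_nonneg fun j _ => by positivity]
  refine Finset.sum_le_sum fun j _ => ?_
  rw [← volume_real_closedBall_mul _ (by norm_num) (hρ j).le, ofReal_measureReal
    measure_closedBall_lt_top.ne]

/-- For a finite slot exponent, a bounded function with small `L^1` norm has small `L^s` norm. For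
the exponent `∞` the function is decomposed at a small height `t`: the good part is small in `L^∞`,
and the bad part is small in `L^1` and has mean zero on balls of small total volume, away from which
the Dini estimate applies. -/
theorem IsCZO.exists_integral_le {n k : ℕ} (hn : 0 < n) {T : InitialOperator n (k + 1)}
    (hT : IsCZO T) (i : Fin (k + 1)) {M : ℝ} (hM : 0 ≤ M) (R : ℝ) {ε : ℝ} (hε : 0 < ε)
    {δ : ℝ≥0∞} (hδ : 0 < δ) :
    ∃ L : ℝ, 0 < L ∧ ∀ f : Fin (k + 1) → TestFn n, (∀ j x, ‖f j x‖ ≤ M) →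
      (∀ j, tsupport (f j) ⊆ Metric.closedBall 0 R) → ∫ x, ‖f i x‖ ≤ L →
      volume {x | ε ≤ ‖T f x‖} ≤ δ := by
  obtain ⟨⟨s, q, hs, -, hq0, hq1, C, hC⟩, K, ω, hω, hD, hS, hK, hrep⟩ := hT
  have hq0' : q ≠ 0 := by rintro rfl; simp at hq1
  have hq1' : q ≠ ∞ := by rintro rfl; simp at hq0
  by_cases hsi : s i = ∞
  · obtain ⟨η, hη, hηb⟩ := InitiallyBounded.measure_le hq0' hq1' hC i M R (half_pos hε)
      (ENNReal.half_pos hδ.ne')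
    obtain ⟨D, hDt, hfar⟩ := lintegral_operator_far_le hn hω hD hS hK hrep
    -- The height `t` is fixed first, to make the good part small; then `L` is taken small relative
    -- to `t`, since the exceptional balls have total volume of order `L / t`.
    obtain ⟨t, ht, htη⟩ : ∃ t : ℝ, 0 < t ∧ ENNReal.ofReal ((2 + 12 ^ n) * t) ≤ η := by
      have : Tendsto (fun t : ℝ => ENNReal.ofReal ((2 + 12 ^ n) * t)) (𝓝[>] 0) (𝓝 0) := by
        have h : Continuous fun t : ℝ => ENNReal.ofReal ((2 + 12 ^ n) * t) :=
          ENNReal.continuous_ofReal.comp (by fun_prop)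
        have := (h.tendsto 0).mono_left (nhdsWithin_le_nhds (s := Set.Ioi 0))
        simpa using this
      obtain ⟨t, h1, h2⟩ := ((this.eventually (Iic_mem_nhds hη)).and self_mem_nhdsWithin).exists
      exact ⟨t, h2, h1⟩
    obtain ⟨L, hL, hLδ⟩ : ∃ L : ℝ, 0 < L ∧ ENNReal.ofReal (2 ^ n * (6 ^ n * L / t)) +
        D * ENNReal.ofReal (M ^ k * (2 * L)) / ENNReal.ofReal (ε / 2) ≤ δ / 2 := by
      have h : Continuous fun L : ℝ => ENNReal.ofReal (2 ^ n * (6 ^ n * L / t)) :=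
        ENNReal.continuous_ofReal.comp (by fun_prop)
      have h' : Continuous fun L : ℝ => ENNReal.ofReal (M ^ k * (2 * L)) :=
        ENNReal.continuous_ofReal.comp (by fun_prop)
      have h1 := (h.tendsto 0).mono_left (nhdsWithin_le_nhds (s := Set.Ioi 0))
      have h2 := (h'.tendsto 0).mono_left (nhdsWithin_le_nhds (s := Set.Ioi 0))
      have h3 := ENNReal.Tendsto.div_const (ENNReal.Tendsto.const_mul (a := D) h2 (Or.inr hDt))
        (b := ENNReal.ofReal (ε / 2)) (Or.inr (by simpa using hε))
      have h4 := h1.add h3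
      simp only [mul_zero, zero_div, ENNReal.ofReal_zero, ENNReal.zero_div, add_zero] at h4
      obtain ⟨t, h1, h2⟩ := ((h4.eventually (Iic_mem_nhds (ENNReal.half_pos hδ.ne'))).and
        self_mem_nhdsWithin).exists
      exact ⟨t, h2, h1⟩
    refine ⟨L, hL, fun f hfM hfR hfL => ?_⟩
    obtain ⟨ι, _, c, ρ, g, β, hdec, hg, hρ, hsupp, hint, hβ1, hvol⟩ :=
      exists_calderonZygmund_decomposition hn (f i) ht
    have hsum : ∫ x, ‖f i x‖ ≤ L := hfL
    let F : Fin (k + 1) → TestFn n := Function.update f i g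
    let H : ι → Fin (k + 1) → TestFn n := fun j => Function.update f i (β j)
    have hTf : T f = T F + ∑ j, T (H j) := by
      conv_lhs => rw [← Function.update_eq_self i f, hdec]
      rw [MultilinearMap.map_update_add, MultilinearMap.map_update_sum]
    have hae : ∀ᵐ x, T f x = T F x + ∑ j, T (H j) x := by
      rw [hTf]
      filter_upwards [AEEqFun.coeFn_add (T F) (∑ j, T (H j)),
        AEEqFun.coeFn_finsetSum Finset.univ fun j => T (H j)] with x h1 h2
      rw [h1, Pi.add_apply, h2, Finset.sum_apply]
    have hFb : volume {x | ε / 2 ≤ ‖T F x‖} ≤ δ / 2 := by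
      refine hηb F (fun j hj => ?_) (fun j hj => ?_) ?_
      · simpa [F, hj] using hfM j
      · simpa [F, hj] using hfR j
      · simp only [F, Function.update_self, hsi]
        refine le_trans ?_ htη
        rw [eLpNorm_exponent_top]
        exact eLpNormEssSup_le_of_ae_bound (Eventually.of_forall hg)
    set Ω : Set (Rn n) := ⋃ j, Metric.closedBall (c j) (2 * ρ j) with hΩ
    have hΩm : MeasurableSet Ω :=
      MeasurableSet.iUnion fun j => Metric.isClosed_closedBall.measurableSet
    have hΩv : volume Ω ≤ ENNReal.ofReal (2 ^ n * (6 ^ n * L / t)) := by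
      refine (measure_biUnion_closedBall_le c ρ hρ).trans (ENNReal.ofReal_le_ofReal ?_)
      refine mul_le_mul_of_nonneg_left ?_ (by positivity)
      rw [le_div_iff₀ ht, mul_comm]
      exact hvol.trans (mul_le_mul_of_nonneg_left hsum (by positivity))
    have hfarsum : ∫⁻ x in Ωᶜ, ∑ j, ‖T (H j) x‖ₑ ≤ D * ENNReal.ofReal (M ^ k * (2 * L)) := by
      rw [lintegral_finsetSum' _ fun j _ => (T (H j)).aestronglyMeasurable.enorm.restrict]
      calc ∑ j, ∫⁻ x in Ωᶜ, ‖T (H j) x‖ₑ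
          ≤ ∑ j, D * ENNReal.ofReal (M ^ k * ∫ x, ‖β j x‖) := by
            refine Finset.sum_le_sum fun j _ => ?_
            have h1 : Ωᶜ ⊆ {x | 2 * ρ j ≤ ‖x - c j‖} := by
              intro x hx
              simp only [hΩ, Set.mem_compl_iff, Set.mem_iUnion, not_exists,
                Metric.mem_closedBall, dist_eq_norm, not_le] at hx
              exact (hx j).le
            refine (lintegral_mono_set h1).trans ?_
            have h2 := hfar i (H j) M hM (fun l hl x => by simpa [H, hl] using hfM l x) (c j) (ρ j)
              (hρ j) (by simpa [H] using hsupp j) (by simpa [H] using hint j)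
            simpa [H] using h2
        _ = D * ENNReal.ofReal (M ^ k * ∑ j, ∫ x, ‖β j x‖) := by
            rw [Finset.mul_sum, ENNReal.ofReal_sum_of_nonneg, Finset.mul_sum]
            intro j _
            have : 0 ≤ ∫ x, ‖β j x‖ := integral_nonneg fun _ => norm_nonneg _
            positivity
        _ ≤ _ := by
            refine mul_le_mul_right (ENNReal.ofReal_le_ofReal ?_) _
            refine mul_le_mul_of_nonneg_left (hβ1.trans ?_) (by positivity)
            linarith
    have hmark : volume (Ωᶜ ∩ {x | ENNReal.ofReal (ε / 2) ≤ ∑ j, ‖T (H j) x‖ₑ}) ≤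
        D * ENNReal.ofReal (M ^ k * (2 * L)) / ENNReal.ofReal (ε / 2) := by
      have hm : AEMeasurable (fun x => ∑ j, ‖T (H j) x‖ₑ) (volume.restrict Ωᶜ) :=
        Finset.aemeasurable_fun_sum _ fun j _ => (T (H j)).aestronglyMeasurable.enorm.restrict
      have := meas_ge_le_lintegral_div hm (ε := ENNReal.ofReal (ε / 2)) (by simpa using hε)
        ENNReal.ofReal_ne_top
      rw [Measure.restrict_apply₀' hΩm.compl.nullMeasurableSet, Set.inter_comm] at this
      exact this.trans (ENNReal.div_le_div_right hfarsum _)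
    let A : Set (Rn n) := {x | ε ≤ ‖T f x‖}
    let B : Set (Rn n) := {x | ε / 2 ≤ ‖T F x‖} ∪ (Ω ∪
      (Ωᶜ ∩ {x | ENNReal.ofReal (ε / 2) ≤ ∑ j, ‖T (H j) x‖ₑ}))
    have hAB : A ≤ᵐ[volume] B := by
      filter_upwards [hae] with x hx
      intro (hxA : ε ≤ ‖T f x‖)
      by_cases h1 : ε / 2 ≤ ‖T F x‖
      · exact Or.inl h1
      refine Or.inr ?_
      by_cases h2 : x ∈ Ω
      · exact Or.inl h2
      refine Or.inr ⟨h2, ?_⟩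
      rw [hx] at hxA
      have h3 := norm_add_le (T F x) (∑ j, T (H j) x)
      have h4 := norm_sum_le Finset.univ fun j => T (H j) x
      rw [Set.mem_ofPred_eq]
      simp_rw [← ofReal_norm]
      rw [← ENNReal.ofReal_sum_of_nonneg fun j _ => norm_nonneg _]
      exact ENNReal.ofReal_le_ofReal (by linarith)
    calc volume A ≤ volume B := measure_mono_ae hAB
      _ ≤ δ / 2 + (ENNReal.ofReal (2 ^ n * (6 ^ n * L / t)) +
          D * ENNReal.ofReal (M ^ k * (2 * L)) / ENNReal.ofReal (ε / 2)) :=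
        (measure_union_le _ _).trans (add_le_add hFb
          ((measure_union_le _ _).trans (add_le_add hΩv hmark)))
      _ ≤ δ / 2 + δ / 2 := add_le_add_right hLδ _
      _ = δ := ENNReal.add_halves δ
  · obtain ⟨η, hη, hηb⟩ := InitiallyBounded.measure_le hq0' hq1' hC i M R hε hδ
    obtain ⟨L, hL, hLb⟩ := eLpNorm_le_of_bounded_of_integral_le (n := n) (hs i) hsi M hη
    exact ⟨L, hL, fun f hfM hfR hfL => hηb f (fun j _ => hfM j) (fun j _ => hfR j)
      (hLb (f i) (hfM i) hfL)⟩

/-! ### Values of the operator on bounded, compactly supported functions -/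

theorem MemLinftyC.exists_bound {n : ℕ} {f : Rn n → ℂ} (hf : MemLinftyC f) :
    ∃ M : ℝ, 0 ≤ M ∧ ∀ᵐ x, ‖f x‖ ≤ M := by
  refine ⟨(eLpNorm f ∞ volume).toReal, ENNReal.toReal_nonneg, ?_⟩
  filter_upwards [ae_le_eLpNormEssSup (f := f) (μ := volume)] with x hx
  rw [← toReal_enorm]
  rw [← eLpNorm_exponent_top] at hx
  exact ENNReal.toReal_mono hf.1.eLpNorm_ne_top hx

theorem MemLinftyC.memLp {n : ℕ} {f : Rn n → ℂ} (hf : MemLinftyC f) (p : ℝ≥0∞) :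
    MemLp f p volume := by
  have hsub : tsupport f ⊆ tsupport f := subset_rfl
  refine hf.1.mono_exponent_of_measure_support_ne_top (s := tsupport f)
    (fun x hx => image_eq_zero_of_notMem_tsupport hx) hf.2.isCompact.measure_lt_top.ne le_top

theorem MemLinftyC.integrable {n : ℕ} {f : Rn n → ℂ} (hf : MemLinftyC f) : Integrable f :=
  memLp_one_iff_integrable.1 (hf.memLp 1)

/-- Mollification: it does not increase the essential bound and enlarges the support by at most `δ`.
Keeping the outer radius of the bumps twice the inner one makes Lebesgue differentiation give almost
everywhere convergence. -/
theorem exists_boundedlyApproximates {n : ℕ} {f : Rn n → ℂ} (hf : MemLinftyC f) {c : Rn n}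
    {ρ : ℝ} (hsupp : Function.support f ⊆ Metric.closedBall c ρ) {δ : ℝ} (hδ : 0 < δ) :
    ∃ φ : ℕ → TestFn n, BoundedlyApproximates φ f ∧
      ∀ k, tsupport (φ k) ⊆ Metric.closedBall c (ρ + δ) := by
  let χ : ℕ → ContDiffBump (0 : Rn n) := fun k =>
    ⟨δ / 2 / (k + 1), δ / (k + 1), by positivity, by
      gcongr; linarith⟩
  obtain ⟨M, hM, hfM⟩ := hf.exists_bound
  let g : ℕ → Rn n → ℂ := fun k =>
    convolution ((χ k).normed volume) f (ContinuousLinearMap.lsmul ℝ ℝ) volume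
  have hcs : ∀ k, HasCompactSupport (g k) := fun k =>
    (χ k).hasCompactSupport_normed.convolution _ hf.2
  have hsm : ∀ k, ContDiff ℝ ((⊤ : ℕ∞) : WithTop ℕ∞) (g k) := fun k =>
    (χ k).hasCompactSupport_normed.contDiff_convolution_left _ (χ k).contDiff_normed
      hf.integrable.locallyIntegrable
  have hbd : ∀ k x, ‖g k x‖ ≤ M := by
    intro k x
    have h1 : ∀ᵐ t, ‖f (x - t)‖ ≤ M :=
      (quasiMeasurePreserving_sub_left volume x).ae hfM
    have h2 : Integrable (fun t => (χ k).normed volume t * M) :=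
      ((χ k).integrable_normed).mul_const M
    refine (norm_integral_le_of_norm_le h2 ?_).trans (le_of_eq ?_)
    · filter_upwards [h1] with t ht
      rw [ContinuousLinearMap.lsmul_apply, norm_smul, Real.norm_of_nonneg ((χ k).nonneg_normed t)]
      exact mul_le_mul_of_nonneg_left ht ((χ k).nonneg_normed t)
    · rw [integral_mul_const, (χ k).integral_normed, one_mul]
  have hts : ∀ k, tsupport (g k) ⊆ Metric.closedBall c (ρ + δ) := by
    intro k
    refine closure_minimal (fun x hx => ?_) Metric.isClosed_closedBall
    obtain ⟨u, hu, v, hv, rfl⟩ := support_convolution_subset _ hx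
    rw [(χ k).support_normed_eq, Metric.mem_ball, dist_zero_right] at hu
    have hv' := hsupp hv
    rw [Metric.mem_closedBall, dist_eq_norm] at hv' ⊢
    have h3 : (χ k).rOut ≤ δ := div_le_self hδ.le (by linarith [(k.cast_nonneg : (0:ℝ) ≤ k)])
    calc ‖u + v - c‖ = ‖u + (v - c)‖ := by rw [add_sub_assoc]
      _ ≤ ‖u‖ + ‖v - c‖ := norm_add_le _ _
      _ ≤ ρ + δ := by linarith
  refine ⟨fun k => mkTestFn (g k) (hsm k) (hcs k), ⟨⟨M, hbd⟩, ⟨‖c‖ + (ρ + δ), fun k => ?_⟩, ?_⟩, hts⟩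
  · refine (hts k).trans (Metric.closedBall_subset_closedBall' ?_)
    rw [dist_zero_right, add_comm]
  · have hK : ∀ᶠ k in atTop, (χ k).rOut ≤ 2 * (χ k).rIn := Eventually.of_forall fun k => by
      change δ / (k + 1) ≤ 2 * (δ / 2 / (k + 1))
      exact le_of_eq (by ring)
    have h0 : Tendsto (fun k => (χ k).rOut) atTop (𝓝 0) := by
      have := (tendsto_one_div_add_atTop_nhds_zero_nat (𝕜 := ℝ)).const_mul δ
      simpa [χ, div_eq_mul_inv] using this
    exact ContDiffBump.ae_convolution_tendsto_right_of_locallyIntegrable h0 hK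
      hf.integrable.locallyIntegrable

theorem MemLinftyC.exists_boundedlyApproximates {n : ℕ} {f : Rn n → ℂ} (hf : MemLinftyC f) :
    ∃ φ : ℕ → TestFn n, BoundedlyApproximates φ f := by
  obtain ⟨ρ, hρ⟩ := hf.2.isCompact.isBounded.subset_closedBall (0 : Rn n)
  obtain ⟨φ, hφ, -⟩ := MultilinearCZ.exists_boundedlyApproximates hf
    ((subset_tsupport f).trans hρ) one_pos
  exact ⟨φ, hφ⟩

theorem BoundedlyApproximates.tendsto_integral {n : ℕ} {φ : ℕ → TestFn n} {f : Rn n → ℂ}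
    (hφ : BoundedlyApproximates φ f) (hf : MemLinftyC f) :
    Tendsto (fun k => ∫ x, ‖φ k x - f x‖) atTop (𝓝 0) := by
  obtain ⟨⟨M, hM⟩, ⟨R, hR⟩, hlim⟩ := hφ
  have hM0 : 0 ≤ M := (norm_nonneg _).trans (hM 0 0)
  have h := tendsto_integral_of_dominated_convergence (μ := (volume : Measure (Rn n)))
    (F := fun k x => ‖φ k x - f x‖) (f := fun _ => 0)
    (fun x => (Metric.closedBall (0 : Rn n) R).indicator (fun _ => M) x + ‖f x‖)
    (fun k => ((φ k).continuous.aestronglyMeasurable.sub hf.1.1).norm) ?_ ?_ ?_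
  · simpa using h
  · refine Integrable.add ?_ hf.integrable.norm
    exact (integrable_indicator_iff Metric.isClosed_closedBall.measurableSet).2
      (integrableOn_const measure_closedBall_lt_top.ne)
  · intro k
    refine Eventually.of_forall fun x => ?_
    rw [norm_norm]
    refine (norm_sub_le _ _).trans (add_le_add_left ?_ _)
    by_cases hx : x ∈ Metric.closedBall (0 : Rn n) R
    · rw [Set.indicator_of_mem hx]; exact hM k x
    · rw [Set.indicator_of_notMem hx,
        image_eq_zero_of_notMem_tsupport fun h => hx (hR k h), norm_zero]
  · filter_upwards [hlim] with x hx
    have := (hx.sub_const (f x)).norm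
    simpa using this

/-- The slots are exchanged one at a time, each exchange being an instance of
`IsCZO.exists_integral_le`. -/
theorem IsCZO.exists_integral_sub_le {n k : ℕ} (hn : 0 < n) {T : InitialOperator n (k + 1)}
    (hT : IsCZO T) {M : ℝ} (hM : 0 ≤ M) (R : ℝ) {ε : ℝ} (hε : 0 < ε) {δ : ℝ≥0∞} (hδ : 0 < δ) :
    ∃ L : ℝ, 0 < L ∧ ∀ f g : Fin (k + 1) → TestFn n, (∀ j x, ‖f j x‖ ≤ M) →
      (∀ j x, ‖g j x‖ ≤ M) → (∀ j, tsupport (f j) ⊆ Metric.closedBall 0 R) →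
      (∀ j, tsupport (g j) ⊆ Metric.closedBall 0 R) → (∀ i, ∫ x, ‖f i x - g i x‖ ≤ L) →
      volume {x | ε ≤ ‖T f x - T g x‖} ≤ δ := by
  suffices h : ∀ s : Finset (Fin (k + 1)), ∀ ε : ℝ, 0 < ε → ∀ δ : ℝ≥0∞, 0 < δ →
      ∃ L : ℝ, 0 < L ∧ ∀ f g : Fin (k + 1) → TestFn n, (∀ j ∉ s, f j = g j) →
      (∀ j x, ‖f j x‖ ≤ M) →
      (∀ j x, ‖g j x‖ ≤ M) → (∀ j, tsupport (f j) ⊆ Metric.closedBall 0 R) →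
      (∀ j, tsupport (g j) ⊆ Metric.closedBall 0 R) → (∀ i, ∫ x, ‖f i x - g i x‖ ≤ L) →
      volume {x | ε ≤ ‖T f x - T g x‖} ≤ δ by
    obtain ⟨L, hL, h⟩ := h Finset.univ ε hε δ hδ
    exact ⟨L, hL, fun f g => h f g (fun j hj => absurd (Finset.mem_univ j) hj)⟩
  intro s
  induction s using Finset.induction_on with
  | empty =>
    intro ε hε δ hδ
    refine ⟨1, one_pos, fun f g hfg _ _ _ _ _ => ?_⟩
    have : f = g := funext fun j => hfg j (Finset.notMem_empty j)
    subst this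
    have h0 : {x : Rn n | ε ≤ ‖T f x - T f x‖} = ∅ := by
      ext x; simpa using hε
    rw [h0, measure_empty]
    exact zero_le
  | insert a s ha ih =>
    intro ε hε δ hδ
    obtain ⟨L₁, hL₁, h₁⟩ := ih (ε / 2) (half_pos hε) (δ / 2) (ENNReal.half_pos hδ.ne')
    -- The exchanged slot holds the difference of two functions bounded by `M`, whence `2 * M`.
    obtain ⟨L₂, hL₂, h₂⟩ := hT.exists_integral_le hn a (by positivity : 0 ≤ 2 * M) R (half_pos hε)
      (ENNReal.half_pos hδ.ne')
    refine ⟨min L₁ L₂, lt_min hL₁ hL₂, fun f g hfg hfM hgM hfR hgR hL => ?_⟩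
    let u : Fin (k + 1) → TestFn n := Function.update f a (g a)
    let v : Fin (k + 1) → TestFn n := Function.update f a (f a - g a)
    have hTv : T v = T f - T u := by
      simp only [v, u, MultilinearMap.map_update_sub, Function.update_eq_self]
    have hu := h₁ u g ?_ ?_ hgM ?_ hgR ?_
    · have hv := h₂ v ?_ ?_ ?_
      · have hae : ∀ᵐ x, T v x = T f x - T u x := by
          rw [hTv]; exact AEEqFun.coeFn_sub _ _
        let A : Set (Rn n) := {x | ε ≤ ‖T f x - T g x‖}
        let B : Set (Rn n) := {x | ε / 2 ≤ ‖T u x - T g x‖} ∪ {x | ε / 2 ≤ ‖T v x‖}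
        have hAB : A ≤ᵐ[volume] B := by
          filter_upwards [hae] with x hx
          intro (hxA : ε ≤ ‖T f x - T g x‖)
          by_contra hxB
          have h3 : ¬ (ε / 2 ≤ ‖T u x - T g x‖) := fun h => hxB (Or.inl h)
          have h4 : ¬ (ε / 2 ≤ ‖T v x‖) := fun h => hxB (Or.inr h)
          rw [hx] at h4
          have := norm_sub_le_norm_sub_add_norm_sub (T f x) (T u x) (T g x)
          linarith
        calc volume A ≤ volume B := measure_mono_ae hAB
          _ ≤ δ / 2 + δ / 2 := (measure_union_le _ _).trans (add_le_add hu hv)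
          _ = δ := ENNReal.add_halves δ
      · intro j x
        by_cases hj : j = a
        · subst hj
          simp only [v, Function.update_self]
          refine (norm_sub_le _ _).trans ?_
          linarith [hfM j x, hgM j x]
        · simp only [v, Function.update_of_ne hj]; linarith [hfM j x]
      · intro j
        by_cases hj : j = a
        · subst hj
          simp only [v, Function.update_self]
          exact (tsupport_sub _ _).trans (Set.union_subset (hfR j) (hgR j))
        · simp only [v, Function.update_of_ne hj]; exact hfR j
      · simp only [v, Function.update_self]
        exact (hL a).trans (min_le_right _ _)
    · intro j hj
      by_cases hja : j = a
      · subst hja; simp [u]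
      · simp only [u, Function.update_of_ne hja]
        exact hfg j (by simp [hja, hj])
    · intro j x
      by_cases hj : j = a
      · subst hj; simpa [u] using hgM j x
      · simpa [u, Function.update_of_ne hj] using hfM j x
    · intro j
      by_cases hj : j = a
      · subst hj; simpa [u] using hgR j
      · simpa [u, Function.update_of_ne hj] using hfR j
    · intro j
      by_cases hj : j = a
      · subst hj; simpa [u] using hL₁.le
      · simpa [u, Function.update_of_ne hj] using (hL j).trans (min_le_left _ _)

theorem BoundedlyApproximates.integral_sub_tendsto {n : ℕ} {φ ψ : ℕ → TestFn n} {f : Rn n → ℂ}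
    (hφ : BoundedlyApproximates φ f) (hψ : BoundedlyApproximates ψ f) (hf : MemLinftyC f) {L : ℝ}
    (hL : 0 < L) : ∃ N, ∀ k ≥ N, ∀ l ≥ N, ∫ x, ‖φ k x - ψ l x‖ ≤ L := by
  have h1 := (hφ.tendsto_integral hf).eventually (gt_mem_nhds (half_pos hL))
  have h2 := (hψ.tendsto_integral hf).eventually (gt_mem_nhds (half_pos hL))
  obtain ⟨N, hN⟩ := eventually_atTop.1 (h1.and h2)
  refine ⟨N, fun k hk l hl => ?_⟩
  have i1 : Integrable fun x => ‖φ k x - f x‖ := ((TestFn.integrable _).sub hf.integrable).norm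
  have i2 : Integrable fun x => ‖ψ l x - f x‖ := ((TestFn.integrable _).sub hf.integrable).norm
  have i3 : Integrable fun x => ‖φ k x - ψ l x‖ :=
    ((TestFn.integrable _).sub (TestFn.integrable _)).norm
  calc ∫ x, ‖φ k x - ψ l x‖ ≤ ∫ x, (‖φ k x - f x‖ + ‖ψ l x - f x‖) := by
        refine integral_mono i3 (i1.add i2) fun x => ?_
        have := norm_sub_le_norm_sub_add_norm_sub (φ k x) (f x) (ψ l x)
        rwa [norm_sub_rev (f x)] at this
    _ ≤ L := by
        rw [integral_add i1 i2]
        linarith [(hN k hk).1, (hN l hl).2]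

theorem exists_common_bounds {n : ℕ} {ι : Type*} [Fintype ι] {φ : ι → ℕ → TestFn n}
    {f : ι → Rn n → ℂ} (hφ : ∀ i, BoundedlyApproximates (φ i) (f i)) :
    ∃ M R : ℝ, 0 ≤ M ∧ ∀ i k, (∀ x, ‖φ i k x‖ ≤ M) ∧
      tsupport (φ i k) ⊆ Metric.closedBall 0 R := by
  choose M hM using fun i => (hφ i).1
  choose R hR using fun i => (hφ i).2.1
  refine ⟨∑ i, |M i|, ∑ i, |R i|, by positivity, fun i k => ⟨fun x => ?_, ?_⟩⟩
  · refine (hM i k x).trans ((le_abs_self _).trans ?_)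
    exact Finset.single_le_sum (f := fun i => |M i|) (fun j _ => abs_nonneg _) (Finset.mem_univ i)
  · refine (hR i k).trans (Metric.closedBall_subset_closedBall ((le_abs_self _).trans ?_))
    exact Finset.single_le_sum (f := fun i => |R i|) (fun j _ => abs_nonneg _) (Finset.mem_univ i)

theorem IsCZO.measure_sub_le {n k : ℕ} (hn : 0 < n) {T : InitialOperator n (k + 1)}
    (hT : IsCZO T) {f : Fin (k + 1) → Rn n → ℂ} (hf : ∀ i, MemLinftyC (f i))
    {φ ψ : ℕ → Fin (k + 1) → TestFn n} (hφ : ∀ i, BoundedlyApproximates (fun l => φ l i) (f i))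
    (hψ : ∀ i, BoundedlyApproximates (fun l => ψ l i) (f i)) {ε : ℝ} (hε : 0 < ε) {δ : ℝ≥0∞}
    (hδ : 0 < δ) : ∃ N, ∀ a ≥ N, ∀ l ≥ N, volume {x | ε ≤ ‖T (φ a) x - T (ψ l) x‖} ≤ δ := by
  obtain ⟨M₁, R₁, hM₁, h₁⟩ := exists_common_bounds hφ
  obtain ⟨M₂, R₂, hM₂, h₂⟩ := exists_common_bounds hψ
  obtain ⟨L, hL, h⟩ := hT.exists_integral_sub_le hn (hM₁.trans (le_max_left M₁ M₂)) (max R₁ R₂) hε hδ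
  choose N hN using fun i => (hφ i).integral_sub_tendsto (hψ i) (hf i) hL
  refine ⟨Finset.univ.sup N, fun a ha l hl => h _ _ (fun j x => ?_) (fun j x => ?_) (fun j => ?_)
    (fun j => ?_) fun i => hN i a (le_trans (Finset.le_sup (Finset.mem_univ i)) ha) l
      (le_trans (Finset.le_sup (Finset.mem_univ i)) hl)⟩
  · exact ((h₁ j a).1 x).trans (le_max_left _ _)
  · exact ((h₂ j l).1 x).trans (le_max_right _ _)
  · exact (h₁ j a).2.trans (Metric.closedBall_subset_closedBall (le_max_left _ _))
  · exact (h₂ j l).2.trans (Metric.closedBall_subset_closedBall (le_max_right _ _))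

/-- The images of two bounded approximations of the same functions approach each other in measure,
so the limit along one approximation is the limit along all. -/
theorem IsCZO.isValue_of_tendsto {n k : ℕ} (hn : 0 < n) {T : InitialOperator n (k + 1)}
    (hT : IsCZO T) {f : Fin (k + 1) → Rn n → ℂ} (hf : ∀ i, MemLinftyC (f i))
    {φ : ℕ → Fin (k + 1) → TestFn n} (hφ : ∀ i, BoundedlyApproximates (fun l => φ l i) (f i))
    {h : Rn n →ₘ[(volume : Measure (Rn n))] ℂ}
    (hlim : TendstoInMeasure volume (fun k => (T (φ k) : Rn n → ℂ)) atTop h) : IsValue T f h := by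
  refine ⟨hf, fun ψ hψ => ?_⟩
  have h0 : TendstoInMeasure volume (fun k x => T (ψ k) x - T (φ k) x) atTop
      (fun _ => (0 : ℂ)) := by
    rw [tendstoInMeasure_iff_norm]
    intro ε hε
    rw [ENNReal.tendsto_atTop_zero]
    intro δ hδ
    obtain ⟨N, hN⟩ := hT.measure_sub_le hn hf hψ hφ hε hδ
    exact ⟨N, fun a ha => by simpa only [sub_zero] using hN a ha a ha⟩
  have := tendstoInMeasure_add h0 hlim
  simpa using this

theorem IsCZO.exists_isValue {n k : ℕ} (hn : 0 < n) {T : InitialOperator n (k + 1)}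
    (hT : IsCZO T) {f : Fin (k + 1) → Rn n → ℂ} (hf : ∀ i, MemLinftyC (f i)) :
    ∃ h, IsValue T f h := by
  choose φ hφ using fun i => (hf i).exists_boundedlyApproximates
  have hφ' : ∀ i, BoundedlyApproximates (fun l => (fun l i => φ i l : ℕ → Fin (k + 1) → TestFn n) l i)
      (f i) := hφ
  obtain ⟨h, hh⟩ := exists_tendstoInMeasure_of_cauchy
    (f := fun l => (T (fun i => φ i l) : Rn n → ℂ)) (μ := volume)
    (fun l => (T (fun i => φ i l)).aestronglyMeasurable)
    (fun ε hε δ hδ => hT.measure_sub_le hn hf hφ' hφ' hε hδ)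
  exact ⟨h, hT.isValue_of_tendsto hn hf hφ' hh⟩

theorem MemLinftyC.sum_mul {n : ℕ} {ι : Type*} [Fintype ι] {u : ι → Rn n → ℂ}
    (hu : ∀ j, MemLinftyC (u j)) (a : ι → ℂ) : MemLinftyC fun x => ∑ j, a j * u j x := by
  refine ⟨memLp_finsetSum _ fun j _ => (hu j).1.const_mul (a j), ?_⟩
  refine HasCompactSupport.of_support_subset_isCompact
    (K := ⋃ j, tsupport (u j)) (isCompact_iUnion fun j => (hu j).2.isCompact) fun x hx => ?_
  obtain ⟨j, -, hj⟩ := Finset.exists_ne_zero_of_sum_ne_zero hx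
  exact Set.mem_iUnion.2 ⟨j, subset_tsupport _ (right_ne_zero_of_mul hj)⟩

theorem BoundedlyApproximates.sum_smul {n : ℕ} {ι : Type*} [Fintype ι] {φ : ι → ℕ → TestFn n}
    {u : ι → Rn n → ℂ} (h : ∀ j, BoundedlyApproximates (φ j) (u j)) (a : ι → ℂ) :
    BoundedlyApproximates (fun k => ∑ j, a j • φ j k) fun x => ∑ j, a j * u j x := by
  obtain ⟨M, R, hM, hb⟩ := exists_common_bounds h
  have hval : ∀ k x, (∑ j, a j • φ j k) x = ∑ j, a j * φ j k x := by
    intro k x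
    have : ((∑ j, a j • φ j k : TestFn n) : Rn n → ℂ) = ∑ j, a j • (φ j k : Rn n → ℂ) := by
      classical
      induction (Finset.univ : Finset ι) using Finset.induction_on with
      | empty => rfl
      | insert i s hi ih => rw [Finset.sum_insert hi, Finset.sum_insert hi, ← ih]; rfl
    rw [this, Finset.sum_apply]
    rfl
  refine ⟨⟨∑ j, ‖a j‖ * M, fun k x => ?_⟩, ⟨R, fun k => ?_⟩, ?_⟩
  · rw [hval]
    refine (norm_sum_le _ _).trans (Finset.sum_le_sum fun j _ => ?_)
    rw [norm_mul]
    exact mul_le_mul_of_nonneg_left ((hb j k).1 x) (norm_nonneg _)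
  · refine closure_minimal (fun x hx => ?_) Metric.isClosed_closedBall
    rw [Function.mem_support, hval] at hx
    obtain ⟨j, -, hj⟩ := Finset.exists_ne_zero_of_sum_ne_zero hx
    exact (hb j k).2 (subset_tsupport _ (right_ne_zero_of_mul hj))
  · have : ∀ᵐ x, ∀ j, Tendsto (fun k => φ j k x) atTop (𝓝 (u j x)) := ae_all_iff.2 fun j => (h j).2.2
    filter_upwards [this] with x hx
    simp only [hval]
    exact tendsto_finsetSum _ fun j _ => (hx j).const_mul (a j)

theorem coeFn_sum_smul {n : ℕ} {κ : Type*} [Fintype κ] (c : κ → ℂ)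
    (h : κ → Rn n →ₘ[(volume : Measure (Rn n))] ℂ) :
    ((∑ J, c J • h J : Rn n →ₘ[(volume : Measure (Rn n))] ℂ) : Rn n → ℂ) =ᵐ[volume]
      fun x => ∑ J, c J * h J x := by
  have h2 : ∀ᵐ x, ∀ J, (c J • h J : Rn n →ₘ[(volume : Measure (Rn n))] ℂ) x = c J * h J x :=
    ae_all_iff.2 fun J => AEEqFun.coeFn_smul _ _
  filter_upwards [AEEqFun.coeFn_finsetSum Finset.univ fun J => c J • h J, h2] with x h1 h2
  rw [h1, Finset.sum_apply]
  exact Finset.sum_congr rfl fun J _ => h2 J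

theorem IsCZO.isValue_sum {n k : ℕ} (hn : 0 < n) {T : InitialOperator n (k + 1)}
    (hT : IsCZO T) {ι : Type*} [Fintype ι] {u : Fin (k + 1) → ι → Rn n → ℂ}
    (hu : ∀ i j, MemLinftyC (u i j)) (a : Fin (k + 1) → ι → ℂ)
    {h : (Fin (k + 1) → ι) → Rn n →ₘ[(volume : Measure (Rn n))] ℂ}
    (hv : ∀ J, IsValue T (fun i => u i (J i)) (h J)) :
    IsValue T (fun i x => ∑ j, a i j * u i j x) (∑ J, (∏ i, a i (J i)) • h J) := by
  choose φ hφ using fun i j => (hu i j).exists_boundedlyApproximates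
  refine hT.isValue_of_tendsto hn (fun i => MemLinftyC.sum_mul (hu i) (a i))
    (φ := fun l i => ∑ j, a i j • φ i j l) (fun i => .sum_smul (hφ i) (a i)) ?_
  have hlim : TendstoInMeasure volume (fun l x => ∑ J : Fin (k + 1) → ι, (∏ i, a i (J i)) *
      T (fun i => φ i (J i) l) x) atTop (fun x => ∑ J, (∏ i, a i (J i)) * h J x) :=
    tendstoInMeasure_finset_sum _ fun J _ => tendstoInMeasure_const_mul
      ((hv J).2 (fun l i => φ i (J i) l) fun i => hφ i (J i)) _
  refine hlim.congr (fun l => ?_) (coeFn_sum_smul _ _).symm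
  have : T (fun i => ∑ j, a i j • φ i j l) =
      ∑ J : Fin (k + 1) → ι, (∏ i, a i (J i)) • T (fun i => φ i (J i) l) := by
    rw [MultilinearMap.map_sum]
    exact Finset.sum_congr rfl fun J _ => MultilinearMap.map_smul_univ _ _ _
  rw [this]
  exact (coeFn_sum_smul _ _).symm

/-- The kernel representation passes to the limit along mollifications: the left side almost
everywhere along a subsequence, the right side by dominated convergence. -/
theorem IsValue.eq_integral {n m : ℕ} {T : InitialOperator n (m + 1)}
    {K : Rn n → (Fin (m + 1) → Rn n) → ℂ} {ω : ℝ → ℝ} (hω : IsModulus ω)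
    (h0 : Tendsto ω (𝓝[>] 0) (𝓝 0)) (hS : SizeCondition K) (hK : RegularityCondition K ω)
    (hT : KernelRepresentation T K) {f : Fin (m + 1) → Rn n → ℂ}
    {h : Rn n →ₘ[(volume : Measure (Rn n))] ℂ} (hv : IsValue T f h) {c : Rn n} {ρ : ℝ} (hρ : 0 < ρ)
    (hsupp : ∀ i, Function.support (f i) ⊆ Metric.closedBall c ρ) :
    ∀ᵐ x, x ∉ Metric.closedBall c (2 * ρ) → h x = ∫ y, K x y * ∏ i, f i (y i) := by
  choose φ hφ hφs using fun i =>
    MultilinearCZ.exists_boundedlyApproximates (hv.1 i) (hsupp i) (half_pos hρ)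
  obtain ⟨M, R, hM, hb⟩ := exists_common_bounds hφ
  obtain ⟨ns, hns_mono, hns⟩ := (hv.2 (fun l i => φ i l) hφ).exists_seq_tendsto_ae
  have hrep : ∀ᵐ x, ∀ l, x ∉ ⋂ i, tsupport (φ i l) →
      T (fun i => φ i l) x = ∫ y, K x y * ∏ i, φ i l (y i) :=
    ae_all_iff.2 fun l => hT fun i => φ i l
  filter_upwards [hns, hrep] with x hx hxr hxc
  have hxs : ∀ l, x ∉ ⋂ i, tsupport (φ i l) := fun l hmem => hxc
    (Metric.closedBall_subset_closedBall (by linarith) (hφs 0 l (Set.mem_iInter.1 hmem 0)))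
  -- The mollified functions live in the ball of radius `3 ρ / 2`; points outside radius `2 ρ` keep
  -- distance `ρ / 2` from it, away from the singularity.
  have hfar : ∀ y : Rn n, y ∈ Metric.closedBall c (ρ + ρ / 2) → ρ / 2 ≤ ‖x - y‖ := by
    intro y hy
    rw [Metric.mem_closedBall, not_le] at hxc
    rw [Metric.mem_closedBall] at hy
    rw [← dist_eq_norm]
    linarith [dist_triangle x y c]
  let G : (Fin (m + 1) → Rn n) → ℂ := fun y =>
    ∏ i, (Metric.closedBall c (ρ + ρ / 2)).indicator (fun _ => (M : ℂ)) (y i)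
  have hG : Integrable fun y => K x y * G y := by
    refine integrable_kernel_mul hS hK hω h0 (Integrable.fintype_prod fun i => ?_) (half_pos hρ)
      fun y hy => ⟨0, hfar _ ?_⟩
    · exact (integrable_indicator_iff Metric.isClosed_closedBall.measurableSet).2
        (integrableOn_const measure_closedBall_lt_top.ne)
    · have := Finset.prod_ne_zero_iff.1 hy 0 (Finset.mem_univ 0)
      exact Set.mem_of_indicator_ne_zero this
  refine tendsto_nhds_unique hx ?_
  simp only [hxr _ (hxs _)]
  refine tendsto_integral_of_dominated_convergence (fun y => ‖K x y * G y‖) (fun l => ?_) hG.norm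
    (fun l => ?_) ?_
  · refine (integrable_kernel_mul hS hK hω h0 (Integrable.fintype_prod fun i => ?_) (half_pos hρ)
      fun y hy => ⟨0, hfar _ ?_⟩).1
    · exact TestFn.integrable _
    · have := Finset.prod_ne_zero_iff.1 hy 0 (Finset.mem_univ 0)
      exact hφs 0 (ns l) (subset_tsupport _ this)
  · refine Eventually.of_forall fun y => ?_
    rw [norm_mul, norm_mul, norm_prod, norm_prod]
    refine mul_le_mul_of_nonneg_left (Finset.prod_le_prod (fun i _ => norm_nonneg _) fun i _ => ?_)
      (norm_nonneg _)
    by_cases hy : y i ∈ Metric.closedBall c (ρ + ρ / 2)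
    · rw [Set.indicator_of_mem hy, Complex.norm_real, Real.norm_of_nonneg hM]
      exact (hb i (ns l)).1 _
    · rw [image_eq_zero_of_notMem_tsupport fun h => hy (hφs i (ns l) h), norm_zero]
      exact norm_nonneg _
  · have : ∀ᵐ y : Fin (m + 1) → Rn n, ∀ i,
        Tendsto (fun l => φ i (ns l) (y i)) atTop (𝓝 (f i (y i))) := by
      refine ae_all_iff.2 fun i => ?_
      exact (Measure.tendsto_eval_ae_ae (μ := fun _ : Fin (m + 1) => (volume : Measure (Rn n)))
        (i := i)).eventually ((hφ i).2.2.mono fun x hx => hx.comp hns_mono.tendsto_atTop)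
    filter_upwards [this] with y hy
    exact (tendsto_finsetProd _ fun i _ => hy i).const_mul _

/-! ### Non-degeneracy on a pair of balls -/

theorem RegularityCondition.norm_sub_le_of_update {n m : ℕ} {K : Rn n → (Fin m → Rn n) → ℂ}
    {ω : ℝ → ℝ} {C : ℝ} (hC : 0 < C) (hω : IsModulus ω)
    (hreg : ∀ (x : Rn n) (y : Fin m → Rn n) (h : Rn n), (∃ i, y i ≠ x) →
      (∃ j, ‖h‖ ≤ ‖x - y j‖ / 2) →
      ‖K (x + h) y - K x y‖ + ∑ i, ‖K x (Function.update y i (y i + h)) - K x y‖ ≤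
        C / (∑ i, ‖x - y i‖) ^ (m * n) * ω (‖h‖ / ∑ i, ‖x - y i‖))
    {x : Rn n} {y : Fin m → Rn n} {h : Rn n} {d t : ℝ} (hd : 0 < d) (ht : t < 1) (j : Fin m)
    (hj : d ≤ ‖x - y j‖) (hh : 2 * ‖h‖ ≤ d) (hht : ‖h‖ ≤ t * d) :
    ‖K (x + h) y - K x y‖ ≤ C / d ^ (m * n) * ω t ∧
      ∀ i, ‖K x (Function.update y i (y i + h)) - K x y‖ ≤ C / d ^ (m * n) * ω t := by
  have hsum : d ≤ ∑ i, ‖x - y i‖ := hj.trans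
    (Finset.single_le_sum (f := fun i => ‖x - y i‖) (fun i _ => norm_nonneg _) (Finset.mem_univ j))
  have hS : 0 < ∑ i, ‖x - y i‖ := hd.trans_le hsum
  have hle : ‖h‖ / ∑ i, ‖x - y i‖ ≤ t := by
    have ht0 : 0 ≤ t := nonneg_of_mul_nonneg_left ((norm_nonneg h).trans hht) hd
    rw [div_le_iff₀ hS]
    exact hht.trans (mul_le_mul_of_nonneg_left hsum ht0)
  have hmem : ‖h‖ / ∑ i, ‖x - y i‖ ∈ Set.Ico (0 : ℝ) 1 :=
    Set.mem_Ico.2 ⟨div_nonneg (norm_nonneg _) hS.le, hle.trans_lt ht⟩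
  have hmon : ω (‖h‖ / ∑ i, ‖x - y i‖) ≤ ω t :=
    hω.mono hmem (Set.mem_Ico.2 ⟨hmem.1.trans hle, ht⟩) hle
  have h1 := hreg x y h ⟨j, fun hjx => by
    rw [hjx, sub_self, norm_zero] at hj; linarith⟩ ⟨j, by linarith⟩
  have h2 : C / (∑ i, ‖x - y i‖) ^ (m * n) * ω (‖h‖ / ∑ i, ‖x - y i‖) ≤ C / d ^ (m * n) * ω t := by
    refine mul_le_mul ?_ hmon (hω.nonneg _ hmem) (by positivity)
    gcongr
  refine ⟨?_, fun i => ?_⟩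
  · exact (le_add_of_nonneg_right (Finset.sum_nonneg fun i _ => norm_nonneg _)).trans (h1.trans h2)
  · have h3 := Finset.single_le_sum
      (f := fun i => ‖K x (Function.update y i (y i + h)) - K x y‖)
      (fun i _ => norm_nonneg _) (Finset.mem_univ i)
    exact (h3.trans (le_add_of_nonneg_left (norm_nonneg _))).trans (h1.trans h2)

/-- Non-degeneracy at scale `A₀ * ρ` yields `x₀` with a large kernel value `z` at `(x₀, c, …, c)`.
If `A₀` is large, moving all variables by at most `ρ` is a relatively tiny perturbation, and
vanishing of `ω` at `0` keeps the kernel close to `z`. -/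
theorem NondegenerateKernel.exists_comparable {n m : ℕ} (hn : 0 < n) (hm : 0 < m)
    {K : Rn n → (Fin m → Rn n) → ℂ}
    {ω : ℝ → ℝ} (hND : NondegenerateKernel K) (hS : SizeCondition K) (hK : RegularityCondition K ω)
    (hω : IsModulus ω) (h0 : Tendsto ω (𝓝[>] 0) (𝓝 0)) :
    ∃ A κ : ℝ, 1 ≤ A ∧ 0 < κ ∧ ∀ (c : Rn n) (ρ : ℝ), 0 < ρ → ∃ (x₀ : Rn n) (z : ℂ),
      Metric.closedBall x₀ ρ ⊆ Metric.closedBall c (A * ρ) ∧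
      (∀ x ∈ Metric.closedBall x₀ ρ, x ∉ Metric.closedBall c (2 * ρ)) ∧
      κ / ρ ^ (m * n) ≤ ‖z‖ ∧ ∀ x ∈ Metric.closedBall x₀ ρ, ∀ y : Fin m → Rn n,
        (∀ i, y i ∈ Metric.closedBall c ρ) → ‖K x y - z‖ ≤ ‖z‖ / 2 := by
  obtain ⟨c₀, hc₀, hnd⟩ := hND
  obtain ⟨C₁, hC₁, hsize⟩ := hS
  obtain ⟨C, hC, hreg⟩ := hK
  have hmn : m * n ≠ 0 := (Nat.mul_pos hm hn).ne'
  -- The `m + 1` perturbations, one of `x` and one of each `y i`, must together cost at most half of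
  -- the non-degeneracy bound. The factor `2 ^ (m * n)` allows the distance to the diagonal to
  -- halve.
  obtain ⟨t, ht0, ht, htω⟩ : ∃ t : ℝ, 0 < t ∧ t < 1 / 2 ∧
      (m + 1) * (C * 2 ^ (m * n) * ω t) ≤ 1 / (2 * c₀) := by
    have h1 : Tendsto (fun t => (m + 1) * (C * 2 ^ (m * n) * ω t)) (𝓝[>] 0)
        (𝓝 ((m + 1) * (C * 2 ^ (m * n) * 0))) := (h0.const_mul _).const_mul _
    rw [mul_zero, mul_zero] at h1
    obtain ⟨t, h2, h3⟩ := ((h1.eventually (ge_mem_nhds (by positivity : 0 < 1 / (2 * c₀)))).and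
      (Ioo_mem_nhdsGT (by norm_num : (0 : ℝ) < 1 / 2))).exists
    exact ⟨t, h3.1, h3.2, h2⟩
  set A₀ : ℝ := 2 / t with hA₀
  have hA₀4 : 4 ≤ A₀ := by
    rw [hA₀, le_div_iff₀ ht0]; linarith
  set Q : ℝ := max 1 (C₁ * c₀)
  have hQ : 1 ≤ Q := le_max_left _ _
  have htI : t ∈ Set.Ico (0 : ℝ) 1 := ⟨ht0.le, by linarith⟩
  refine ⟨Q * A₀ + 1, 1 / (c₀ * A₀ ^ (m * n)), by nlinarith, by positivity, ?_⟩
  intro c ρ hρ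
  have hAρ : 0 < A₀ * ρ := by positivity
  obtain ⟨x₀, hx₀, hz⟩ := hnd c (A₀ * ρ) hAρ
  rw [Metric.mem_ball, not_lt, dist_eq_norm] at hx₀
  set D : ℝ := ‖x₀ - c‖ with hD
  have hD0 : 0 < D := hAρ.trans_le hx₀
  have hρD : 4 * ρ ≤ D := le_trans (by nlinarith) hx₀
  have hne : ∃ _i : Fin m, c ≠ x₀ := ⟨⟨0, hm⟩, fun h => by
    rw [hD, h, sub_self, norm_zero] at hD0; exact lt_irrefl _ hD0⟩
  -- Non-degeneracy only bounds the distance of `x₀` from below; the size condition bounds it from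
  -- above, since the kernel is too small far away.
  have hDle : D ≤ Q * (A₀ * ρ) := by
    have h1 := hz.trans (hsize x₀ (fun _ => c) hne)
    have h2 : D ≤ ∑ _i : Fin m, ‖x₀ - c‖ :=
      Finset.single_le_sum (f := fun _ : Fin m => ‖x₀ - c‖) (fun i _ => norm_nonneg _)
        (Finset.mem_univ ⟨0, hm⟩)
    have h3 : C₁ / (∑ _i : Fin m, ‖x₀ - c‖) ^ (m * n) ≤ C₁ / D ^ (m * n) := by gcongr
    have h4 := h1.trans h3
    rw [div_le_div_iff₀ (by positivity) (by positivity), one_mul] at h4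
    have h5 : D ^ (m * n) ≤ (Q * (A₀ * ρ)) ^ (m * n) := by
      calc D ^ (m * n) ≤ (C₁ * c₀) * (A₀ * ρ) ^ (m * n) := by linarith
        _ ≤ Q ^ (m * n) * (A₀ * ρ) ^ (m * n) := by
          gcongr
          exact (le_max_right _ _).trans (le_self_pow₀ hQ hmn)
        _ = _ := (mul_pow _ _ _).symm
    exact le_of_pow_le_pow_left₀ hmn (by positivity) h5
  have hzκ : 1 / (c₀ * A₀ ^ (m * n)) / ρ ^ (m * n) ≤ ‖K x₀ fun _ => c‖ := by
    rw [div_div, mul_assoc, ← mul_pow]; exact hz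
  refine ⟨x₀, K x₀ fun _ => c, ?_, ?_, hzκ, ?_⟩
  · refine Metric.closedBall_subset_closedBall' ?_
    rw [dist_eq_norm]; linarith
  · intro x hx hxc
    rw [Metric.mem_closedBall] at hx hxc
    have := dist_triangle_left x₀ c x
    rw [dist_eq_norm x₀ c] at this
    linarith
  intro x hx y hy
  set B : ℝ := C * 2 ^ (m * n) / D ^ (m * n) * ω t with hB
  have hωt : 0 ≤ ω t := hω.nonneg _ htI
  have hfar : ∀ u : Rn n, u ∈ Metric.closedBall c ρ → D / 2 ≤ ‖x - u‖ := by
    intro u hu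
    rw [Metric.mem_closedBall] at hx hu
    have h1 := dist_triangle4 x₀ x u c
    rw [dist_comm x₀ x, dist_eq_norm x₀ c, dist_eq_norm x u] at h1
    linarith
  have hρt : ρ ≤ t * (D / 2) := by
    have : t * (A₀ * ρ) ≤ t * D := mul_le_mul_of_nonneg_left hx₀ ht0.le
    have h2 : t * (A₀ * ρ) = 2 * ρ := by rw [hA₀]; field_simp
    linarith
  have hhalf : C / (D / 2) ^ (m * n) * ω t = B := by
    rw [hB, div_pow]; field_simp
  have hstep : ∀ s : Finset (Fin m),
      ‖K x (s.piecewise y fun _ => c) - K x₀ fun _ => c‖ ≤ (s.card + 1) * B := by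
    intro s
    induction s using Finset.induction_on with
    | empty =>
      have hxn : ‖x - x₀‖ ≤ ρ := by rwa [← dist_eq_norm]
      have h1 := (RegularityCondition.norm_sub_le_of_update hC hω hreg (x := x₀) (y := fun _ => c)
        (h := x - x₀) (d := D / 2) (t := t) (by positivity) htI.2 ⟨0, hm⟩ (by
          linarith) (by linarith) (hxn.trans hρt)).1
      rw [add_sub_cancel, hhalf] at h1
      simpa using h1
    | insert a s ha ih =>
      have hyn : ‖y a - c‖ ≤ ρ := by rw [← dist_eq_norm]; exact hy a
      have hmem : (s.piecewise y fun _ => c) a = c := Finset.piecewise_eq_of_notMem _ _ _ ha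
      have h1 := (RegularityCondition.norm_sub_le_of_update hC hω hreg (x := x)
        (y := s.piecewise y fun _ => c)
        (h := y a - c) (d := D / 2) (t := t) (by positivity) htI.2 a (by
          rw [hmem]
          exact hfar c (Metric.mem_closedBall_self hρ.le)) (by linarith) (hyn.trans hρt)).2 a
      rw [hmem, add_sub_cancel, hhalf] at h1
      rw [Finset.piecewise_insert, Finset.card_insert_of_notMem ha]
      refine (norm_sub_le_norm_sub_add_norm_sub _ (K x (s.piecewise y fun _ => c)) _).trans ?_
      push_cast
      linarith
  have h1 := hstep Finset.univ
  rw [Finset.piecewise_univ, Finset.card_univ, Fintype.card_fin] at h1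
  refine h1.trans (le_trans ?_ (div_le_div_of_nonneg_right hz two_pos.le))
  have h2 : (m + 1) * B = (m + 1) * (C * 2 ^ (m * n) * ω t) / D ^ (m * n) := by
    rw [hB]; ring
  rw [h2]
  calc (m + 1) * (C * 2 ^ (m * n) * ω t) / D ^ (m * n) ≤ 1 / (2 * c₀) / (A₀ * ρ) ^ (m * n) := by
        gcongr
    _ = _ := by field_simp

/-! ### Medians and one-sided truncations -/

/-- The median is the infimum of the points whose left half-line has at least half of the mass; both
inequalities pass to it by continuity of the measure from above. -/
theorem exists_median {μ : Measure ℝ} [IsFiniteMeasure μ] (hμ : μ ≠ 0) :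
    ∃ α : ℝ, μ Set.univ / 2 ≤ μ (Set.Iic α) ∧ μ Set.univ / 2 ≤ μ (Set.Ici α) := by
  have hV : 0 < μ Set.univ := Measure.measure_univ_pos.2 hμ
  have hlt : μ Set.univ / 2 < μ Set.univ := ENNReal.half_lt_self hV.ne' (measure_ne_top _ _)
  let S : Set ℝ := {a | μ Set.univ / 2 ≤ μ (Set.Iic a)}
  have hne : S.Nonempty := by
    obtain ⟨a, ha⟩ := ((tendsto_measure_Iic_atTop μ).eventually (lt_mem_nhds hlt)).exists
    exact ⟨a, ha.le⟩
  have hbdd : BddBelow S := by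
    obtain ⟨a, ha⟩ := ((tendsto_measure_Ici_atBot μ).eventually (lt_mem_nhds hlt)).exists
    refine ⟨a, fun s hs => ?_⟩
    by_contra h
    have hd : Disjoint (Set.Iic s) (Set.Ici a) :=
      Set.disjoint_left.2 fun x hx hx' => h (le_trans hx' hx)
    have h1 := measure_union (μ := μ) hd measurableSet_Ici
    have h2 : μ Set.univ < μ (Set.Iic s ∪ Set.Ici a) := by
      rw [h1]
      calc μ Set.univ = μ Set.univ / 2 + μ Set.univ / 2 := (ENNReal.add_halves _).symm
        _ < μ (Set.Iic s) + μ (Set.Ici a) :=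
          ENNReal.add_lt_add_of_le_of_lt (hlt.trans_le le_top).ne hs ha
    exact absurd (measure_mono (Set.subset_univ _)) (not_le.2 h2)
  refine ⟨sInf S, ?_, ?_⟩
  · have h1 := tendsto_measure_biInter_gt (μ := μ) (s := fun a : ℝ => Set.Iic a) (a := sInf S)
      (fun r _ => measurableSet_Iic.nullMeasurableSet) (fun i j _ hij => Set.Iic_subset_Iic.2 hij)
      ⟨sInf S + 1, by simp, measure_ne_top _ _⟩
    have h2 : ⋂ r > sInf S, Set.Iic r = Set.Iic (sInf S) := by
      ext x
      simp only [Set.mem_iInter, Set.mem_Iic]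
      exact ⟨fun h => le_of_forall_gt_imp_ge_of_dense h, fun h r hr => h.trans (le_of_lt hr)⟩
    rw [h2] at h1
    refine ge_of_tendsto h1 ?_
    filter_upwards [self_mem_nhdsWithin] with a ha
    obtain ⟨s, hs, hsa⟩ := exists_lt_of_csInf_lt hne ha
    exact hs.trans (measure_mono (Set.Iic_subset_Iic.2 hsa.le))
  -- Reflecting the parameter turns the approach to the infimum from below into a limit from the
  -- right; below the infimum the left half-line has less than half of the mass.
  · have h1 := tendsto_measure_biInter_gt (μ := μ) (s := fun a : ℝ => Set.Ioi (-a)) (a := -sInf S)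
      (fun r _ => measurableSet_Ioi.nullMeasurableSet)
      (fun i j _ hij => Set.Ioi_subset_Ioi (neg_le_neg hij))
      ⟨-sInf S + 1, by simp, measure_ne_top _ _⟩
    have h2 : ⋂ r > -sInf S, Set.Ioi (-r) = Set.Ici (sInf S) := by
      ext x
      simp only [Set.mem_iInter, Set.mem_Ioi, Set.mem_Ici]
      refine ⟨fun h => le_of_forall_lt_imp_le_of_dense fun a ha => ?_, fun h r hr => ?_⟩
      · simpa using (h (-a) (neg_lt_neg ha)).le
      · exact lt_of_lt_of_le (neg_lt.1 hr) h
    rw [h2] at h1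
    refine ge_of_tendsto h1 ?_
    filter_upwards [self_mem_nhdsWithin] with a ha
    have h2 : μ (Set.Iic (-a)) < μ Set.univ / 2 :=
      not_le.1 fun h => absurd (csInf_le hbdd h) (not_le.2 (neg_lt.1 ha))
    rw [Function.comp_apply, ← Set.compl_Iic, measure_compl measurableSet_Iic (measure_ne_top _ _)]
    refine ENNReal.le_sub_of_add_le_left (measure_ne_top _ _) ?_
    calc μ (Set.Iic (-a)) + μ Set.univ / 2 ≤ μ Set.univ / 2 + μ Set.univ / 2 := by gcongr
      _ = _ := ENNReal.add_halves _

theorem exists_median_on {X : Type*} [MeasurableSpace X] {μ : Measure X} {b : X → ℝ}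
    (hb : Measurable b) {B : Set X} (hB0 : μ B ≠ 0) (hB : μ B ≠ ∞) :
    ∃ α : ℝ, ∀ σ : ℝ, σ = 1 ∨ σ = -1 →
      μ.real B / 2 ≤ μ.real (B ∩ {x | σ * (b x - α) ≤ 0}) := by
  let ν : Measure ℝ := (μ.restrict B).map b
  have : IsFiniteMeasure (μ.restrict B) := ⟨by simpa using hB.lt_top⟩
  have hν : ν Set.univ = μ B := by
    simp [ν, Measure.map_apply hb MeasurableSet.univ]
  have hν0 : ν ≠ 0 := fun h => hB0 (by rw [← hν, h]; rfl)
  obtain ⟨α, h1, h2⟩ := exists_median hν0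
  refine ⟨α, fun σ hσ => ?_⟩
  have key : ∀ S : Set ℝ, MeasurableSet S → ν Set.univ / 2 ≤ ν S →
      μ.real B / 2 ≤ μ.real (B ∩ b ⁻¹' S) := by
    intro S hS h
    rw [hν, Measure.map_apply hb hS, Measure.restrict_apply (hb hS), Set.inter_comm] at h
    have := ENNReal.toReal_mono (ne_top_of_le_ne_top hB (measure_mono Set.inter_subset_left)) h
    simpa [measureReal_def] using this
  rcases hσ with rfl | rfl
  · have := key _ measurableSet_Iic h1
    convert this using 3
    ext x; simp
  · have := key _ measurableSet_Ici h2
    convert this using 3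
    ext x; simp

theorem measurableSet_sign_truncation {X : Type*} [MeasurableSpace X] {b : X → ℝ}
    (hb : Measurable b) (σ α N : ℝ) :
    MeasurableSet {x | 0 ≤ σ * (b x - α) ∧ σ * (b x - α) ≤ N} := by
  have h1 : MeasurableSet {x | 0 ≤ σ * (b x - α)} :=
    measurableSet_le measurable_const (by fun_prop)
  have h2 : MeasurableSet {x | σ * (b x - α) ≤ N} :=
    measurableSet_le (by fun_prop) measurable_const
  exact h1.inter h2

/-- One of the positive and negative parts carries half of the integral of `|b - α|`, and by
monotone convergence a truncation at a high level loses at most half of that. -/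
theorem exists_sign_truncation {X : Type*} [MeasurableSpace X] {μ : Measure X} {b : X → ℝ}
    (hb : Measurable b) {B : Set X} (hB : MeasurableSet B) {α : ℝ}
    (hint : IntegrableOn (fun x => b x - α) B μ) :
    ∃ (σ : ℝ) (N : ℕ), (σ = 1 ∨ σ = -1) ∧
      (∫ x in B, |b x - α| ∂μ) / 4 ≤
        ∫ x in B ∩ {x | 0 ≤ σ * (b x - α) ∧ σ * (b x - α) ≤ N}, σ * (b x - α) ∂μ := by
  have hpos : ∀ σ : ℝ, IntegrableOn (fun x => max (σ * (b x - α)) 0) B μ := fun σ =>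
    (hint.const_mul σ).pos_part
  obtain ⟨σ, hσ, hσ2⟩ : ∃ σ : ℝ, (σ = 1 ∨ σ = -1) ∧
      (∫ x in B, |b x - α| ∂μ) / 2 ≤ ∫ x in B, max (σ * (b x - α)) 0 ∂μ := by
    have hsum : ∫ x in B, |b x - α| ∂μ = (∫ x in B, max (1 * (b x - α)) 0 ∂μ) +
        ∫ x in B, max (-1 * (b x - α)) 0 ∂μ := by
      rw [← integral_add (hpos 1) (hpos (-1))]
      refine integral_congr_ae (Eventually.of_forall fun x => ?_)
      rcases le_total 0 (b x - α) with h | h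
      · simp only [abs_of_nonneg h, one_mul, neg_one_mul, max_eq_left h,
          max_eq_right (neg_nonpos.2 h), add_zero]
      · simp only [abs_of_nonpos h, one_mul, neg_one_mul, max_eq_right h,
          max_eq_left (neg_nonneg.2 h), zero_add]
    by_cases h : (∫ x in B, |b x - α| ∂μ) / 2 ≤ ∫ x in B, max (1 * (b x - α)) 0 ∂μ
    · exact ⟨1, Or.inl rfl, h⟩
    · exact ⟨-1, Or.inr rfl, by linarith⟩
  let S : ℕ → Set X := fun N => B ∩ {x | max (σ * (b x - α)) 0 ≤ N}
  have hS : ∀ N, MeasurableSet (S N) := fun N =>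
    hB.inter (measurableSet_le (by fun_prop) measurable_const)
  have hU : ⋃ N, S N = B := by
    rw [← Set.inter_iUnion, Set.inter_eq_left]
    intro x _
    obtain ⟨N, hN⟩ := exists_nat_ge (max (σ * (b x - α)) 0)
    exact Set.mem_iUnion.2 ⟨N, hN⟩
  have hmono : Monotone S := fun N N' h => Set.inter_subset_inter_right _ fun x hx =>
    le_trans (show _ ≤ (N : ℝ) from hx) (by exact_mod_cast h)
  have hlim := tendsto_setIntegral_of_monotone hS hmono (by rw [hU]; exact hpos σ)
  rw [hU] at hlim
  have heq : ∀ N : ℕ, ∫ x in S N, max (σ * (b x - α)) 0 ∂μ =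
      ∫ x in B ∩ {x | 0 ≤ σ * (b x - α) ∧ σ * (b x - α) ≤ N}, σ * (b x - α) ∂μ := by
    intro N
    have hE : MeasurableSet (B ∩ {x | 0 ≤ σ * (b x - α) ∧ σ * (b x - α) ≤ N}) :=
      hB.inter (measurableSet_sign_truncation hb σ α N)
    rw [← integral_indicator (hS N), ← integral_indicator hE]
    refine integral_congr_ae (Eventually.of_forall fun x => ?_)
    by_cases hx : x ∈ B
    · rcases le_total 0 (σ * (b x - α)) with h | h
      · simp [Set.indicator, S, hx, h]
      · rcases h.lt_or_eq with h' | h'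
        · simp [Set.indicator, h, not_le.2 h']
        · simp [Set.indicator, h']
    · simp [Set.indicator, S, hx]
  simp only [heq] at hlim
  have h0 : 0 ≤ ∫ x in B, |b x - α| ∂μ := integral_nonneg fun _ => abs_nonneg _
  rcases h0.eq_or_lt with h | h
  · refine ⟨σ, 0, hσ, ?_⟩
    rw [← h, zero_div, ← heq]
    exact integral_nonneg fun x => le_max_right _ _
  · obtain ⟨N, hN⟩ := (hlim.eventually (lt_mem_nhds (lt_of_lt_of_le
      (by linarith : (∫ x in B, |b x - α| ∂μ) / 4 < _) hσ2))).exists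
    exact ⟨σ, N, hσ, hN.le⟩

/-! ### Lower bound for the commutator on one ball -/

theorem half_norm_le_re_mul {z w : ℂ} (h : ‖w - z‖ ≤ ‖z‖ / 2) :
    ‖z‖ / 2 ≤ ((starRingEnd ℂ) z / ‖z‖ * w).re := by
  rcases eq_or_ne z 0 with rfl | hz
  · simp
  have hz' : (‖z‖ : ℂ) ≠ 0 := by simpa using hz
  have h1 : (starRingEnd ℂ) z / ‖z‖ * w = ‖z‖ + (starRingEnd ℂ) z / ‖z‖ * (w - z) := by
    have : (starRingEnd ℂ) z * z = ‖z‖ ^ 2 := Complex.conj_mul' z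
    field_simp
    linear_combination this
  have h2 : ‖(starRingEnd ℂ) z / ‖z‖ * (w - z)‖ ≤ ‖z‖ / 2 := by
    rw [norm_mul, norm_div, RCLike.norm_conj, Complex.norm_real, norm_norm,
      div_self (norm_ne_zero_iff.2 hz), one_mul]
    exact h
  have h3 := (abs_le.1 ((Complex.abs_re_le_norm _).trans h2)).1
  rw [h1, Complex.add_re, Complex.ofReal_re]
  linarith

theorem memLinftyC_indicator {n : ℕ} {E : Set (Rn n)} (hE : MeasurableSet E) {c : Rn n} {ρ : ℝ}
    (hsub : E ⊆ Metric.closedBall c ρ) {u : Rn n → ℂ} (hu : AEStronglyMeasurable u volume) {N : ℝ}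
    (hN : ∀ᵐ x, x ∈ E → ‖u x‖ ≤ N) : MemLinftyC (E.indicator u) := by
  refine ⟨memLp_top_of_bound (hu.indicator hE) (max N 0) ?_, ?_⟩
  · filter_upwards [hN] with x hx
    by_cases h : x ∈ E
    · rw [Set.indicator_of_mem h]; exact (hx h).trans (le_max_left _ _)
    · rw [Set.indicator_of_notMem h, norm_zero]; exact le_max_right _ _
  · exact HasCompactSupport.of_support_subset_isCompact (isCompact_closedBall c ρ)
      (Set.support_indicator_subset.trans hsub)

/-- The tuple of indicator functions of the sets `E 0, …, E k`. -/
noncomputable def indicatorTuple {n k : ℕ} (E : Fin (k + 1) → Set (Rn n)) :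
    Fin (k + 1) → Rn n → ℂ := fun i => (E i).indicator fun _ => 1

/-- The integrand of the commutator contains `b x - b (y 0)`. The sign conditions give `σ (b (y 0) -
b x) ≥ σ (b (y 0) - α) ≥ 0`, and after rotation by the phase of `z` the kernel has real part at
least `‖z‖ / 2`; the inequality then holds pointwise. -/
theorem le_re_integral_kernel {n k : ℕ} {K : Rn n → (Fin (k + 1) → Rn n) → ℂ} {x : Rn n} {z : ℂ}
    {b : Rn n → ℝ} {E : Fin (k + 1) → Set (Rn n)} (hE : ∀ i, MeasurableSet (E i))
    (hEv : ∀ i, volume (E i) ≠ ∞)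
    (hK : ∀ y, (∀ i, y i ∈ E i) → ‖K x y - z‖ ≤ ‖z‖ / 2) {σ α : ℝ}
    (hx : σ * (b x - α) ≤ 0) (hbE : ∀ y ∈ E 0, 0 ≤ σ * (b y - α))
    (hbi : IntegrableOn (fun y => σ * (b y - α)) (E 0))
    (hi : Integrable fun y => K x y * ∏ i, indicatorTuple E i (y i))
    (hi' : Integrable fun y => K x y *
      ∏ i, Function.update (indicatorTuple E) 0 (fun u => (b u : ℂ) * indicatorTuple E 0 u) i (y i)) :
    ‖z‖ / 2 * ((∫ y in E 0, σ * (b y - α)) * ∏ i : Fin k, volume.real (E i.succ)) ≤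
      (-σ * (starRingEnd ℂ) z / ‖z‖ * (b x * (∫ y, K x y * ∏ i, indicatorTuple E i (y i)) -
        ∫ y, K x y * ∏ i, Function.update (indicatorTuple E) 0
          (fun u => (b u : ℂ) * indicatorTuple E 0 u) i (y i))).re := by
  have hI : Integrable fun y => -σ * (starRingEnd ℂ) z / ‖z‖ *
      (b x * (K x y * ∏ i, indicatorTuple E i (y i)) - K x y *
        ∏ i, Function.update (indicatorTuple E) 0 (fun u => (b u : ℂ) * indicatorTuple E 0 u) i (y i)) :=
    ((hi.const_mul _).sub hi').const_mul _
  rw [← integral_const_mul, ← integral_sub (hi.const_mul _) hi', ← integral_const_mul,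
    ← RCLike.re_eq_complex_re, ← integral_re hI]
  let W : Fin (k + 1) → Rn n → ℝ := Fin.cons ((E 0).indicator fun y => σ * (b y - α))
    fun i => (E i.succ).indicator fun _ => 1
  have hWi : ∀ i, Integrable (W i) := by
    intro i
    refine Fin.cases ?_ (fun i => ?_) i
    · exact (integrable_indicator_iff (hE 0)).2 hbi
    · exact (integrable_indicator_iff (hE _)).2 (integrableOn_const (hEv _))
  have hWint : (∫ y in E 0, σ * (b y - α)) * ∏ i : Fin k, volume.real (E i.succ) =
      ∫ y : Fin (k + 1) → Rn n, ∏ i, W i (y i) := by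
    rw [integral_fintype_prod_volume_eq_prod, Fin.prod_univ_succ]
    congr 1
    · exact (integral_indicator (hE 0)).symm
    · refine Finset.prod_congr rfl fun i _ => ?_
      simp only [W, Fin.cons_succ]
      rw [integral_indicator (hE _), setIntegral_const, smul_eq_mul, mul_one]
  rw [hWint, ← integral_const_mul]
  refine integral_mono ((Integrable.fintype_prod hWi).const_mul _)
    hI.re fun y => ?_
  have hup : ∏ i, Function.update (indicatorTuple E) 0
      (fun u => (b u : ℂ) * indicatorTuple E 0 u) i (y i) =
      b (y 0) * ∏ i, indicatorTuple E i (y i) := by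
    rw [Fin.prod_univ_succ, Fin.prod_univ_succ, Function.update_self, mul_assoc]
    simp
  simp only [hup]
  by_cases hy : ∀ i, y i ∈ E i
  · have h1 : ∏ i, indicatorTuple E i (y i) = 1 :=
      Finset.prod_eq_one fun i _ => Set.indicator_of_mem (hy i) _
    have h2 : ∏ i, W i (y i) = σ * (b (y 0) - α) := by
      rw [Fin.prod_univ_succ]
      simp only [W, Fin.cons_zero, Fin.cons_succ]
      rw [Set.indicator_of_mem (hy 0), Finset.prod_eq_one fun i _ => Set.indicator_of_mem (hy _) _,
        mul_one]
    rw [h1, h2]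
    have h3 := half_norm_le_re_mul (hK y hy)
    have h4 : (-σ * (starRingEnd ℂ) z / ‖z‖ * (b x * (K x y * 1) - K x y * (b (y 0) * 1)) : ℂ) =
        ((σ * (b (y 0) - b x) : ℝ) : ℂ) * ((starRingEnd ℂ) z / ‖z‖ * K x y) := by
      push_cast; ring
    rw [h4, RCLike.re_eq_complex_re, Complex.re_ofReal_mul]
    have h5 : σ * (b (y 0) - α) ≤ σ * (b (y 0) - b x) := by linarith
    rw [mul_comm]
    exact mul_le_mul h5 h3 (by positivity) ((hbE _ (hy 0)).trans h5)
  · push Not at hy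
    obtain ⟨i, hi⟩ := hy
    have h1 : ∏ i, indicatorTuple E i (y i) = 0 :=
      Finset.prod_eq_zero (Finset.mem_univ i) (Set.indicator_of_notMem hi _)
    have h2 : ∏ i, W i (y i) = 0 := by
      refine Finset.prod_eq_zero (Finset.mem_univ i) ?_
      revert hi
      refine Fin.cases (fun hi => ?_) (fun i hi => ?_) i
      · exact Set.indicator_of_notMem (s := E 0) (f := fun y => σ * (b y - α)) hi
      · exact Set.indicator_of_notMem (s := E i.succ) (f := fun _ => (1 : ℝ)) hi
    rw [h1, h2]
    simp

theorem ae_pi_of_ae {n m : ℕ} {P : Rn n → Prop} (h : ∀ᵐ x, P x) (i : Fin m) :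
    ∀ᵐ y : Fin m → Rn n, P (y i) :=
  (Measure.tendsto_eval_ae_ae (μ := fun _ : Fin m => (volume : Measure (Rn n))) (i := i)).eventually h

theorem integrable_kernel_prod {n k : ℕ} {K : Rn n → (Fin (k + 1) → Rn n) → ℂ} {ω : ℝ → ℝ}
    (hS : SizeCondition K) (hK : RegularityCondition K ω) (hω : IsModulus ω)
    (h0 : Tendsto ω (𝓝[>] 0) (𝓝 0)) {f : Fin (k + 1) → Rn n → ℂ} (hf : ∀ i, Integrable (f i))
    {c : Rn n} {ρ : ℝ} (hρ : 0 < ρ) (hsupp : Function.support (f 0) ⊆ Metric.closedBall c ρ)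
    {x : Rn n} (hx : x ∉ Metric.closedBall c (2 * ρ)) :
    Integrable fun y => K x y * ∏ i, f i (y i) := by
  refine integrable_kernel_mul hS hK hω h0 (Integrable.fintype_prod hf) hρ fun y hy => ⟨0, ?_⟩
  have h1 := hsupp (Finset.prod_ne_zero_iff.1 hy 0 (Finset.mem_univ 0))
  rw [Metric.mem_closedBall] at h1 hx
  rw [← dist_eq_norm]
  linarith [dist_triangle x (y 0) c]

/-- `le_re_integral_kernel` integrated over `F`. The output keeps the phase `θ` and the plain
integral over `F`, not an absolute value, so that the bounds for different balls can be added inside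
one linear pairing. -/
theorem exists_local_lower_bound {n k : ℕ} (hn : 0 < n) {T : InitialOperator n (k + 1)}
    (hT : IsNondegenerateCZO T) {b : Rn n → ℝ} (hb : LocallyIntegrable b volume) :
    ∃ A κ : ℝ, 1 ≤ A ∧ 0 < κ ∧ ∀ (c : Rn n) (ρ : ℝ), 0 < ρ →
      ∃ (α : ℝ) (E : Fin (k + 1) → Set (Rn n)) (F : Set (Rn n)) (θ : ℂ),
        (∀ i, MeasurableSet (E i)) ∧ MeasurableSet F ∧ (∀ i, E i ⊆ Metric.closedBall c ρ) ∧
        F ⊆ Metric.closedBall c (A * ρ) ∧ ‖θ‖ ≤ 1 ∧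
        MemLinftyC (fun x => (b x : ℂ) * indicatorTuple E 0 x) ∧
        ∀ g, IsCommutatorValue b T 0 (indicatorTuple E) g → IntegrableOn g F →
          κ * ∫ x in Metric.closedBall c ρ, |b x - α| ≤ (θ * ∫ x in F, g x).re := by
  obtain ⟨-, K, ω, hω, h0, hS, hK, hrep, hND⟩ := hT
  obtain ⟨A, κ, hA, hκ, hcomp⟩ := hND.exists_comparable hn k.succ_pos hS hK hω h0
  set v : ℝ := volume.real (Metric.closedBall (0 : Rn n) 1) with hv
  have hv0 : 0 < v := volume_real_closedBall_pos _ one_pos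
  -- The `16` is `2 * 2 * 4`: half of the far ball, half of `‖z‖`, and a quarter of the oscillation
  -- left by `exists_sign_truncation`.
  refine ⟨A, κ * v ^ (k + 1) / 16, hA, by positivity, fun c ρ hρ => ?_⟩
  obtain ⟨x₀, z, hx₀A, hx₀d, hz, hKz⟩ := hcomp c ρ hρ
  let B := Metric.closedBall c ρ
  have hBm : MeasurableSet B := Metric.isClosed_closedBall.measurableSet
  have hB'm : MeasurableSet (Metric.closedBall x₀ ρ) := Metric.isClosed_closedBall.measurableSet
  have hV : ∀ x : Rn n, volume.real (Metric.closedBall x ρ) = v * ρ ^ n := by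
    intro x
    have h1 := volume_real_closedBall_mul x hρ.le zero_le_one
    rw [mul_one] at h1
    rw [h1, hv, measureReal_def, measureReal_def, Measure.addHaar_closedBall_center, mul_comm]
  have hbs : AEStronglyMeasurable b volume := hb.aestronglyMeasurable
  let b' : Rn n → ℝ := hbs.mk b
  have hb'm : Measurable b' := hbs.stronglyMeasurable_mk.measurable
  have hbb' : b =ᵐ[volume] b' := hbs.ae_eq_mk
  -- The median is taken over the far ball, where it serves both signs; the sign may thus be chosen
  -- afterwards from the behaviour of `b` on the original ball.
  obtain ⟨α, hα⟩ := exists_median_on hb'm (B := Metric.closedBall x₀ ρ)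
    (Metric.measure_closedBall_pos volume x₀ hρ).ne' measure_closedBall_lt_top.ne
  have hbB : IntegrableOn b' B :=
    (hb.integrableOn_isCompact (isCompact_closedBall c ρ)).congr (ae_restrict_of_ae hbb')
  have hbα : IntegrableOn (fun x => b' x - α) B :=
    hbB.sub (integrableOn_const measure_closedBall_lt_top.ne)
  obtain ⟨σ, N, hσ, hN⟩ := exists_sign_truncation hb'm hBm hbα
  let E₀ : Set (Rn n) := B ∩ {x | 0 ≤ σ * (b' x - α) ∧ σ * (b' x - α) ≤ N}
  have hE₀ : MeasurableSet E₀ := hBm.inter (measurableSet_sign_truncation hb'm σ α N)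
  let E : Fin (k + 1) → Set (Rn n) := Fin.cons E₀ fun _ => B
  have hE : ∀ i, MeasurableSet (E i) := fun i => Fin.cases hE₀ (fun _ => hBm) i
  have hEB : ∀ i, E i ⊆ B := fun i =>
    Fin.cases (motive := fun i => E i ⊆ B) Set.inter_subset_left (fun _ => subset_rfl) i
  let F : Set (Rn n) := Metric.closedBall x₀ ρ ∩ {x | σ * (b' x - α) ≤ 0}
  have hF : MeasurableSet F := hB'm.inter (measurableSet_le (by fun_prop) measurable_const)
  have hEv : ∀ i, volume (E i) ≠ ∞ := fun i =>
    ne_top_of_le_ne_top measure_closedBall_lt_top.ne (measure_mono (hEB i))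
  have hσ1 : |σ| = 1 := by rcases hσ with rfl | rfl <;> simp
  have hbu : MemLinftyC (fun x => (b x : ℂ) * indicatorTuple E 0 x) := by
    have h1 : (fun x => (b x : ℂ) * indicatorTuple E 0 x) = (E 0).indicator fun x => (b x : ℂ) := by
      ext x
      by_cases hx : x ∈ E 0 <;> simp [indicatorTuple, hx]
    rw [h1]
    refine memLinftyC_indicator (hE 0) (hEB 0) (N := N + |α|)
      (Complex.continuous_ofReal.comp_aestronglyMeasurable hbs) ?_
    filter_upwards [hbb'] with x hx hxE
    have h2 : |b' x - α| ≤ N := by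
      rw [← one_mul |b' x - α|, ← hσ1, ← abs_mul, abs_of_nonneg hxE.2.1]
      exact hxE.2.2
    rw [Complex.norm_real, hx, Real.norm_eq_abs]
    have := abs_add_le (b' x - α) α
    rw [sub_add_cancel] at this
    linarith
  refine ⟨α, E, F, -σ * (starRingEnd ℂ) z / ‖z‖, hE, hF, hEB,
    Set.inter_subset_left.trans hx₀A, ?_, hbu, ?_⟩
  · rw [norm_div, norm_mul, norm_neg, RCLike.norm_conj, Complex.norm_real, Complex.norm_real,
      norm_norm, Real.norm_eq_abs, hσ1, one_mul]
    exact div_self_le_one _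
  rintro g ⟨h₀, h₁, hv₀, hv₁, hg⟩ hgF
  have hsupp₀ : ∀ i, Function.support (indicatorTuple E i) ⊆ Metric.closedBall c ρ := fun i =>
    Set.support_indicator_subset.trans (hEB i)
  have hsupp₁ : ∀ i, Function.support (Function.update (indicatorTuple E) 0
      (fun x => (b x : ℂ) * indicatorTuple E 0 x) i) ⊆ Metric.closedBall c ρ := by
    intro i
    by_cases hi : i = 0
    · subst hi
      rw [Function.update_self]
      exact (Function.support_mul_subset_right _ _).trans (hsupp₀ 0)
    · rw [Function.update_of_ne hi]; exact hsupp₀ i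
  have hmain : ∀ᵐ x, x ∈ F → ‖z‖ / 2 * ((∫ y in E 0, σ * (b' y - α)) * (v * ρ ^ n) ^ k) ≤
      (-σ * (starRingEnd ℂ) z / ‖z‖ * g x).re := by
    filter_upwards [hg, hbb', hv₀.eq_integral hω h0 hS hK hrep hρ hsupp₀,
      hv₁.eq_integral hω h0 hS hK hrep hρ hsupp₁] with x hgx hbx hx₀ hx₁ hxF
    have hxd := hx₀d x hxF.1
    have hi := integrable_kernel_prod hS hK hω h0 (fun i => (hv₀.1 i).integrable) hρ (hsupp₀ 0) hxd
    have hi' := integrable_kernel_prod hS hK hω h0 (fun i => (hv₁.1 i).integrable) hρ (hsupp₁ 0) hxd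
    have hae : (fun y => K x y * ∏ i, Function.update (indicatorTuple E) 0
        (fun u => (b u : ℂ) * indicatorTuple E 0 u) i (y i)) =ᵐ[volume]
        fun y => K x y * ∏ i, Function.update (indicatorTuple E) 0
        (fun u => (b' u : ℂ) * indicatorTuple E 0 u) i (y i) := by
      filter_upwards [ae_pi_of_ae hbb' 0] with y hy
      rw [Fin.prod_univ_succ, Fin.prod_univ_succ]
      simp [hy]
    have h1 := le_re_integral_kernel hE hEv (z := z) (x := x) (K := K) (b := b') (α := α)
      (fun y hy => hKz x hxF.1 y fun i => hEB i (hy i)) hxF.2 (fun y hy => hy.2.1)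
      ((hbα.mono_set (hEB 0)).const_mul σ) hi (hi'.congr hae)
    rw [hgx, hx₀ hxd, hx₁ hxd, integral_congr_ae hae, hbx]
    have h2 : ∏ i : Fin k, volume.real (E i.succ) = (v * ρ ^ n) ^ k := by
      have h3 : ∀ i : Fin k, volume.real (E i.succ) = v * ρ ^ n := fun i => hV c
      simp only [h3, Finset.prod_const, Finset.card_univ, Fintype.card_fin]
    rw [h2] at h1
    exact h1
  set I : ℝ := ∫ x in Metric.closedBall c ρ, |b x - α| with hI
  have hI' : ∫ x in B, |b' x - α| = I :=
    integral_congr_ae (ae_restrict_of_ae (hbb'.mono fun x hx => by simp only [hx]))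
  have hI0 : 0 ≤ I := integral_nonneg fun _ => abs_nonneg _
  rw [hI'] at hN
  have hVF : v * ρ ^ n / 2 ≤ volume.real F := by
    have := hα σ hσ
    rwa [hV] at this
  have hgi : IntegrableOn (fun x => -σ * (starRingEnd ℂ) z / ‖z‖ * g x) F := hgF.const_mul _
  have hre : (-σ * (starRingEnd ℂ) z / ‖z‖ * ∫ x in F, g x).re =
      ∫ x in F, RCLike.re (-σ * (starRingEnd ℂ) z / ‖z‖ * g x) := by
    rw [← integral_const_mul, ← RCLike.re_eq_complex_re, ← integral_re hgi]
  rw [hre]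
  have hlow : volume.real F * (‖z‖ / 2 * ((∫ y in E 0, σ * (b' y - α)) * (v * ρ ^ n) ^ k)) ≤
      ∫ x in F, RCLike.re (-σ * (starRingEnd ℂ) z / ‖z‖ * g x) := by
    have hFv : volume F ≠ ∞ :=
      ne_top_of_le_ne_top measure_closedBall_lt_top.ne (measure_mono Set.inter_subset_left)
    rw [← smul_eq_mul (volume.real F), ← setIntegral_const]
    exact setIntegral_mono_on_ae (integrableOn_const hFv) hgi.re hF hmain
  refine le_trans ?_ hlow
  have hz' : κ ≤ ‖z‖ * ρ ^ ((k + 1) * n) := (div_le_iff₀ (by positivity)).1 hz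
  have hN' : I / 4 ≤ ∫ y in E 0, σ * (b' y - α) := hN
  calc κ * v ^ (k + 1) / 16 * I ≤ (‖z‖ * ρ ^ ((k + 1) * n)) * v ^ (k + 1) / 16 * I := by gcongr
    _ = v * ρ ^ n / 2 * (‖z‖ / 2 * (I / 4 * (v * ρ ^ n) ^ k)) := by
        rw [mul_pow, ← pow_mul, add_mul, one_mul, pow_add, pow_succ v k, mul_comm n k]; ring
    _ ≤ _ := by gcongr

/-! ### Random signs, duality and the conclusion -/

theorem sum_units_mul {ι : Type} [Fintype ι] [DecidableEq ι] (j l : ι) :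
    ∑ e : ι → ℤˣ, ((e j : ℤ) : ℝ) * ((e l : ℤ) : ℝ) =
      if l = j then (Fintype.card (ι → ℤˣ) : ℝ) else 0 := by
  split_ifs with h
  · subst h
    have : ∀ e : ι → ℤˣ, ((e l : ℤ) : ℝ) * ((e l : ℤ) : ℝ) = 1 := fun e => by
      rcases Int.units_eq_one_or (e l) with h | h <;> simp [h]
    simp [this]
  · let s : ι → ℤˣ := Pi.mulSingle j (-1)
    have h1 := Fintype.sum_equiv (Equiv.mulLeft s)
      (fun e : ι → ℤˣ => -(((e j : ℤ) : ℝ) * ((e l : ℤ) : ℝ)))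
      (fun e : ι → ℤˣ => ((e j : ℤ) : ℝ) * ((e l : ℤ) : ℝ)) (fun e => by
        simp [s, Pi.mulSingle_eq_of_ne h])
    rw [Finset.sum_neg_distrib] at h1
    linarith

/-- With independent signs in every slot, the product has mean one if `J` is constantly `j` and mean
zero otherwise. The average of the right side is therefore the diagonal sum, and some choice of
signs is at least as good. -/
theorem exists_signs {ι : Type} [Fintype ι] {m : ℕ} (Φ : ι → (Fin m → ι) → ℝ) :
    ∃ ε : Fin m → ι → ℤˣ, ∑ j, Φ j (fun _ => j) ≤
      ∑ j, ∑ J : Fin m → ι, ((∏ i, ((ε i j : ℤ) : ℝ)) * ∏ i, ((ε i (J i) : ℤ) : ℝ)) * Φ j J := by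
  classical
  have key : ∀ j (J : Fin m → ι), ∑ ε : Fin m → ι → ℤˣ,
      ((∏ i, ((ε i j : ℤ) : ℝ)) * ∏ i, ((ε i (J i) : ℤ) : ℝ)) =
      if J = fun _ => j then (Fintype.card (Fin m → ι → ℤˣ) : ℝ) else 0 := by
    intro j J
    simp only [← Finset.prod_mul_distrib]
    have h1 := Finset.prod_univ_sum (fun _ : Fin m => (Finset.univ : Finset (ι → ℤˣ)))
      (fun i e => ((e j : ℤ) : ℝ) * ((e (J i) : ℤ) : ℝ))
    rw [Fintype.piFinset_univ] at h1
    rw [← h1]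
    simp only [sum_units_mul]
    split_ifs with h
    · subst h
      simp
    · obtain ⟨i, hi⟩ := Function.ne_iff.1 h
      exact Finset.prod_eq_zero (Finset.mem_univ i) (if_neg hi)
  have hsum : ∑ _ε : Fin m → ι → ℤˣ, ∑ j, Φ j (fun _ => j) ≤ ∑ ε : Fin m → ι → ℤˣ,
      ∑ j, ∑ J : Fin m → ι, ((∏ i, ((ε i j : ℤ) : ℝ)) * ∏ i, ((ε i (J i) : ℤ) : ℝ)) * Φ j J := by
    rw [Finset.sum_comm]
    refine le_of_eq ?_
    conv_rhs => rw [Finset.sum_comm]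
    refine Finset.sum_congr rfl fun j _ => ?_
    rw [Finset.sum_comm]
    simp only [← Finset.sum_mul, key, ite_mul, zero_mul, Finset.sum_ite_eq', Finset.mem_univ,
      if_true]
    simp
  obtain ⟨ε, -, hε⟩ := Finset.exists_le_of_sum_le Finset.univ_nonempty hsum
  exact ⟨ε, hε⟩

/-- Multilinearity of the commutator, with representatives `G J` chosen before the coefficients: the
signs will be selected from integrals of the `G J`. -/
theorem IsCZO.exists_commutator_expansion {n k : ℕ} (hn : 0 < n) {T : InitialOperator n (k + 1)}
    (hT : IsCZO T) {b : Rn n → ℝ} {ι : Type*} [Fintype ι] {u : Fin (k + 1) → ι → Rn n → ℂ}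
    (hu : ∀ i j, MemLinftyC (u i j)) (hbu : ∀ j, MemLinftyC fun x => (b x : ℂ) * u 0 j x) :
    ∃ G : (Fin (k + 1) → ι) → Rn n → ℂ,
      (∀ J, IsCommutatorValue b T 0 (fun i => u i (J i)) (G J)) ∧
      ∀ a : Fin (k + 1) → ι → ℂ, IsCommutatorValue b T 0 (fun i x => ∑ j, a i j * u i j x)
        fun x => ∑ J : Fin (k + 1) → ι, (∏ i, a i (J i)) * G J x := by
  let u' : Fin (k + 1) → ι → Rn n → ℂ := Function.update u 0 fun j x => (b x : ℂ) * u 0 j x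
  have hu' : ∀ i j, MemLinftyC (u' i j) := by
    intro i j
    by_cases hi : i = 0
    · subst hi; simpa [u'] using hbu j
    · simpa [u', hi] using hu i j
  choose h₀ hv₀ using fun J : Fin (k + 1) → ι => hT.exists_isValue hn (fun i => hu i (J i))
  choose h₁ hv₁ using fun J : Fin (k + 1) → ι => hT.exists_isValue hn (fun i => hu' i (J i))
  refine ⟨fun J x => (b x : ℂ) * h₀ J x - h₁ J x, fun J => ⟨h₀ J, h₁ J, hv₀ J, ?_, .rfl⟩, fun a =>
    ⟨∑ J : Fin (k + 1) → ι, (∏ i, a i (J i)) • h₀ J, ∑ J : Fin (k + 1) → ι, (∏ i, a i (J i)) • h₁ J,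
      hT.isValue_sum hn hu a hv₀, ?_, ?_⟩⟩
  · convert hv₁ J using 1
    ext i x
    by_cases hi : i = 0
    · subst hi; simp [u']
    · simp [u', hi]
  · convert hT.isValue_sum hn hu' a hv₁ using 1
    ext i x
    by_cases hi : i = 0
    · subst hi
      simp only [u', Function.update_self, Finset.mul_sum]
      exact Finset.sum_congr rfl fun j _ => by ring
    · simp [u', hi]
  · filter_upwards [coeFn_sum_smul (fun J : Fin (k + 1) → ι => ∏ i, a i (J i)) h₀,
      coeFn_sum_smul (fun J : Fin (k + 1) → ι => ∏ i, a i (J i)) h₁] with x hx₀ hx₁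
    rw [hx₀, hx₁, Finset.mul_sum, ← Finset.sum_sub_distrib]
    exact Finset.sum_congr rfl fun J _ => by ring

theorem SparseBalls.eLpNorm_le {n : ℕ} {Λ : ℝ≥0∞} (hΛ : Λ ≠ ∞) {s : ℝ} (hs : 1 < s) :
    ∃ C : ℝ≥0∞, C ≠ ∞ ∧ ∀ (ι : Type) [Fintype ι] (c : ι → Rn n) (ρ μ : ι → ℝ),
      SparseBalls Λ c ρ → (∀ j, 0 < ρ j) → (∀ j, 0 ≤ μ j) → ∀ f : Rn n → ℂ,
      (∀ x, ‖f x‖ ≤ ∑ j, (Metric.closedBall (c j) (ρ j)).indicator (fun _ => μ j) x) →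
      eLpNorm f (ENNReal.ofReal s) volume ≤ (C * ∑ j, ENNReal.ofReal (μ j ^ s) *
        volume (Metric.closedBall (c j) (ρ j))) ^ (1 / s) := by
  obtain ⟨C, hC, h⟩ := CarlesonPacking.lintegral_sum_indicator_rpow_le n hΛ hs
  have hs0 : 0 < s := by linarith
  refine ⟨C, hC, fun ι _ c ρ μ hsp hρ hμ f hf => ?_⟩
  rw [eLpNorm_eq_lintegral_rpow_enorm_toReal (by simpa using hs0) ENNReal.ofReal_ne_top,
    ENNReal.toReal_ofReal hs0.le]
  refine ENNReal.rpow_le_rpow (le_trans (lintegral_mono fun x => ?_)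
    (h ι c ρ μ hsp.carlesonPacking hρ hμ)) (by positivity)
  rw [← ofReal_norm, ENNReal.ofReal_rpow_of_nonneg (norm_nonneg _) hs0.le]
  exact ENNReal.ofReal_le_ofReal (Real.rpow_le_rpow (norm_nonneg _) (hf x) hs0.le)

theorem IsCommutatorValue.aestronglyMeasurable {n m : ℕ} {b : Rn n → ℝ} {T : InitialOperator n m}
    {i : Fin m} {f : Fin m → Rn n → ℂ} {g : Rn n → ℂ} (h : IsCommutatorValue b T i f g)
    (hb : AEStronglyMeasurable b volume) : AEStronglyMeasurable g volume := by
  obtain ⟨h₀, h₁, -, -, hg⟩ := h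
  exact (((Complex.continuous_ofReal.comp_aestronglyMeasurable hb).mul
    h₀.aestronglyMeasurable).sub h₁.aestronglyMeasurable).congr hg.symm

theorem CommutatorBounded.memLp {n m : ℕ} {b : Rn n → ℝ} {T : InitialOperator n m}
    {i : Fin m} {p : Fin m → ℝ≥0∞} {q : ℝ≥0∞} (hbdd : CommutatorBounded b T i p q)
    (hb : AEStronglyMeasurable b volume) {f : Fin m → Rn n → ℂ} {g : Rn n → ℂ}
    (h : IsCommutatorValue b T i f g) : MemLp g q volume := by
  refine ⟨h.aestronglyMeasurable hb, ?_⟩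
  obtain ⟨C, hC⟩ := hbdd
  refine (hC f g h).trans_lt (ENNReal.mul_lt_top ENNReal.coe_lt_top
    (ENNReal.prod_lt_top fun j _ => ?_))
  obtain ⟨h₀, -, hv, -⟩ := h
  exact ((hv.1 j).memLp _).eLpNorm_lt_top

theorem prod_rpow_eq_rpow_sum {ι : Type*} (s : Finset ι) (X : ℝ≥0∞) {e : ι → ℝ}
    (he : ∀ i ∈ s, 0 ≤ e i) : ∏ i ∈ s, X ^ e i = X ^ ∑ i ∈ s, e i := by
  classical
  induction s using Finset.induction_on with
  | empty => simp
  | insert a s ha ih =>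
    rw [Finset.prod_insert ha, Finset.sum_insert ha, ih fun i hi => he i (Finset.mem_insert_of_mem hi),
      ENNReal.rpow_add_of_nonneg _ _ (he a (Finset.mem_insert_self _ _))
        (Finset.sum_nonneg fun i hi => he i (Finset.mem_insert_of_mem hi))]

/-- Division by `X ^ (1 - 1 / r)`, which is legitimate only because `X` is known to be finite. -/
theorem le_rpow_of_mul_le {X κ D : ℝ≥0∞} {r : ℝ} (hr : 0 < r) (hX : X ≠ ∞) (hκ : κ ≠ 0)
    (hκ' : κ ≠ ∞) (h : κ * X ≤ D * X ^ (1 - 1 / r)) : X ≤ (D / κ) ^ r := by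
  rcases eq_or_ne X 0 with rfl | hX0
  · exact zero_le
  have h1 : X = X ^ (1 / r) * X ^ (1 - 1 / r) := by
    rw [← ENNReal.rpow_add _ _ hX0 hX, add_sub_cancel, ENNReal.rpow_one]
  have h0 : X ^ (1 - 1 / r) ≠ 0 := by simp [ENNReal.rpow_eq_zero_iff, hX0, hX]
  have ht : X ^ (1 - 1 / r) ≠ ∞ := by simp [ENNReal.rpow_eq_top_iff, hX0, hX]
  have h2 : κ * X ^ (1 / r) * X ^ (1 - 1 / r) ≤ D * X ^ (1 - 1 / r) := by
    rwa [mul_assoc, ← h1]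
  replace h2 := (ENNReal.mul_le_mul_iff_left h0 ht).1 h2
  have h3 : X ^ (1 / r) ≤ D / κ := by
    rw [ENNReal.le_div_iff_mul_le (Or.inl hκ) (Or.inl hκ'), mul_comm]; exact h2
  calc X = (X ^ (1 / r)) ^ r := by
        rw [← ENNReal.rpow_mul, one_div_mul_cancel hr.ne', ENNReal.rpow_one]
    _ ≤ _ := ENNReal.rpow_le_rpow h3 hr.le

theorem norm_sum_indicator_le {n : ℕ} {ι : Type} [Fintype ι] (c : ι → Rn n) (ρ : ι → ℝ)
    {S : ι → Set (Rn n)} (hS : ∀ j, S j ⊆ Metric.closedBall (c j) (ρ j)) (w : ι → ℂ) {μ : ι → ℝ}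
    (hw : ∀ j, ‖w j‖ ≤ μ j) (x : Rn n) :
    ‖∑ j, w j * (S j).indicator (fun _ => (1 : ℂ)) x‖ ≤
      ∑ j, (Metric.closedBall (c j) (ρ j)).indicator (fun _ => μ j) x := by
  refine (norm_sum_le _ _).trans (Finset.sum_le_sum fun j _ => ?_)
  by_cases hx : x ∈ S j
  · rw [Set.indicator_of_mem hx, Set.indicator_of_mem (hS j hx), mul_one]
    exact hw j
  · rw [Set.indicator_of_notMem hx, mul_zero, norm_zero]
    exact Set.indicator_nonneg (fun _ _ => (norm_nonneg _).trans (hw j)) x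

theorem integral_sum_mul_sum {n : ℕ} {ι κ : Type*} [Fintype ι] [Fintype κ] {F : ι → Set (Rn n)}
    (hF : ∀ j, MeasurableSet (F j)) {G : κ → Rn n → ℂ} (hG : ∀ j J, IntegrableOn (G J) (F j))
    (w : ι → ℂ) (a : κ → ℂ) :
    ∫ x, (∑ j, w j * (F j).indicator (fun _ => (1 : ℂ)) x) * ∑ J, a J * G J x =
      ∑ j, ∑ J, w j * a J * ∫ x in F j, G J x := by
  have h1 : ∀ x, (∑ j, w j * (F j).indicator (fun _ => (1 : ℂ)) x) * ∑ J, a J * G J x =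
      ∑ j, ∑ J, w j * a J * (F j).indicator (G J) x := by
    intro x
    rw [Finset.sum_mul_sum]
    refine Finset.sum_congr rfl fun j _ => Finset.sum_congr rfl fun J _ => ?_
    by_cases hx : x ∈ F j <;> simp [hx]
    ring
  have hi : ∀ j J, Integrable fun x => w j * a J * (F j).indicator (G J) x := fun j J =>
    ((integrable_indicator_iff (hF j)).2 (hG j J)).const_mul _
  simp only [h1]
  rw [integral_finsetSum _ fun j _ => integrable_finsetSum _ fun J _ => hi j J]
  refine Finset.sum_congr rfl fun j _ => ?_
  rw [integral_finsetSum _ fun J _ => hi j J]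
  refine Finset.sum_congr rfl fun J _ => ?_
  rw [integral_const_mul, integral_indicator (hF j)]

theorem enorm_integral_mul_le {n : ℕ} {f g : Rn n → ℂ} {q q' : ℝ} (hqq : Real.HolderConjugate q' q)
    (hf : AEStronglyMeasurable f volume) (hg : AEStronglyMeasurable g volume) :
    ‖∫ x, f x * g x‖ₑ ≤ eLpNorm f (ENNReal.ofReal q') volume * eLpNorm g (ENNReal.ofReal q) volume := by
  have : ENNReal.HolderTriple (ENNReal.ofReal q') (ENNReal.ofReal q) 1 := hqq.ennrealOfReal
  refine (enorm_integral_le_lintegral_enorm _).trans ?_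
  have h := eLpNorm_smul_le_mul_eLpNorm (p := ENNReal.ofReal q') (q := ENNReal.ofReal q) (r := 1) hg hf
  rwa [eLpNorm_one_eq_lintegral_enorm] at h

/-- A linear pairing of one commutator with one function collects the lower bounds of all balls at
once. Hölder bounds it by `D X ^ (1 - 1/r)`, against the lower bound `κ X`. -/
theorem CommutatorBounded.memDotLp {n k : ℕ} (hn : 0 < n) {T : InitialOperator n (k + 1)}
    (hT : IsNondegenerateCZO T) {b : Rn n → ℝ} (hb : LocallyIntegrable b volume)
    {p : Fin (k + 1) → ℝ} {q r : ℝ} (hp : ∀ i, 1 < p i) (hq : 1 < q) (hr : 1 < r)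
    (hrel : 1 / r = 1 / q - ∑ i, 1 / p i)
    (hbdd : CommutatorBounded b T 0 (fun i => ENNReal.ofReal (p i)) (ENNReal.ofReal q)) :
    MemDotLp b (ENNReal.ofReal r) := by
  have hr0 : 0 < r := by linarith
  have hp0 : ∀ i, 0 < p i := fun i => zero_lt_one.trans (hp i)
  obtain ⟨q', hqq⟩ : ∃ q', Real.HolderConjugate q q' := ⟨_, Real.HolderConjugate.conjExponent hq⟩
  have hq' : 1 < q' := hqq.symm.lt
  have hq'0 : 0 < q' := by linarith
  have hexp : 1 / q' + ∑ i, 1 / p i = 1 - 1 / r := by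
    have := hqq.inv_add_inv_eq_one
    rw [← one_div, ← one_div] at this
    linarith
  have hbm := hb.aestronglyMeasurable
  refine memDotLp_of_sparse hn hb hr fun Λ hΛ => ?_
  obtain ⟨A, κ, hA, hκ, hloc⟩ := exists_local_lower_bound hn hT hb
  have hmem : ∀ {f g}, IsCommutatorValue b T 0 f g → MemLp g (ENNReal.ofReal q) volume :=
    fun h => hbdd.memLp hbm h
  obtain ⟨C, hC⟩ := hbdd
  choose Cp hCp hCpb using fun i => SparseBalls.eLpNorm_le (n := n) hΛ (hp i)
  obtain ⟨Cq, hCq, hCqb⟩ := SparseBalls.eLpNorm_le (n := n)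
    (ENNReal.mul_ne_top (ENNReal.ofReal_ne_top (r := A ^ n)) hΛ) hq'
  set D : ℝ≥0∞ := (Cq * ENNReal.ofReal (A ^ n)) ^ (1 / q') * (C * ∏ i, Cp i ^ (1 / p i)) with hD
  have hDt : D ≠ ∞ := by
    refine ENNReal.mul_ne_top (ENNReal.rpow_ne_top_of_nonneg (by positivity)
      (ENNReal.mul_ne_top hCq ENNReal.ofReal_ne_top)) (ENNReal.mul_ne_top ENNReal.coe_ne_top
        (ENNReal.prod_ne_top fun i _ => ENNReal.rpow_ne_top_of_nonneg ?_ (hCp i)))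
    exact (one_div_pos.2 (hp0 i)).le
  refine ⟨(D / ENNReal.ofReal κ) ^ r, ENNReal.rpow_ne_top_of_nonneg hr0.le
    (ENNReal.div_ne_top hDt (by simpa using hκ)), ?_⟩
  intro ι _ c ρ hρ hsp o ho hosc
  choose α E F θ hE hF hEB hFB hθ hbu hlow using fun j => hloc (c j) (ρ j) (hρ j)
  -- The weights are chosen so that each of them, raised to its own exponent, is `o j ^ r`; their
  -- product is then `o j ^ (r - 1)`, one factor short of `o j ^ r`, and the local lower bound
  -- supplies that factor.
  set μ : Fin (k + 1) → ι → ℝ := fun i j => o j ^ (r / p i) with hμ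
  set ν : ι → ℝ := fun j => o j ^ (r / q') with hν
  have hμ0 : ∀ i j, 0 ≤ μ i j := fun i j => Real.rpow_nonneg (ho j) _
  have hν0 : ∀ j, 0 ≤ ν j := fun j => Real.rpow_nonneg (ho j) _
  have hμp : ∀ i j, μ i j ^ p i = o j ^ r := fun i j => by
    rw [hμ, ← Real.rpow_mul (ho j), div_mul_cancel₀ _ (hp0 i).ne']
  have hνq : ∀ j, ν j ^ q' = o j ^ r := fun j => by
    rw [hν, ← Real.rpow_mul (ho j), div_mul_cancel₀ _ hq'0.ne']
  have hprod : ∀ j, ν j * ∏ i, μ i j = o j ^ (r - 1) := by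
    intro j
    have h1 : ∀ i, 0 ≤ r / p i := fun i => div_nonneg hr0.le (hp0 i).le
    rw [hν, hμ, ← Real.rpow_sum_of_nonneg (ho j) fun i _ => h1 i,
      ← Real.rpow_add_of_nonneg (ho j) (by positivity) (Finset.sum_nonneg fun i _ => h1 i)]
    congr 1
    have h2 : r / q' + ∑ i, r / p i = r * (1 / q' + ∑ i, 1 / p i) := by
      rw [mul_add, Finset.mul_sum]; simp only [mul_one_div]
    rw [h2, hexp]
    field_simp
  have hu : ∀ i j, MemLinftyC (indicatorTuple (E j) i) := fun i j =>
    memLinftyC_indicator (hE j i) (hEB j i) (N := 1) aestronglyMeasurable_const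
      (Eventually.of_forall fun x _ => by simp)
  obtain ⟨G, hG, hGa⟩ := hT.1.exists_commutator_expansion hn hu hbu
  have hFv : ∀ j, volume (F j) < ∞ := fun j =>
    (measure_mono (hFB j)).trans_lt measure_closedBall_lt_top
  have hGF : ∀ j J, IntegrableOn (G J) (F j) := fun j J => by
    have : IsFiniteMeasure (volume.restrict (F j)) := ⟨by simpa using hFv j⟩
    exact ((hmem (hG J)).restrict (F j)).integrable (by simpa using hq.le)
  let Φ : ι → (Fin (k + 1) → ι) → ℝ := fun j J =>
    (ν j * ∏ i, μ i (J i)) * (θ j * ∫ x in F j, G J x).re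
  obtain ⟨ε, hε⟩ := exists_signs Φ
  -- The dual weight carries the product of the signs of all slots, so that the signs cancel exactly
  -- on the diagonal.
  let w : ι → ℂ := fun j => ((∏ i, ((ε i j : ℤ) : ℝ)) * ν j : ℝ) * θ j
  let a : Fin (k + 1) → ι → ℂ := fun i j => ((((ε i j : ℤ) : ℝ) * μ i j : ℝ) : ℂ)
  have hεabs : ∀ i j, |((ε i j : ℤ) : ℝ)| = 1 := fun i j => by
    rcases Int.units_eq_one_or (ε i j) with h | h <;> simp [h]
  have hw : ∀ j, ‖w j‖ ≤ ν j := fun j => by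
    simp only [w]
    rw [norm_mul, Complex.norm_real, Real.norm_eq_abs, abs_mul, Finset.abs_prod,
      Finset.prod_congr rfl fun i _ => hεabs i j, Finset.prod_const_one, one_mul,
      abs_of_nonneg (hν0 j)]
    exact mul_le_of_le_one_right (hν0 j) (hθ j)
  have ha : ∀ i j, ‖a i j‖ ≤ μ i j := fun i j => by
    simp only [a]
    rw [Complex.norm_real, Real.norm_eq_abs, abs_mul, hεabs, one_mul, abs_of_nonneg (hμ0 i j)]
  let f : Rn n → ℂ := fun x => ∑ j, w j * (F j).indicator (fun _ => (1 : ℂ)) x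
  let g : Rn n → ℂ := fun x => ∑ J : Fin (k + 1) → ι, (∏ i, a i (J i)) * G J x
  have hre : (∫ x, f x * g x).re = ∑ j, ∑ J : Fin (k + 1) → ι,
      ((∏ i, ((ε i j : ℤ) : ℝ)) * ∏ i, ((ε i (J i) : ℤ) : ℝ)) * Φ j J := by
    rw [integral_sum_mul_sum hF hGF w, Complex.re_sum]
    refine Finset.sum_congr rfl fun j _ => ?_
    rw [Complex.re_sum]
    refine Finset.sum_congr rfl fun J _ => ?_
    have h1 : w j * (∏ i, a i (J i)) * ∫ x in F j, G J x =
        ((((∏ i, ((ε i j : ℤ) : ℝ)) * ∏ i, ((ε i (J i) : ℤ) : ℝ)) * (ν j * ∏ i, μ i (J i)) : ℝ) : ℂ) *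
          (θ j * ∫ x in F j, G J x) := by
      simp only [w, a, ← Complex.ofReal_prod, Finset.prod_mul_distrib]
      push_cast
      ring
    rw [h1, Complex.re_ofReal_mul, mul_assoc]
  set X : ℝ≥0∞ := ∑ j, ENNReal.ofReal (o j ^ r) * volume (Metric.closedBall (c j) (ρ j)) with hX
  have hXt : X ≠ ∞ := ENNReal.sum_ne_top.2 fun j _ =>
    ENNReal.mul_ne_top ENNReal.ofReal_ne_top measure_closedBall_lt_top.ne
  refine le_rpow_of_mul_le hr0 hXt (by simpa using hκ) ENNReal.ofReal_ne_top ?_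
  have hlower : ENNReal.ofReal κ * X ≤ ‖∫ x, f x * g x‖ₑ := by
    have h1 : X = ENNReal.ofReal (∑ j, o j ^ r * volume.real (Metric.closedBall (c j) (ρ j))) := by
      rw [hX, ENNReal.ofReal_sum_of_nonneg fun j _ => mul_nonneg (Real.rpow_nonneg (ho j) _)
        measureReal_nonneg]
      refine Finset.sum_congr rfl fun j _ => ?_
      rw [ENNReal.ofReal_mul (Real.rpow_nonneg (ho j) _), ofReal_measureReal
        measure_closedBall_lt_top.ne]
    rw [h1, ← ENNReal.ofReal_mul hκ.le, ← ofReal_norm]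
    refine ENNReal.ofReal_le_ofReal (le_trans ?_ ((le_abs_self _).trans (Complex.abs_re_le_norm _)))
    rw [hre]
    refine le_trans ?_ hε
    rw [Finset.mul_sum]
    refine Finset.sum_le_sum fun j _ => ?_
    simp only [Φ]
    rw [hprod]
    have h2 : o j ^ r = o j ^ (r - 1) * o j := by
      rcases (ho j).eq_or_lt with h | h
      · rw [← h, mul_zero, Real.zero_rpow hr0.ne']
      · rw [Real.rpow_sub_one h.ne']; field_simp
    have h3 := hlow j _ (hG fun _ => j) (hGF j _)
    calc κ * (o j ^ r * volume.real (Metric.closedBall (c j) (ρ j)))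
        = o j ^ (r - 1) * (κ * (o j * volume.real (Metric.closedBall (c j) (ρ j)))) := by
          rw [h2]; ring
      _ ≤ o j ^ (r - 1) * (κ * ∫ x in Metric.closedBall (c j) (ρ j), |b x - α j|) :=
          mul_le_mul_of_nonneg_left (mul_le_mul_of_nonneg_left (hosc j _) hκ.le)
            (Real.rpow_nonneg (ho j) _)
      _ ≤ _ := mul_le_mul_of_nonneg_left h3 (Real.rpow_nonneg (ho j) _)
  refine hlower.trans ?_
  have hf : AEStronglyMeasurable f volume := by
    refine Finset.aestronglyMeasurable_fun_sum _ fun j _ => ?_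
    exact (aestronglyMeasurable_const.indicator (hF j)).const_mul _
  refine (enorm_integral_mul_le hqq.symm hf (hmem (hGa a)).1).trans ?_
  have hf' : eLpNorm f (ENNReal.ofReal q') volume ≤
      (Cq * ENNReal.ofReal (A ^ n)) ^ (1 / q') * X ^ (1 / q') := by
    refine (hCqb ι c (fun j => A * ρ j) ν (hsp.dilate hρ hA)
      (fun j => mul_pos (zero_lt_one.trans_le hA) (hρ j)) hν0 f
      (norm_sum_indicator_le c _ hFB w hw)).trans (le_of_eq ?_)
    rw [← ENNReal.mul_rpow_of_nonneg _ _ (by positivity), mul_assoc, hX]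
    congr 2
    rw [Finset.mul_sum]
    refine Finset.sum_congr rfl fun j _ => ?_
    rw [hνq, Measure.addHaar_closedBall_mul _ _ (by linarith) (hρ j).le,
      ← Measure.addHaar_closedBall_center volume (c j)]
    simp only [finrank_euclideanSpace, Fintype.card_fin]
    ring
  have hg' : eLpNorm g (ENNReal.ofReal q) volume ≤
      C * ∏ i, (Cp i ^ (1 / p i) * X ^ (1 / p i)) := by
    refine (hC _ _ (hGa a)).trans (mul_le_mul_right (Finset.prod_le_prod' fun i _ => ?_) _)
    refine (hCpb i ι c ρ (μ i) hsp hρ (hμ0 i) _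
      (norm_sum_indicator_le c ρ (fun j => hEB j i) (a i) (ha i))).trans (le_of_eq ?_)
    rw [← ENNReal.mul_rpow_of_nonneg _ _ (one_div_pos.2 (hp0 i)).le]
    simp only [hμp, hX]
  refine (mul_le_mul' hf' hg').trans (le_of_eq ?_)
  rw [Finset.prod_mul_distrib, prod_rpow_eq_rpow_sum _ _ fun i _ => (one_div_pos.2 (hp0 i)).le,
    ← hexp, ENNReal.rpow_add_of_nonneg _ _ (by positivity)
      (Finset.sum_nonneg fun i _ => (one_div_pos.2 (hp0 i)).le), hD]
  ring

end MultilinearCZ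

theorem theorem3p3 {n m : ℕ} (hn : 0 < n) (hm : 2 ≤ m)
    (p q r : ℝ) (ps : Fin m → ℝ)
    (hq : 1 < q) (hqp : q < p)
    (hps : ∀ i, 1 < ps i) (hp : 1 / p = ∑ i, 1 / ps i)
    (hr : 1 / r = 1 / q - 1 / p)
    (T : MultilinearCZ.InitialOperator n m) (hT : MultilinearCZ.IsNondegenerateCZO T)
    (b : MultilinearCZ.Rn n → ℝ) (hb : LocallyIntegrable b volume)
    (hbdd : MultilinearCZ.CommutatorBounded b T ⟨0, by omega⟩
      (fun i => ENNReal.ofReal (ps i)) (ENNReal.ofReal q)) :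
    MultilinearCZ.MemDotLp b (ENNReal.ofReal r) := by
  obtain ⟨k, rfl⟩ := Nat.exists_eq_add_of_le' (show 1 ≤ m by omega)
  have hq0 : 0 < q := by linarith
  have hp0 : 0 < p := by linarith
  have h1 : 1 / p < 1 / q := one_div_lt_one_div_of_lt hq0 hqp
  have h2 : 1 / q < 1 := (div_lt_one hq0).2 hq
  have h3 : 0 < 1 / p := one_div_pos.2 hp0
  have hr0 : 0 < r := one_div_pos.1 (by linarith)
  have hr1 : 1 < r := (div_lt_one hr0).1 (by linarith)
  exact hbdd.memDotLp hn hT hb hps hq hr1 (by rw [hr, hp])
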